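/- Consider the stationary M/G/1 queue: customers arrive according to a Poisson process of rate $\lambda>0$ and are served by a single server, first come first served, with service times that are independent, independent of the arrivals, and have a common distribution $G$ on $[0,\infty)$. Let $g_k=\int x^k\,dG(x)$, and assume $g_1>0$, $g_3<\infty$ and $\rho:=\lambda g_1<1$. The queue is stationary: the state at time $0$ (the number $Q(0)$ of customers in the system together with the residual service time of the customer in service, if any) is independent of the arrivals after time $0$ and of the service times not yet begun, and its distribution is invariant, i.e. the state has the same distribution at every time $t\ge 0$. Let $$c^2=\frac{g_2}{g_1^2}-1,\qquad \gamma=\frac{2g_1^3-3g_1g_2+g_3}{(g_2-g_1^2)^{3/2}}$$ be the squared coefficient of variation and the skewness coefficient of $G$, where $c\ge 0$; if $G$ is degenerate ($c=0$), $\gamma c^3$ is read as $0$. Let $D(t)$ be the number of service completions during $[0,t]$ and let $v(t)=\mathrm{Var}(D(t))$ be its variance curve. Suppose that there exist real numbers $\overline v$ and $\overline b_e$ such that $v(t)=\overline v\,t+\overline b_e+o(1)$ as $t\to\infty$. Then $$\overline b_e=L_e\,\frac{\rho}{(1-\rho)^2},\qquad L_e=\frac{(3c^4-4\gamma c^3+6c^2-1)\rho^3+(4\gamma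 c^3-12c^2+4)\rho^2+(6c^2-6)\rho}{6}.$$ -/

import Mathlib

open MeasureTheory ProbabilityTheory Filter Asymptotics

noncomputable section

namespace MG1

/-! ### Moments of the service-time distribution -/

/-- The `k`-th moment `g_k` of the distribution `G`. -/
def moment (G : Measure ℝ) (k : ℕ) : ℝ := ∫ x, x ^ k ∂G

/-- The squared coefficient of variation `c² = g₂ / g₁² - 1`. -/
def scv (G : Measure ℝ) : ℝ := moment G 2 / moment G 1 ^ 2 - 1

/-- The coefficient of variation `c = √(c²)`. -/
def cv (G : Measure ℝ) : ℝ := √(scv G)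

/-- The skewness coefficient `γ = (2 g₁³ - 3 g₁ g₂ + g₃) / (g₂ - g₁²)^(3/2)`. For a degenerate
distribution it is `0 / 0`, read as `0`; only the product `γ c³` is used, and it equals
`(2 g₁³ - 3 g₁ g₂ + g₃) / g₁³` in the nondegenerate case and `0` (the value of the same
expression) in the degenerate case. -/
def skewness (G : Measure ℝ) : ℝ :=
  (2 * moment G 1 ^ 3 - 3 * moment G 1 * moment G 2 + moment G 3) /
    (moment G 2 - moment G 1 ^ 2) ^ (3 / 2 : ℝ)

/-! ### Sample paths of the single-server first-come-first-served queue

A sample path is determined by the number `q₀` of customers present at time `0`, the residual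
service time `r₀` of the one then in service (if `q₀ > 0`), the interarrival times `ξ 0, ξ 1, …`
after time `0`, and the service times `S 0, S 1, …`. Customers are numbered `0, 1, 2, …` in the
order of service; the customers `i < q₀` are those present at time `0`. -/

/-- The `n`-th arrival epoch after time `0`. -/
def arrivalEpoch (ξ : ℕ → ℝ) (n : ℕ) : ℝ := ∑ k ∈ Finset.range (n + 1), ξ k

/-- The time from which customer `i` is available for service: `0` for a customer present at
time `0`, and the arrival epoch otherwise. -/
def availableTime (q₀ : ℕ) (ξ : ℕ → ℝ) (i : ℕ) : ℝ :=
  if i < q₀ then 0 else arrivalEpoch ξ (i - q₀)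

/-- The amount of service that customer `i` still requires when first available: the residual
service time `r₀` for the customer in service at time `0`, and a full service time otherwise. -/
def requirement (q₀ : ℕ) (r₀ : ℝ) (S : ℕ → ℝ) (i : ℕ) : ℝ :=
  if i = 0 ∧ 0 < q₀ then r₀ else S i

/-- The departure time of customer `i`: the service of customer `i + 1` begins as soon as that
customer is available and customer `i` has left. -/
def departureTime (q₀ : ℕ) (r₀ : ℝ) (ξ S : ℕ → ℝ) : ℕ → ℝ
  | 0 => availableTime q₀ ξ 0 + requirement q₀ r₀ S 0
  | i + 1 => max (availableTime q₀ ξ (i + 1)) (departureTime q₀ r₀ ξ S i) +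
      requirement q₀ r₀ S (i + 1)

/-- `D(t)`: the number of service completions during `[0, t]`. -/
def departures (q₀ : ℕ) (r₀ : ℝ) (ξ S : ℕ → ℝ) (t : ℝ) : ℕ :=
  {i : ℕ | departureTime q₀ r₀ ξ S i ≤ t}.ncard

/-- `Q(t)`: the number of customers in the system at time `t`. -/
def queueLength (q₀ : ℕ) (r₀ : ℝ) (ξ S : ℕ → ℝ) (t : ℝ) : ℕ :=
  {i : ℕ | availableTime q₀ ξ i ≤ t ∧ t < departureTime q₀ r₀ ξ S i}.ncard

/-- `R(t)`: the residual service time at time `t` of the customer then in service, who is the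
customer numbered `D(t)`; it is `0` if the system is empty. -/
def residualService (q₀ : ℕ) (r₀ : ℝ) (ξ S : ℕ → ℝ) (t : ℝ) : ℝ :=
  if queueLength q₀ r₀ ξ S t = 0 then 0
  else departureTime q₀ r₀ ξ S (departures q₀ r₀ ξ S t) - t

/-! ### The stationary M/G/1 queue -/

/-- The random data `q₀, r₀, ξ, S` describe a stationary M/G/1 queue with arrival rate `lam` and
service-time distribution `G`, on the probability space `(Ω, μ)`: the interarrival times are
independent and exponential of rate `lam` (Poisson arrivals), the service times are independent
with distribution `G`, these two sequences and the initial state are independent of each other,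
and the distribution of the state `(Q(t), R(t))` of the queue (a Markov process) is the same at
all times `t ≥ 0`, namely that of the initial state `(q₀, r₀)`. -/
structure IsStationary {Ω : Type*} [MeasurableSpace Ω] (μ : Measure Ω) (lam : ℝ) (G : Measure ℝ)
    (q₀ : Ω → ℕ) (r₀ : Ω → ℝ) (ξ S : ℕ → Ω → ℝ) : Prop where
  measurable_q₀ : Measurable q₀
  measurable_r₀ : Measurable r₀
  measurable_ξ : ∀ n, Measurable (ξ n)
  measurable_S : ∀ n, Measurable (S n)
  law_ξ : ∀ n, HasLaw (ξ n) (expMeasure lam) μ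
  law_S : ∀ n, HasLaw (S n) G μ
  indep_ξ : iIndepFun ξ μ
  indep_S : iIndepFun S μ
  indep_inputs : IndepFun (fun ω n => ξ n ω) (fun ω n => S n ω) μ
  indep_initial :
    IndepFun (fun ω => (q₀ ω, r₀ ω)) (fun ω => ((fun n => ξ n ω), (fun n => S n ω))) μ
  residual_initial : ∀ᵐ ω ∂μ, (q₀ ω = 0 → r₀ ω = 0) ∧ (0 < q₀ ω → 0 < r₀ ω)
  invariant : ∀ t : ℝ, 0 ≤ t →
    μ.map (fun ω =>
      (queueLength (q₀ ω) (r₀ ω) (fun n => ξ n ω) (fun n => S n ω) t,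
        residualService (q₀ ω) (r₀ ω) (fun n => ξ n ω) (fun n => S n ω) t)) =
      μ.map (fun ω => (q₀ ω, r₀ ω))

/-- The variance curve `v(t) = Var(D(t))` of the departure process. -/
def varianceCurve {Ω : Type*} [MeasurableSpace Ω] (μ : Measure Ω)
    (q₀ : Ω → ℕ) (r₀ : Ω → ℝ) (ξ S : ℕ → Ω → ℝ) (t : ℝ) : ℝ :=
  variance (fun ω =>
    (departures (q₀ ω) (r₀ ω) (fun n => ξ n ω) (fun n => S n ω) t : ℝ)) μ

end MG1

end

/-!
# The intercept of the variance curve of the departures from a stationary M/G/1 queue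

Write `A t` for the number of arrivals, `D t` for the number of departures and `Q t` for the number
of customers present, `R t` for the residual service time and `Y t` for the number waiting. Since
`D t = A t + Q 0 - Q t`, with `A t` Poisson and independent of `Q 0`, and `Q` is stationary,
`Var (D t) = lam t + 2 Var Q - 2 Cov (Q t, A t + Q 0)` (`variance_departures`). If `Var (D t)` has
a linear asymptote, so has the covariance; hence its long-run average, if it exists, is its limit,
and it determines the intercept (`intercept_eq_of_average`, `intercept_eq`). Thus no mixing of the
queue is needed, only a Cesàro limit and the stationary variance of `Q`.

*Dynkin's formula.* Between events `R` decreases at unit rate; at the start of a service one waiting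
customer is exchanged for a service time drawn from `G`. For functions `f` with
`E f(y, S) = f(y + 1, 0)` (`TestFunction`) the latter has no expected effect, so the only jumps that
matter are those at arrivals. The sample-path identity `evolution` and the compensation of Poisson
arrivals (`lintegral_sum_arrivals`) give Dynkin's formula for `(α (A t - lam t) + β) f(Y t, R t)`
(`dynkin`, `dynkin_stationary`), and, in the stationary state, that the generator has mean zero
(`integral_generator_eq_zero`).

*The Cesàro limit.* There is a quadratic test function `f` whose generator is `- g₁ (Q - E Q)`
(`poissonSol`, `generator_poissonSol`). Dynkin's formula with weight `A t - lam t + β`, divided by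
`t`, then shows that the average of `Cov (Q, A + β)` converges to `lam / g₁` times the mean
increment of `f` at an arrival, for every bounded function `β` of the initial state
(`tendsto_average_covar`). With third moments of `G` the state has only two moments, so that
`A t - lam t` and `f(Y t, R t)` cannot be separated by the Cauchy–Schwarz inequality in the boundary
term; instead the event that `A t` is far from its mean is separated off
(`tendsto_weighted_growth`). Finally `Q 0 - E Q`, which need not be bounded, is approximated in
mean square by bounded `β`; the resulting error in the covariance is uniform in time
(`abs_covar_sub_le`, `exists_bounded_approx`).

*Stationary moments.* Exponential test functions give the Pollaczek–Khinchine transform of the work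
(`integral_workExp_mul`), whence the finiteness of the second moments (`integrable_growth`) and the
first two moments of the work. Further test functions give the moments of `R` and the mixed moment of
`R` and `Y`, and these together give `Var Q` (`variance_number`).
-/

set_option linter.unusedSectionVars false

noncomputable section

namespace MG1

open scoped ENNReal

/-! ### Counting functions of monotone sequences -/

/-- The natural numbers with a property that is inherited downwards and fails somewhere form an
initial segment, of length their number. -/
lemma lt_ncard_iff_of_lower {p : ℕ → Prop} (h : ∀ i j, i ≤ j → p j → p i) (hn : ∃ n, ¬ p n)
    (i : ℕ) : i < {n | p n}.ncard ↔ p i := by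
  classical
  have hset : {n | p n} = ((Finset.range (Nat.find hn) : Finset ℕ) : Set ℕ) := by
    ext n
    simp only [Set.mem_ofPred_eq, Finset.coe_range, Set.mem_Iio]
    constructor
    · intro hp
      by_contra hlt
      exact Nat.find_spec hn (h _ _ (not_lt.mp hlt) hp)
    · intro hlt
      exact not_not.mp (Nat.find_min hn hlt)
  have hi : i ∈ {n | p n} ↔ i < Nat.find hn := by rw [hset]; simp
  rw [hset, Set.ncard_coe_finset, Finset.card_range]
  exact hi.symm

/-- The number of arrivals in `(0, t]`. -/
def arrivalCount (ξ : ℕ → ℝ) (t : ℝ) : ℕ := {n | arrivalEpoch ξ n ≤ t}.ncard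

/-- The number of arrivals in `(0, t)`: the left limit of `arrivalCount`. -/
def arrivalCountBefore (ξ : ℕ → ℝ) (t : ℝ) : ℕ := {n | arrivalEpoch ξ n < t}.ncard

/-- The epoch at which the service of customer `i` begins (`0` for a customer whose service was
under way at time `0`). -/
def startTime (q₀ : ℕ) (r₀ : ℝ) (ξ S : ℕ → ℝ) : ℕ → ℝ
  | 0 => availableTime q₀ ξ 0
  | i + 1 => max (availableTime q₀ ξ (i + 1)) (departureTime q₀ r₀ ξ S i)

/-- The epoch from which customer `i` is the next to be served: the departure time of the
preceding customer, and `0` for the first one. -/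
def readyTime (q₀ : ℕ) (r₀ : ℝ) (ξ S : ℕ → ℝ) : ℕ → ℝ
  | 0 => 0
  | i + 1 => departureTime q₀ r₀ ξ S i

/-- The number of service completions during `[0, t)`. -/
def departuresBefore (q₀ : ℕ) (r₀ : ℝ) (ξ S : ℕ → ℝ) (t : ℝ) : ℕ :=
  {i : ℕ | departureTime q₀ r₀ ξ S i < t}.ncard

/-- The number of customers waiting (not in service) at time `t`. -/
def waiting (q₀ : ℕ) (r₀ : ℝ) (ξ S : ℕ → ℝ) (t : ℝ) : ℕ := queueLength q₀ r₀ ξ S t - 1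

/-- The number of customers waiting just before time `t`. -/
def waitingBefore (q₀ : ℕ) (r₀ : ℝ) (ξ S : ℕ → ℝ) (t : ℝ) : ℕ :=
  if startTime q₀ r₀ ξ S (departuresBefore q₀ r₀ ξ S t) < t then
    q₀ + arrivalCountBefore ξ t - departuresBefore q₀ r₀ ξ S t - 1
  else 0

/-- The residual service time just before time `t`, or `0` if the system is then empty. -/
def residualBefore (q₀ : ℕ) (r₀ : ℝ) (ξ S : ℕ → ℝ) (t : ℝ) : ℝ :=
  if startTime q₀ r₀ ξ S (departuresBefore q₀ r₀ ξ S t) < t then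
    departureTime q₀ r₀ ξ S (departuresBefore q₀ r₀ ξ S t) - t
  else 0

/-- The regularity, valid almost surely, under which sample paths are analysed: distinct arrival
epochs that do not accumulate, nonnegative service times, and a consistent initial state. -/
structure GoodPath (q₀ : ℕ) (r₀ : ℝ) (ξ S : ℕ → ℝ) : Prop where
  xi_pos : ∀ n, 0 < ξ n
  unbounded : ∀ t, ∃ n, t < arrivalEpoch ξ n
  S_nonneg : ∀ n, 0 ≤ S n
  empty : q₀ = 0 → r₀ = 0
  busy : 0 < q₀ → 0 < r₀

lemma arrivalEpoch_succ (ξ : ℕ → ℝ) (n : ℕ) :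
    arrivalEpoch ξ (n + 1) = arrivalEpoch ξ n + ξ (n + 1) :=
  Finset.sum_range_succ _ _

lemma departureTime_eq (q₀ : ℕ) (r₀ : ℝ) (ξ S : ℕ → ℝ) (i : ℕ) :
    departureTime q₀ r₀ ξ S i = startTime q₀ r₀ ξ S i + requirement q₀ r₀ S i := by
  cases i <;> rfl

lemma availableTime_le_startTime (q₀ : ℕ) (r₀ : ℝ) (ξ S : ℕ → ℝ) (i : ℕ) :
    availableTime q₀ ξ i ≤ startTime q₀ r₀ ξ S i := by
  cases i
  · exact le_rfl
  · exact le_max_left _ _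

namespace GoodPath

variable {q₀ : ℕ} {r₀ : ℝ} {ξ S : ℕ → ℝ} (h : GoodPath q₀ r₀ ξ S)
include h

lemma arrivalEpoch_strictMono : StrictMono (arrivalEpoch ξ) :=
  strictMono_nat_of_lt_succ fun n => by
    rw [arrivalEpoch_succ]; linarith [h.xi_pos (n + 1)]

lemma arrivalEpoch_pos (n : ℕ) : 0 < arrivalEpoch ξ n :=
  Finset.sum_pos (fun k _ => h.xi_pos k) ⟨0, by simp⟩

lemma lt_arrivalCount_iff (n : ℕ) (t : ℝ) : n < arrivalCount ξ t ↔ arrivalEpoch ξ n ≤ t :=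
  lt_ncard_iff_of_lower (fun _ _ hij hj => (h.arrivalEpoch_strictMono.monotone hij).trans hj)
    (by obtain ⟨n, hn⟩ := h.unbounded t; exact ⟨n, not_le.mpr hn⟩) n

lemma lt_arrivalCountBefore_iff (n : ℕ) (t : ℝ) :
    n < arrivalCountBefore ξ t ↔ arrivalEpoch ξ n < t :=
  lt_ncard_iff_of_lower (fun _ _ hij hj => (h.arrivalEpoch_strictMono.monotone hij).trans_lt hj)
    (by obtain ⟨n, hn⟩ := h.unbounded t; exact ⟨n, not_lt.mpr hn.le⟩) n

lemma arrivalCount_le_iff (n : ℕ) (t : ℝ) : arrivalCount ξ t ≤ n ↔ t < arrivalEpoch ξ n := by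
  rw [← not_lt, h.lt_arrivalCount_iff, not_le]

lemma arrivalCountBefore_le_iff (n : ℕ) (t : ℝ) :
    arrivalCountBefore ξ t ≤ n ↔ t ≤ arrivalEpoch ξ n := by
  rw [← not_lt, h.lt_arrivalCountBefore_iff, not_lt]

lemma arrivalCount_zero : arrivalCount ξ 0 = 0 :=
  Nat.le_zero.mp ((h.arrivalCount_le_iff 0 0).mpr (h.arrivalEpoch_pos 0))

lemma arrivalCount_mono {s t : ℝ} (hst : s ≤ t) : arrivalCount ξ s ≤ arrivalCount ξ t := by
  by_contra hlt
  exact lt_irrefl _ ((h.lt_arrivalCount_iff _ t).mpr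
    (((h.lt_arrivalCount_iff _ s).mp (not_le.mp hlt)).trans hst))

lemma arrivalCountBefore_le {s t : ℝ} (hst : s ≤ t) : arrivalCountBefore ξ s ≤ arrivalCount ξ t := by
  by_contra hlt
  exact lt_irrefl _ ((h.lt_arrivalCount_iff _ t).mpr
    (((h.lt_arrivalCountBefore_iff _ s).mp (not_le.mp hlt)).le.trans hst))

lemma arrivalCountBefore_arrivalEpoch (n : ℕ) :
    arrivalCountBefore ξ (arrivalEpoch ξ n) = n := by
  refine le_antisymm ((h.arrivalCountBefore_le_iff _ _).mpr le_rfl) ?_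
  by_contra hlt
  have := (h.arrivalCountBefore_le_iff _ _).mp (Nat.le_of_lt_succ (Nat.lt_succ_of_lt (not_le.mp hlt)))
  have h2 := (h.arrivalCountBefore_le_iff (arrivalCountBefore ξ (arrivalEpoch ξ n)) _).mp le_rfl
  exact absurd (h.arrivalEpoch_strictMono (not_le.mp hlt)) (not_lt.mpr h2)

/-! The customers available for service by time `t` are those numbered below
`q₀ + arrivalCount ξ t`. -/

lemma availableTime_nonneg (i : ℕ) : 0 ≤ availableTime q₀ ξ i := by
  unfold availableTime; split_ifs
  · exact le_rfl
  · exact (h.arrivalEpoch_pos _).le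

lemma availableTime_le_iff (i : ℕ) {t : ℝ} (ht : 0 ≤ t) :
    availableTime q₀ ξ i ≤ t ↔ i < q₀ + arrivalCount ξ t := by
  unfold availableTime; split_ifs with hi
  · simp only [ht, true_iff]; omega
  · rw [← h.lt_arrivalCount_iff]; omega

lemma availableTime_lt_iff (i : ℕ) {t : ℝ} (ht : 0 < t) :
    availableTime q₀ ξ i < t ↔ i < q₀ + arrivalCountBefore ξ t := by
  unfold availableTime; split_ifs with hi
  · simp only [ht, true_iff]; omega
  · rw [← h.lt_arrivalCountBefore_iff]; omega

lemma availableTime_mono : Monotone (availableTime q₀ ξ) := fun i j hij => by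
  have hj := (h.availableTime_le_iff j (h.availableTime_nonneg j)).mp le_rfl
  exact (h.availableTime_le_iff i (h.availableTime_nonneg j)).mpr (hij.trans_lt hj)

lemma requirement_nonneg (i : ℕ) : 0 ≤ requirement q₀ r₀ S i := by
  unfold requirement; split_ifs with hi
  · exact (h.busy hi.2).le
  · exact h.S_nonneg i

lemma readyTime_le_startTime (i : ℕ) : readyTime q₀ r₀ ξ S i ≤ startTime q₀ r₀ ξ S i := by
  cases i
  · exact h.availableTime_nonneg 0
  · exact le_max_right _ _

/-- Lindley's recursion: a service starts once the customer has arrived and the preceding one has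
left. -/
lemma startTime_eq_max (i : ℕ) :
    startTime q₀ r₀ ξ S i = max (availableTime q₀ ξ i) (readyTime q₀ r₀ ξ S i) := by
  cases i
  · exact (max_eq_left (h.availableTime_nonneg 0)).symm
  · rfl

lemma startTime_le_departureTime (i : ℕ) :
    startTime q₀ r₀ ξ S i ≤ departureTime q₀ r₀ ξ S i := by
  rw [departureTime_eq]; linarith [h.requirement_nonneg i]

lemma departureTime_mono : Monotone (departureTime q₀ r₀ ξ S) :=
  monotone_nat_of_le_succ fun i =>
    (h.readyTime_le_startTime (i + 1)).trans (h.startTime_le_departureTime (i + 1))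

lemma readyTime_nonneg (i : ℕ) : 0 ≤ readyTime q₀ r₀ ξ S i := by
  cases i with
  | zero => exact le_rfl
  | succ i => exact (h.availableTime_nonneg i).trans ((availableTime_le_startTime q₀ r₀ ξ S i).trans
      (h.startTime_le_departureTime i))

lemma availableTime_le_departureTime (i : ℕ) :
    availableTime q₀ ξ i ≤ departureTime q₀ r₀ ξ S i :=
  (availableTime_le_startTime q₀ r₀ ξ S i).trans (h.startTime_le_departureTime i)

lemma departureTime_unbounded {t : ℝ} (ht : 0 ≤ t) : t < departureTime q₀ r₀ ξ S (q₀ + arrivalCount ξ t) := by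
  refine lt_of_lt_of_le ?_ (h.availableTime_le_departureTime _)
  exact not_le.mp fun hle => lt_irrefl _ ((h.availableTime_le_iff _ ht).mp hle)

lemma lt_departures_iff (i : ℕ) {t : ℝ} (ht : 0 ≤ t) :
    i < departures q₀ r₀ ξ S t ↔ departureTime q₀ r₀ ξ S i ≤ t :=
  lt_ncard_iff_of_lower (fun _ _ hij hj => (h.departureTime_mono hij).trans hj)
    ⟨_, not_le.mpr (h.departureTime_unbounded ht)⟩ i

lemma lt_departuresBefore_iff (i : ℕ) {t : ℝ} (ht : 0 ≤ t) :
    i < departuresBefore q₀ r₀ ξ S t ↔ departureTime q₀ r₀ ξ S i < t :=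
  lt_ncard_iff_of_lower (fun _ _ hij hj => (h.departureTime_mono hij).trans_lt hj)
    ⟨_, not_lt.mpr (h.departureTime_unbounded ht).le⟩ i

lemma departures_le {t : ℝ} (ht : 0 ≤ t) : departures q₀ r₀ ξ S t ≤ q₀ + arrivalCount ξ t := by
  by_contra hlt
  exact absurd ((h.lt_departures_iff _ ht).mp (not_le.mp hlt))
    (not_le.mpr (h.departureTime_unbounded ht))

/-- Customers in the system are those who have arrived and not yet left. -/
lemma queueLength_eq {t : ℝ} (ht : 0 ≤ t) :
    queueLength q₀ r₀ ξ S t = q₀ + arrivalCount ξ t - departures q₀ r₀ ξ S t := by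
  have : {i : ℕ | availableTime q₀ ξ i ≤ t ∧ t < departureTime q₀ r₀ ξ S i} =
      ((Finset.Ico (departures q₀ r₀ ξ S t) (q₀ + arrivalCount ξ t) : Finset ℕ) : Set ℕ) := by
    ext i
    simp only [Set.mem_ofPred_eq, Finset.coe_Ico, Set.mem_Ico]
    rw [h.availableTime_le_iff i ht, ← not_le (a := departureTime q₀ r₀ ξ S i),
      ← h.lt_departures_iff i ht]
    omega
  rw [queueLength, this, Set.ncard_coe_finset, Nat.card_Ico]

lemma departures_eq_of_mem {i : ℕ} {t : ℝ} (h1 : readyTime q₀ r₀ ξ S i ≤ t)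
    (h2 : t < departureTime q₀ r₀ ξ S i) : departures q₀ r₀ ξ S t = i := by
  have ht : 0 ≤ t := (h.readyTime_nonneg i).trans h1
  refine le_antisymm (not_lt.mp fun hlt => absurd ((h.lt_departures_iff _ ht).mp hlt)
    (not_le.mpr h2)) ?_
  cases i with
  | zero => exact Nat.zero_le _
  | succ i => exact (h.lt_departures_iff _ ht).mpr h1

lemma departuresBefore_eq_of_mem {i : ℕ} {t : ℝ} (h1 : readyTime q₀ r₀ ξ S i < t)
    (h2 : t ≤ departureTime q₀ r₀ ξ S i) : departuresBefore q₀ r₀ ξ S t = i := by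
  have ht : 0 ≤ t := (h.readyTime_nonneg i).trans h1.le
  refine le_antisymm (not_lt.mp fun hlt => absurd ((h.lt_departuresBefore_iff _ ht).mp hlt)
    (not_lt.mpr h2)) ?_
  cases i with
  | zero => exact Nat.zero_le _
  | succ i => exact (h.lt_departuresBefore_iff _ ht).mpr h1

lemma readyTime_departures_le {t : ℝ} (ht : 0 ≤ t) :
    readyTime q₀ r₀ ξ S (departures q₀ r₀ ξ S t) ≤ t := by
  rcases hd : departures q₀ r₀ ξ S t with _ | i
  · exact ht
  · exact (h.lt_departures_iff i ht).mp (by omega)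

lemma lt_departureTime_departures {t : ℝ} (ht : 0 ≤ t) :
    t < departureTime q₀ r₀ ξ S (departures q₀ r₀ ξ S t) :=
  not_le.mp fun hle => lt_irrefl _ ((h.lt_departures_iff _ ht).mpr hle)

/-- While the server is idle, all customers that have arrived have left. -/
lemma arrivalCountBefore_eq_of_idle {i : ℕ} {v : ℝ} (h1 : readyTime q₀ r₀ ξ S i < v)
    (h2 : v ≤ startTime q₀ r₀ ξ S i) : q₀ + arrivalCountBefore ξ v = i := by
  have hv : 0 < v := (h.readyTime_nonneg i).trans_lt h1
  have hav : ¬ availableTime q₀ ξ i < v := by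
    rw [h.startTime_eq_max] at h2
    rcases le_max_iff.mp h2 with h3 | h3
    · exact not_lt.mpr h3
    · exact absurd h1 (not_lt.mpr h3)
  rw [h.availableTime_lt_iff i hv] at hav
  refine le_antisymm (not_lt.mp hav) ?_
  cases i with
  | zero => exact Nat.zero_le _
  | succ i => exact Nat.succ_le_of_lt ((h.availableTime_lt_iff i hv).mp
      ((h.availableTime_le_departureTime i).trans_lt h1))

lemma arrivalCount_eq_of_idle {i : ℕ} {v : ℝ} (h1 : readyTime q₀ r₀ ξ S i ≤ v)
    (h2 : v < startTime q₀ r₀ ξ S i) : q₀ + arrivalCount ξ v = i := by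
  have hv : 0 ≤ v := (h.readyTime_nonneg i).trans h1
  have hav : ¬ availableTime q₀ ξ i ≤ v := by
    rw [h.startTime_eq_max] at h2
    rcases lt_max_iff.mp h2 with h3 | h3
    · exact not_le.mpr h3
    · exact absurd h1 (not_le.mpr h3)
  rw [h.availableTime_le_iff i hv] at hav
  refine le_antisymm (not_lt.mp hav) ?_
  cases i with
  | zero => exact Nat.zero_le _
  | succ i => exact Nat.succ_le_of_lt ((h.availableTime_le_iff i hv).mp
      ((h.availableTime_le_departureTime i).trans h1))

/-! The state in terms of the service cycles. -/

/-- From the departure of customer `i - 1` to the start of service of customer `i` the system is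
empty. -/
lemma state_of_idle {i : ℕ} {t : ℝ} (h1 : readyTime q₀ r₀ ξ S i ≤ t)
    (h2 : t < startTime q₀ r₀ ξ S i) :
    queueLength q₀ r₀ ξ S t = 0 ∧ residualService q₀ r₀ ξ S t = 0 := by
  have ht : 0 ≤ t := (h.readyTime_nonneg i).trans h1
  have hq : queueLength q₀ r₀ ξ S t = 0 := by
    rw [h.queueLength_eq ht,
      h.departures_eq_of_mem h1 (h2.trans_le (h.startTime_le_departureTime i)),
      h.arrivalCount_eq_of_idle h1 h2, Nat.sub_self]
  exact ⟨hq, by rw [residualService, if_pos hq]⟩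

/-- During the service of customer `i`, the customers numbered from `i` on that have arrived are in
the system, and the residual service time decreases to the departure time. -/
lemma state_of_busy {i : ℕ} {t : ℝ} (h1 : startTime q₀ r₀ ξ S i ≤ t)
    (h2 : t < departureTime q₀ r₀ ξ S i) :
    queueLength q₀ r₀ ξ S t = q₀ + arrivalCount ξ t - i ∧ 0 < queueLength q₀ r₀ ξ S t ∧
    residualService q₀ r₀ ξ S t = departureTime q₀ r₀ ξ S i - t := by
  have h3 := (h.readyTime_le_startTime i).trans h1
  have ht : 0 ≤ t := (h.readyTime_nonneg i).trans h3
  have hd := h.departures_eq_of_mem h3 h2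
  have hq : queueLength q₀ r₀ ξ S t = q₀ + arrivalCount ξ t - i := by
    rw [h.queueLength_eq ht, hd]
  have hav := (h.availableTime_le_iff i ht).mp ((availableTime_le_startTime q₀ r₀ ξ S i).trans h1)
  have hpos : 0 < queueLength q₀ r₀ ξ S t := by omega
  exact ⟨hq, hpos, by rw [residualService, if_neg hpos.ne', hd]⟩

lemma stateBefore_of_idle {i : ℕ} {t : ℝ} (h1 : readyTime q₀ r₀ ξ S i < t)
    (h2 : t ≤ startTime q₀ r₀ ξ S i) :
    waitingBefore q₀ r₀ ξ S t = 0 ∧ residualBefore q₀ r₀ ξ S t = 0 := by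
  have hd := h.departuresBefore_eq_of_mem h1 (h2.trans (h.startTime_le_departureTime i))
  simp only [waitingBefore, residualBefore, hd, if_neg (not_lt.mpr h2), and_self]

lemma stateBefore_of_busy {i : ℕ} {t : ℝ} (h1 : startTime q₀ r₀ ξ S i < t)
    (h2 : t ≤ departureTime q₀ r₀ ξ S i) :
    waitingBefore q₀ r₀ ξ S t = q₀ + arrivalCountBefore ξ t - i - 1 ∧
    residualBefore q₀ r₀ ξ S t = departureTime q₀ r₀ ξ S i - t := by
  have hd := h.departuresBefore_eq_of_mem ((h.readyTime_le_startTime i).trans_lt h1) h2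
  simp only [waitingBefore, residualBefore, hd, if_pos h1, and_self]

end GoodPath

/-! ### The evolution of a function of the state along a sample path -/

/-- The derivative of `w (A t) t * f (Y t) (R t)` along a stretch of path without events, as a
function of the number of arrivals `a`, the time `v`, the number waiting `y` and the residual
service time `r`. -/
def drift (w w' : ℕ → ℝ → ℝ) (f f' : ℕ → ℝ → ℝ) (a : ℕ) (v : ℝ) (y : ℕ) (r : ℝ) : ℝ :=
  w' a v * f y r - w a v * (if 0 < r then f' y r else 0)

/-- The jump of `w (A t) t * f (Y t) (R t)` at an arrival, when the start of a service for a
customer who meets an empty system is accounted for separately. -/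
def arrivalJump (w : ℕ → ℝ → ℝ) (f : ℕ → ℝ → ℝ) (a : ℕ) (v : ℝ) (y : ℕ) (r : ℝ) : ℝ :=
  w (a + 1) v * f (y + 1) r - w a v * f y r

/-- The change of `w (A t) t * f (Y t) (R t)` at the start of the service of customer `i`, where
the state before the start is regarded as one with residual service time `0`. -/
def startJump (w : ℕ → ℝ → ℝ) (f : ℕ → ℝ → ℝ) (q₀ : ℕ) (r₀ : ℝ) (ξ S : ℕ → ℝ) (i : ℕ) : ℝ :=
  w (arrivalCount ξ (startTime q₀ r₀ ξ S i)) (startTime q₀ r₀ ξ S i) *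
    (f (q₀ + arrivalCount ξ (startTime q₀ r₀ ξ S i) - i - 1) (requirement q₀ r₀ S i) -
      f (q₀ + arrivalCount ξ (startTime q₀ r₀ ξ S i) - i) 0)

lemma startJump_eq (w : ℕ → ℝ → ℝ) (f : ℕ → ℝ → ℝ) (q₀ : ℕ) (r₀ : ℝ) (ξ S : ℕ → ℝ) (i : ℕ) :
    startJump w f q₀ r₀ ξ S i =
      w (arrivalCount ξ (startTime q₀ r₀ ξ S i)) (startTime q₀ r₀ ξ S i) *
        f (q₀ + arrivalCount ξ (startTime q₀ r₀ ξ S i) - i - 1) (requirement q₀ r₀ S i) -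
      w (arrivalCount ξ (startTime q₀ r₀ ξ S i)) (startTime q₀ r₀ ξ S i) *
        f (q₀ + arrivalCount ξ (startTime q₀ r₀ ξ S i) - i) 0 :=
  mul_sub _ _ _

namespace GoodPath

variable {q₀ : ℕ} {r₀ : ℝ} {ξ S : ℕ → ℝ} (h : GoodPath q₀ r₀ ξ S)
include h

/-- A function of time and of the arrival count is the integral of its derivative plus the sum of
its jumps. -/
lemma counting_stieltjes {H H' : ℕ → ℝ → ℝ} (hH : ∀ n v, HasDerivAt (H n) (H' n v) v)
    (hH' : ∀ n, Continuous (H' n)) {s t : ℝ} (hst : s ≤ t) :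
    IntervalIntegrable (fun v => H' (arrivalCountBefore ξ v) v) volume s t ∧
    H (arrivalCount ξ t) t - H (arrivalCount ξ s) s =
      (∫ v in s..t, H' (arrivalCountBefore ξ v) v) +
      ∑ n ∈ Finset.Ico (arrivalCount ξ s) (arrivalCount ξ t),
        (H (n + 1) (arrivalEpoch ξ n) - H n (arrivalEpoch ξ n)) := by
  -- on a stretch without arrivals this is the fundamental theorem of calculus
  have key : ∀ N u t, u ≤ t → (∀ v, u < v → v ≤ t → arrivalCountBefore ξ v = N) →
      IntervalIntegrable (fun v => H' (arrivalCountBefore ξ v) v) volume u t ∧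
      H N t - H N u = ∫ v in u..t, H' (arrivalCountBefore ξ v) v := by
    intro N u t hut hN
    have hcongr : Set.EqOn (H' N) (fun v => H' (arrivalCountBefore ξ v) v) (Set.uIoc u t) := by
      intro v hv
      rw [Set.uIoc_of_le hut] at hv
      simp only [hN v hv.1 hv.2]
    refine ⟨((hH' N).intervalIntegrable u t).congr hcongr, ?_⟩
    rw [← intervalIntegral.integral_eq_sub_of_hasDerivAt (fun v _ => hH N v)
      ((hH' N).intervalIntegrable u t)]
    exact intervalIntegral.integral_congr_ae (Filter.Eventually.of_forall fun v hv => hcongr hv)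
  have main : ∀ N, arrivalCount ξ s ≤ N → ∀ t, s ≤ t → t ≤ arrivalEpoch ξ N →
      (∀ n < N, arrivalEpoch ξ n ≤ t) →
      IntervalIntegrable (fun v => H' (arrivalCountBefore ξ v) v) volume s t ∧
      H N t - H (arrivalCount ξ s) s =
      (∫ v in s..t, H' (arrivalCountBefore ξ v) v) +
      ∑ n ∈ Finset.Ico (arrivalCount ξ s) N,
        (H (n + 1) (arrivalEpoch ξ n) - H n (arrivalEpoch ξ n)) := by
    intro N hN
    induction N, hN using Nat.le_induction with
    | base =>
      intro t hst ht _
      have := key (arrivalCount ξ s) s t hst (fun v hv1 hv2 => by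
        refine le_antisymm ((h.arrivalCountBefore_le_iff _ _).mpr (hv2.trans ht)) ?_
        by_contra hlt
        have h1 := (h.lt_arrivalCount_iff _ s).mp (not_le.mp hlt)
        exact lt_irrefl _ ((h.lt_arrivalCountBefore_iff _ v).mpr (h1.trans_lt hv1)))
      simpa using this
    | succ N hN ih =>
      intro t hst ht hn
      have hsN : s < arrivalEpoch ξ N := (h.arrivalCount_le_iff _ _).mp hN
      obtain ⟨i1, e1⟩ := ih (arrivalEpoch ξ N) hsN.le le_rfl
        (fun n hn => (h.arrivalEpoch_strictMono hn).le)
      obtain ⟨i2, e2⟩ := key (N + 1) (arrivalEpoch ξ N) t (hn N N.lt_succ_self)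
        (fun v hv1 hv2 => le_antisymm ((h.arrivalCountBefore_le_iff _ _).mpr (hv2.trans ht))
          (Nat.succ_le_of_lt ((h.lt_arrivalCountBefore_iff _ _).mpr hv1)))
      refine ⟨i1.trans i2, ?_⟩
      rw [Finset.sum_Ico_succ_top hN, ← intervalIntegral.integral_add_adjacent_intervals i1 i2]
      linarith
  exact main _ (h.arrivalCount_mono hst) t hst ((h.arrivalCount_le_iff _ _).mp le_rfl).le
    (fun n hn => (h.lt_arrivalCount_iff _ _).mp hn)

variable {w w' : ℕ → ℝ → ℝ} {f f' : ℕ → ℝ → ℝ}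
  (hw : ∀ a v, HasDerivAt (w a) (w' a v) v) (hw' : ∀ a, Continuous (w' a))
  (hf : ∀ y r, HasDerivAt (f y) (f' y r) r) (hf' : ∀ y, Continuous (f' y))
include hw hw'

/-- The increment over part of an idle period, when customer `i` is next to be served. The state is
represented with that customer still counted as waiting, and residual service time `0`. -/
lemma increment_idle {i : ℕ} {s t : ℝ} (hs : readyTime q₀ r₀ ξ S i ≤ s) (hst : s ≤ t)
    (ht : t ≤ startTime q₀ r₀ ξ S i) :
    IntervalIntegrable (fun v => drift w w' f f' (arrivalCountBefore ξ v) v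
      (waitingBefore q₀ r₀ ξ S v) (residualBefore q₀ r₀ ξ S v)) volume s t ∧
    w (arrivalCount ξ t) t * f (q₀ + arrivalCount ξ t - i) 0 -
      w (arrivalCount ξ s) s * f (q₀ + arrivalCount ξ s - i) 0 =
      (∫ v in s..t, drift w w' f f' (arrivalCountBefore ξ v) v
        (waitingBefore q₀ r₀ ξ S v) (residualBefore q₀ r₀ ξ S v)) +
      ∑ n ∈ Finset.Ico (arrivalCount ξ s) (arrivalCount ξ t), arrivalJump w f n (arrivalEpoch ξ n)
        (waitingBefore q₀ r₀ ξ S (arrivalEpoch ξ n))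
        (residualBefore q₀ r₀ ξ S (arrivalEpoch ξ n)) := by
  obtain ⟨i1, e1⟩ := h.counting_stieltjes (H := fun a v => w a v * f (q₀ + a - i) 0)
    (H' := fun a v => w' a v * f (q₀ + a - i) 0) (fun a v => (hw a v).mul_const _)
    (fun a => (hw' a).mul continuous_const) hst
  have hcongr : Set.EqOn
      (fun v => w' (arrivalCountBefore ξ v) v * f (q₀ + arrivalCountBefore ξ v - i) 0)
      (fun v => drift w w' f f' (arrivalCountBefore ξ v) v
        (waitingBefore q₀ r₀ ξ S v) (residualBefore q₀ r₀ ξ S v)) (Set.uIoc s t) := by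
    intro v hv
    rw [Set.uIoc_of_le hst] at hv
    have h1 := hs.trans_lt hv.1
    have h2 := hv.2.trans ht
    obtain ⟨e1, e2⟩ := h.stateBefore_of_idle h1 h2
    have e3 := h.arrivalCountBefore_eq_of_idle h1 h2
    simp [drift, e1, e2, e3]
  refine ⟨i1.congr hcongr, ?_⟩
  rw [e1]
  congr 1
  · exact intervalIntegral.integral_congr_ae (Filter.Eventually.of_forall fun v hv => hcongr hv)
  · refine Finset.sum_congr rfl fun n hn => ?_
    rw [Finset.mem_Ico, h.arrivalCount_le_iff, h.lt_arrivalCount_iff] at hn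
    have h1 := hs.trans_lt hn.1
    have h2 := hn.2.trans ht
    obtain ⟨e1, e2⟩ := h.stateBefore_of_idle h1 h2
    have e3 := h.arrivalCountBefore_eq_of_idle h1 h2
    rw [h.arrivalCountBefore_arrivalEpoch] at e3
    have e4 : q₀ + (n + 1) - i = 1 := by omega
    have e5 : q₀ + n - i = 0 := by omega
    simp only [arrivalJump, e1, e2, e4, e5]

include hf hf'

/-- The increment over part of the service of customer `i`. -/
lemma increment_busy {i : ℕ} {s t : ℝ} (hs : startTime q₀ r₀ ξ S i ≤ s) (hst : s ≤ t)
    (ht : t ≤ departureTime q₀ r₀ ξ S i) :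
    IntervalIntegrable (fun v => drift w w' f f' (arrivalCountBefore ξ v) v
      (waitingBefore q₀ r₀ ξ S v) (residualBefore q₀ r₀ ξ S v)) volume s t ∧
    w (arrivalCount ξ t) t * f (q₀ + arrivalCount ξ t - i - 1) (departureTime q₀ r₀ ξ S i - t) -
      w (arrivalCount ξ s) s * f (q₀ + arrivalCount ξ s - i - 1) (departureTime q₀ r₀ ξ S i - s) =
      (∫ v in s..t, drift w w' f f' (arrivalCountBefore ξ v) v
        (waitingBefore q₀ r₀ ξ S v) (residualBefore q₀ r₀ ξ S v)) +
      ∑ n ∈ Finset.Ico (arrivalCount ξ s) (arrivalCount ξ t), arrivalJump w f n (arrivalEpoch ξ n)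
        (waitingBefore q₀ r₀ ξ S (arrivalEpoch ξ n))
        (residualBefore q₀ r₀ ξ S (arrivalEpoch ξ n)) := by
  set d := departureTime q₀ r₀ ξ S i with hd
  have hcf : ∀ y, Continuous (f y) := fun y =>
    continuous_iff_continuousAt.mpr fun r => (hf y r).continuousAt
  have hcw : ∀ a, Continuous (w a) := fun a =>
    continuous_iff_continuousAt.mpr fun v => (hw a v).continuousAt
  obtain ⟨i1, e1⟩ := h.counting_stieltjes (H := fun a v => w a v * f (q₀ + a - i - 1) (d - v))
    (H' := fun a v => w' a v * f (q₀ + a - i - 1) (d - v) +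
      w a v * -f' (q₀ + a - i - 1) (d - v))
    (fun a v => (hw a v).mul ((hf (q₀ + a - i - 1) (d - v)).comp_const_sub d v))
    (fun a => ((hw' a).mul ((hcf _).comp (continuous_const.sub continuous_id))).add
      ((hcw a).mul ((hf' _).comp (continuous_const.sub continuous_id)).neg)) hst
  have hcongr : ∀ v, v ≠ d → v ∈ Set.uIoc s t →
      w' (arrivalCountBefore ξ v) v * f (q₀ + arrivalCountBefore ξ v - i - 1) (d - v) +
        w (arrivalCountBefore ξ v) v * -f' (q₀ + arrivalCountBefore ξ v - i - 1) (d - v) =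
      drift w w' f f' (arrivalCountBefore ξ v) v
        (waitingBefore q₀ r₀ ξ S v) (residualBefore q₀ r₀ ξ S v) := by
    intro v hvd hv
    rw [Set.uIoc_of_le hst] at hv
    have h1 := hs.trans_lt hv.1
    have h2 := hv.2.trans ht
    obtain ⟨e1, e2⟩ := h.stateBefore_of_busy h1 h2
    have : 0 < d - v := sub_pos.mpr (lt_of_le_of_ne h2 hvd)
    rw [drift, e1, e2, if_pos this]
    ring
  have hae : ∀ᵐ v : ℝ, v ≠ d := by
    simp [ae_iff]
  have hcongr' : ∀ᵐ v : ℝ, v ∈ Set.uIoc s t → _ := hae.mono hcongr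
  refine ⟨i1.congr_ae ((ae_restrict_iff' measurableSet_uIoc).mpr hcongr'), ?_⟩
  rw [e1, intervalIntegral.integral_congr_ae hcongr']
  congr 1
  refine Finset.sum_congr rfl fun n hn => ?_
  rw [Finset.mem_Ico, h.arrivalCount_le_iff, h.lt_arrivalCount_iff] at hn
  have h1 := hs.trans_lt hn.1
  have h2 := hn.2.trans ht
  obtain ⟨e1, e2⟩ := h.stateBefore_of_busy h1 h2
  rw [h.arrivalCountBefore_arrivalEpoch] at e1
  have hav := (h.availableTime_lt_iff i (h.arrivalEpoch_pos n)).mp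
    ((availableTime_le_startTime q₀ r₀ ξ S i).trans_lt h1)
  rw [h.arrivalCountBefore_arrivalEpoch] at hav
  have e4 : q₀ + (n + 1) - i - 1 = q₀ + n - i - 1 + 1 := by omega
  simp only [arrivalJump, e1, e2, e4, hd]

/-- The evolution up to the end of the `i`-th service, by telescoping over service cycles. -/
lemma increment_readyTime (i : ℕ) :
    IntervalIntegrable (fun v => drift w w' f f' (arrivalCountBefore ξ v) v
      (waitingBefore q₀ r₀ ξ S v) (residualBefore q₀ r₀ ξ S v)) volume 0
        (readyTime q₀ r₀ ξ S i) ∧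
    w (arrivalCount ξ (readyTime q₀ r₀ ξ S i)) (readyTime q₀ r₀ ξ S i) *
        f (q₀ + arrivalCount ξ (readyTime q₀ r₀ ξ S i) - i) 0 =
      w 0 0 * f q₀ 0 +
      (∫ v in 0..readyTime q₀ r₀ ξ S i, drift w w' f f' (arrivalCountBefore ξ v) v
        (waitingBefore q₀ r₀ ξ S v) (residualBefore q₀ r₀ ξ S v)) +
      ∑ n ∈ Finset.Ico 0 (arrivalCount ξ (readyTime q₀ r₀ ξ S i)),
        arrivalJump w f n (arrivalEpoch ξ n)
          (waitingBefore q₀ r₀ ξ S (arrivalEpoch ξ n))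
          (residualBefore q₀ r₀ ξ S (arrivalEpoch ξ n)) +
      ∑ j ∈ Finset.range i, startJump w f q₀ r₀ ξ S j := by
  induction i with
  | zero => simp [readyTime, h.arrivalCount_zero]
  | succ i ih =>
    obtain ⟨i0, e0⟩ := ih
    obtain ⟨i1, e1⟩ := h.increment_idle (f := f) (f' := f') hw hw' le_rfl
      (h.readyTime_le_startTime i) le_rfl
    obtain ⟨i2, e2⟩ := h.increment_busy hw hw' hf hf' le_rfl (h.startTime_le_departureTime i) le_rfl
    have m1 := h.arrivalCount_mono (h.readyTime_le_startTime i)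
    have m2 := h.arrivalCount_mono (h.startTime_le_departureTime i)
    refine ⟨(i0.trans i1).trans i2, ?_⟩
    change w (arrivalCount ξ (departureTime q₀ r₀ ξ S i)) (departureTime q₀ r₀ ξ S i) * _ =
      _ + (∫ v in 0..departureTime q₀ r₀ ξ S i, _) +
      ∑ n ∈ Finset.Ico 0 (arrivalCount ξ (departureTime q₀ r₀ ξ S i)), _ + _
    rw [← intervalIntegral.integral_add_adjacent_intervals (i0.trans i1) i2,
      ← intervalIntegral.integral_add_adjacent_intervals i0 i1,
      ← Finset.sum_Ico_consecutive _ (Nat.zero_le _) m2,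
      ← Finset.sum_Ico_consecutive _ (Nat.zero_le _) m1, Finset.sum_range_succ, ← Nat.sub_sub]
    have e3 := startJump_eq w f q₀ r₀ ξ S i
    have e4 : departureTime q₀ r₀ ξ S i - startTime q₀ r₀ ξ S i = requirement q₀ r₀ S i := by
      rw [departureTime_eq]; ring
    rw [sub_self, e4] at e2
    change w (arrivalCount ξ (departureTime q₀ r₀ ξ S i)) (departureTime q₀ r₀ ξ S i) *
      f (q₀ + arrivalCount ξ (departureTime q₀ r₀ ξ S i) - i - 1) 0 = _
    linarith

/-- The evolution of `w (A t) t * f (Y t) (R t)`, where `A` counts arrivals, `Y` is the number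
waiting and `R` the residual service time: an integral between events, the jumps at arrivals and
the jumps at starts of services. A service under way at time `0` counts as started then. -/
theorem evolution {t : ℝ} (ht : 0 ≤ t) :
    IntervalIntegrable (fun v => drift w w' f f' (arrivalCountBefore ξ v) v
      (waitingBefore q₀ r₀ ξ S v) (residualBefore q₀ r₀ ξ S v)) volume 0 t ∧
    w (arrivalCount ξ t) t * f (waiting q₀ r₀ ξ S t) (residualService q₀ r₀ ξ S t) =
      w 0 0 * f q₀ 0 +
      (∫ v in 0..t, drift w w' f f' (arrivalCountBefore ξ v) v
        (waitingBefore q₀ r₀ ξ S v) (residualBefore q₀ r₀ ξ S v)) +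
      ∑ n ∈ Finset.range (arrivalCount ξ t),
        arrivalJump w f n (arrivalEpoch ξ n)
          (waitingBefore q₀ r₀ ξ S (arrivalEpoch ξ n))
          (residualBefore q₀ r₀ ξ S (arrivalEpoch ξ n)) +
      ∑ j ∈ Finset.range (q₀ + arrivalCount ξ t),
        if startTime q₀ r₀ ξ S j ≤ t then startJump w f q₀ r₀ ξ S j else 0 := by
  set i := departures q₀ r₀ ξ S t with hi
  have h1 : readyTime q₀ r₀ ξ S i ≤ t := h.readyTime_departures_le ht
  have h2 : t < departureTime q₀ r₀ ξ S i := h.lt_departureTime_departures ht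
  have hmono : Monotone (startTime q₀ r₀ ξ S) := monotone_nat_of_le_succ fun k =>
    (h.startTime_le_departureTime k).trans (h.readyTime_le_startTime (k + 1))
  have hstart : ∀ m, (∀ j, startTime q₀ r₀ ξ S j ≤ t ↔ j < m) →
      (∑ j ∈ Finset.range (q₀ + arrivalCount ξ t),
        if startTime q₀ r₀ ξ S j ≤ t then startJump w f q₀ r₀ ξ S j else 0) =
      ∑ j ∈ Finset.range m, startJump w f q₀ r₀ ξ S j := by
    intro m hm
    rw [← Finset.sum_filter]
    refine Finset.sum_congr ?_ fun _ _ => rfl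
    ext j
    rw [Finset.mem_filter, Finset.mem_range, Finset.mem_range, hm]
    refine ⟨fun hj => hj.2, fun hj => ⟨?_, hj⟩⟩
    exact (h.availableTime_le_iff j ht).mp
      ((availableTime_le_startTime q₀ r₀ ξ S j).trans ((hm j).mpr hj))
  obtain ⟨i0, e0⟩ := h.increment_readyTime hw hw' hf hf' i
  rcases lt_or_ge t (startTime q₀ r₀ ξ S i) with h3 | h3
  · obtain ⟨i1, e1⟩ := h.increment_idle (f := f) (f' := f') hw hw' le_rfl h1 h3.le
    refine ⟨i0.trans i1, ?_⟩
    obtain ⟨e2, e3⟩ := h.state_of_idle h1 h3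
    have e4 := h.arrivalCount_eq_of_idle h1 h3
    rw [hstart i fun j => ⟨fun hj => not_le.mp fun hij =>
        absurd ((hmono hij).trans hj) (not_le.mpr h3),
      fun hj => (h.startTime_le_departureTime j).trans ((h.lt_departures_iff j ht).mp hj)⟩,
      Finset.range_eq_Ico,
      ← Finset.sum_Ico_consecutive _ (Nat.zero_le _) (h.arrivalCount_mono h1),
      ← intervalIntegral.integral_add_adjacent_intervals i0 i1, waiting, e2, e3]
    have e5 : q₀ + arrivalCount ξ t - i = 0 := by omega
    rw [e5] at e1
    linarith
  · obtain ⟨i1, e1⟩ := h.increment_idle (f := f) (f' := f') hw hw' le_rfl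
      (h.readyTime_le_startTime i) le_rfl
    obtain ⟨i2, e2⟩ := h.increment_busy hw hw' hf hf' le_rfl h3 h2.le
    refine ⟨(i0.trans i1).trans i2, ?_⟩
    obtain ⟨e3, -, e4⟩ := h.state_of_busy h3 h2
    have m1 := h.arrivalCount_mono (h.readyTime_le_startTime i)
    have m2 := h.arrivalCount_mono h3
    rw [hstart (i + 1) fun j => ⟨fun hj => not_le.mp fun hij => absurd hj (not_le.mpr
        (h2.trans_le (h.readyTime_le_startTime (i + 1)) |>.trans_le (hmono hij))),
      fun hj => (hmono (Nat.lt_succ_iff.mp hj)).trans h3⟩,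
      Finset.sum_range_succ, Finset.range_eq_Ico,
      ← Finset.sum_Ico_consecutive _ (Nat.zero_le _) m2,
      ← Finset.sum_Ico_consecutive _ (Nat.zero_le _) m1,
      ← intervalIntegral.integral_add_adjacent_intervals (i0.trans i1) i2,
      ← intervalIntegral.integral_add_adjacent_intervals i0 i1, waiting, e3, e4]
    have e3 := startJump_eq w f q₀ r₀ ξ S i
    have e4 : departureTime q₀ r₀ ξ S i - startTime q₀ r₀ ξ S i = requirement q₀ r₀ S i := by
      rw [departureTime_eq]; ring
    rw [e4] at e2
    linarith

omit hw hw' hf hf'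

/-- Just before almost every time the state is what it is at that time. -/
lemma stateBefore_ae_eq : ∀ᵐ v : ℝ, 0 ≤ v →
    arrivalCountBefore ξ v = arrivalCount ξ v ∧
    waitingBefore q₀ r₀ ξ S v = waiting q₀ r₀ ξ S v ∧
    residualBefore q₀ r₀ ξ S v = residualService q₀ r₀ ξ S v := by
  have hcount : (Set.range (arrivalEpoch ξ) ∪ Set.range (startTime q₀ r₀ ξ S) ∪
      Set.range (readyTime q₀ r₀ ξ S)).Countable :=
    ((Set.countable_range _).union (Set.countable_range _)).union (Set.countable_range _)
  filter_upwards [hcount.ae_notMem volume] with v hv hv0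
  simp only [Set.mem_union, Set.mem_range, not_or, not_exists] at hv
  obtain ⟨⟨ha, hs⟩, hr⟩ := hv
  have eA : arrivalCountBefore ξ v = arrivalCount ξ v := by
    refine le_antisymm (h.arrivalCountBefore_le le_rfl) (not_lt.mp fun hlt => ?_)
    have h1 := (h.arrivalCountBefore_le_iff _ v).mp le_rfl
    have h2 := (h.lt_arrivalCount_iff _ _).mp hlt
    exact ha _ (le_antisymm h2 h1)
  refine ⟨eA, ?_⟩
  set i := departures q₀ r₀ ξ S v
  have h1 : readyTime q₀ r₀ ξ S i < v := lt_of_le_of_ne (h.readyTime_departures_le hv0) (hr i)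
  have h2 : v < departureTime q₀ r₀ ξ S i := h.lt_departureTime_departures hv0
  rcases lt_or_ge v (startTime q₀ r₀ ξ S i) with h3 | h3
  · obtain ⟨a1, a2⟩ := h.state_of_idle h1.le h3
    obtain ⟨b1, b2⟩ := h.stateBefore_of_idle h1 h3.le
    rw [waiting, a1, a2, b1, b2]; simp
  · obtain ⟨a1, -, a2⟩ := h.state_of_busy h3 h2
    obtain ⟨b1, b2⟩ := h.stateBefore_of_busy (lt_of_le_of_ne h3 (hs i)) h2.le
    rw [waiting, a1, a2, b1, b2, eA]; simp

end GoodPath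

/-! ### Resampling one coordinate of a product measure -/

section Resample

variable (m : Measure ℝ) [IsProbabilityMeasure m]

/-- The law of a sequence of independent random variables with distribution `m`. -/
abbrev iidLaw (m : Measure ℝ) : Measure (ℕ → ℝ) := Measure.infinitePi fun _ : ℕ => m

/-- Resampling one coordinate independently preserves the law of an i.i.d. sequence. -/
lemma map_update_iidLaw (n : ℕ) :
    ((iidLaw m).prod m).map (fun p : (ℕ → ℝ) × ℝ => Function.update p.1 n p.2) = iidLaw m := by
  classical
  have hmeas : Measurable (fun p : (ℕ → ℝ) × ℝ => Function.update p.1 n p.2) :=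
    measurable_update'
  refine Measure.eq_infinitePi (fun _ : ℕ => m) fun s t ht => ?_
  rw [Measure.map_apply hmeas (MeasurableSet.pi s.countable_toSet fun i _ => ht i)]
  by_cases hn : n ∈ s
  · have : (fun p : (ℕ → ℝ) × ℝ => Function.update p.1 n p.2) ⁻¹' (Set.pi s t) =
        (Set.pi (s.erase n : Finset ℕ) t) ×ˢ t n := by
      ext ⟨ξ, x⟩
      simp only [Set.mem_preimage, Set.mem_pi, Set.mem_prod, Finset.mem_coe, Finset.mem_erase]
      constructor
      · intro h
        exact ⟨fun i hi => by simpa [Function.update_of_ne hi.1] using h i hi.2,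
          by simpa using h n hn⟩
      · rintro ⟨h1, h2⟩ i hi
        by_cases hin : i = n
        · subst hin; simpa using h2
        · simpa [Function.update_of_ne hin] using h1 i ⟨hin, hi⟩
    rw [this, Measure.prod_prod, Measure.infinitePi_pi _ (fun i _ => ht i),
      Finset.prod_erase_mul _ _ hn]
  · have : (fun p : (ℕ → ℝ) × ℝ => Function.update p.1 n p.2) ⁻¹' (Set.pi s t) =
        (Set.pi s t) ×ˢ Set.univ := by
      ext ⟨ξ, x⟩
      simp only [Set.mem_preimage, Set.mem_pi, Set.mem_prod, Finset.mem_coe, Set.mem_univ, and_true]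
      refine forall₂_congr fun i hi => ?_
      rw [Function.update_of_ne (ne_of_mem_of_not_mem hi hn)]
    rw [this, Measure.prod_prod, Measure.infinitePi_pi _ (fun i _ => ht i), measure_univ, mul_one]

lemma lintegral_update_iidLaw (n : ℕ) {F : (ℕ → ℝ) → ℝ≥0∞} (hF : Measurable F) :
    ∫⁻ ξ, F ξ ∂iidLaw m = ∫⁻ ξ, ∫⁻ x, F (Function.update ξ n x) ∂m ∂iidLaw m := by
  conv_lhs => rw [← map_update_iidLaw m n]
  rw [lintegral_map hF measurable_update', lintegral_prod]
  exact (hF.comp measurable_update').aemeasurable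

lemma integral_update_iidLaw (n : ℕ) {F : (ℕ → ℝ) → ℝ} (hF : Measurable F)
    (hint : Integrable F (iidLaw m)) :
    ∫ ξ, F ξ ∂iidLaw m = ∫ ξ, ∫ x, F (Function.update ξ n x) ∂m ∂iidLaw m := by
  have hmp : MeasurePreserving (fun p : (ℕ → ℝ) × ℝ => Function.update p.1 n p.2)
      ((iidLaw m).prod m) (iidLaw m) := ⟨measurable_update', map_update_iidLaw m n⟩
  conv_lhs => rw [← map_update_iidLaw m n]
  rw [integral_map measurable_update'.aemeasurable hF.aestronglyMeasurable]
  exact integral_prod (fun p : (ℕ → ℝ) × ℝ => F (Function.update p.1 n p.2))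
    (hmp.integrable_comp_of_integrable hint)

lemma ae_forall_iidLaw {p : ℝ → Prop} (hp : ∀ᵐ x ∂m, p x) : ∀ᵐ ξ ∂iidLaw m, ∀ n, p (ξ n) :=
  ae_all_iff.mpr fun n =>
    (measurePreserving_eval_infinitePi (fun _ : ℕ => m) n).quasiMeasurePreserving.ae hp

end Resample

/-! ### Compensation of Poisson arrivals -/

section Exponential

variable {lam : ℝ} (hlam : 0 < lam)
include hlam

omit hlam in
lemma expMeasure_eq_withDensity : expMeasure lam = volume.withDensity (exponentialPDF lam) := by
  rfl

lemma ae_pos_expMeasure : ∀ᵐ x ∂expMeasure lam, 0 < x := by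
  have hlt : (expMeasure lam) (Set.Iic 0) = 0 := by
    rw [expMeasure_eq_withDensity, withDensity_apply _ measurableSet_Iic,
      lintegral_exponentialPDF_eq_antiDeriv hlam]
    simp
  rw [ae_iff]
  simpa [Set.Iic] using hlt

lemma expMeasure_Ici {u : ℝ} (hu : 0 ≤ u) :
    expMeasure lam (Set.Ici u) = ENNReal.ofReal (Real.exp (-(lam * u))) := by
  have := isProbabilityMeasure_expMeasure hlam
  have h1 : expMeasure lam (Set.Iic u) = ENNReal.ofReal (1 - Real.exp (-(lam * u))) := by
    rw [expMeasure_eq_withDensity, withDensity_apply _ measurableSet_Iic,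
      lintegral_exponentialPDF_eq_antiDeriv hlam, if_pos hu]
  have hne : expMeasure lam ≪ volume := by
    rw [expMeasure_eq_withDensity]; exact withDensity_absolutelyContinuous _ _
  have h0 : expMeasure lam {u} = 0 := hne (by simp)
  have h2 : expMeasure lam (Set.Ici u) = expMeasure lam (Set.Ioi u) := by
    rw [← Set.Ioi_union_left]
    refine le_antisymm ((measure_union_le _ _).trans (by rw [h0, add_zero])) (measure_mono ?_)
    exact Set.subset_union_left
  have hle : Real.exp (-(lam * u)) ≤ 1 := Real.exp_le_one_iff.mpr (by nlinarith)
  rw [h2, ← Set.compl_Iic, prob_compl_eq_one_sub measurableSet_Iic, h1, ← ENNReal.ofReal_one,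
    ← ENNReal.ofReal_sub _ (sub_nonneg.mpr hle)]
  congr 1; ring

/-- The hazard rate of the exponential distribution of rate `lam` is constantly `lam`. -/
lemma lintegral_expMeasure_eq {g : ℝ → ℝ≥0∞} (hg : Measurable g) :
    ∫⁻ x, g x ∂expMeasure lam =
      ENNReal.ofReal lam * ∫⁻ x, (∫⁻ u in Set.Ioc 0 x, g u) ∂expMeasure lam := by
  have := isProbabilityMeasure_expMeasure hlam
  have hL : ∫⁻ x, g x ∂expMeasure lam =
      ∫⁻ u in Set.Ioi 0, ENNReal.ofReal lam * (ENNReal.ofReal (Real.exp (-(lam * u))) * g u) := by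
    have hm : Measurable (exponentialPDF lam) := (measurable_exponentialPDFReal lam).ennreal_ofReal
    rw [expMeasure_eq_withDensity, lintegral_withDensity_eq_lintegral_mul _ hm hg,
      ← lintegral_add_compl _ (measurableSet_Ioi (a := (0 : ℝ))), Set.compl_Ioi]
    have h0 : ∫⁻ x in Set.Iic 0, (exponentialPDF lam * g) x = 0 := by
      rw [setLIntegral_congr Iio_ae_eq_Iic.symm, setLIntegral_congr_fun (g := fun _ => 0)
        measurableSet_Iio, lintegral_zero]
      intro x hx
      simp [exponentialPDF_of_neg (r := lam) hx]
    rw [h0, add_zero]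
    refine setLIntegral_congr_fun measurableSet_Ioi fun u hu => ?_
    rw [Pi.mul_apply, exponentialPDF_of_nonneg (le_of_lt hu), ENNReal.ofReal_mul hlam.le, mul_assoc]
  have hR : ∫⁻ x, (∫⁻ u in Set.Ioc 0 x, g u) ∂expMeasure lam =
      ∫⁻ u in Set.Ioi 0, ENNReal.ofReal (Real.exp (-(lam * u))) * g u := by
    have h1 : ∀ x : ℝ, ∫⁻ u in Set.Ioc 0 x, g u =
        ∫⁻ u in Set.Ioi 0, (if u ≤ x then g u else 0) := by
      intro x
      have : (fun u => if u ≤ x then g u else 0) = (Set.Iic x).indicator g := by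
        ext u; simp [Set.indicator_apply]
      rw [this, setLIntegral_indicator measurableSet_Iic, Set.inter_comm, Set.Ioi_inter_Iic]
    simp_rw [h1]
    rw [lintegral_lintegral_swap]
    · refine setLIntegral_congr_fun measurableSet_Ioi fun u hu => ?_
      have : (fun x => if u ≤ x then g u else 0) = (Set.Ici u).indicator fun _ => g u := by
        ext x; simp [Set.indicator_apply]
      simp only [this]
      rw [lintegral_indicator measurableSet_Ici, setLIntegral_const,
        expMeasure_Ici hlam (le_of_lt hu), mul_comm]
    · refine Measurable.aemeasurable (Measurable.ite ?_ (hg.comp measurable_snd) measurable_const)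
      exact measurableSet_le measurable_snd measurable_fst
  rw [hL, hR, lintegral_const_mul]
  exact ((by fun_prop : Measurable fun u : ℝ =>
    ENNReal.ofReal (Real.exp (-(lam * u))))).mul hg

/-- Interarrival times are positive and arrivals do not accumulate. -/
def RegularArrivals (ξ : ℕ → ℝ) : Prop :=
  (∀ n, 0 < ξ n) ∧ ∀ t, ∃ n, t < arrivalEpoch ξ n

lemma ae_regularArrivals : ∀ᵐ ξ ∂iidLaw (expMeasure lam), RegularArrivals ξ := by
  have := isProbabilityMeasure_expMeasure hlam
  have hpos := ae_forall_iidLaw (expMeasure lam) (ae_pos_expMeasure hlam)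
  have hub : ∀ N : ℕ, ∀ᵐ ξ ∂iidLaw (expMeasure lam), ∃ n, (N : ℝ) < ξ n := by
    intro N
    set p := expMeasure lam (Set.Iic (N : ℝ)) with hp
    have hp1 : p < 1 := by
      rw [hp, expMeasure_eq_withDensity, withDensity_apply _ measurableSet_Iic,
        lintegral_exponentialPDF_eq_antiDeriv hlam, if_pos N.cast_nonneg, ENNReal.ofReal_lt_one]
      linarith [Real.exp_pos (-(lam * N))]
    have hle : ∀ k : ℕ, iidLaw (expMeasure lam) {ξ | ¬ ∃ n, (N : ℝ) < ξ n} ≤ p ^ k := by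
      intro k
      have := Measure.infinitePi_pi (fun _ : ℕ => expMeasure lam) (s := Finset.range k)
        (t := fun _ => Set.Iic (N : ℝ)) (fun _ _ => measurableSet_Iic)
      rw [Finset.prod_const, Finset.card_range, ← hp] at this
      rw [← this]
      refine measure_mono fun ξ hξ => ?_
      simp only [Set.mem_ofPred_eq, not_exists, not_lt] at hξ
      exact fun i _ => hξ i
    rw [ae_iff]
    exact le_antisymm (ge_of_tendsto' (ENNReal.tendsto_pow_atTop_nhds_zero_of_lt_one hp1) hle)
      zero_le
  filter_upwards [hpos, ae_all_iff.mpr hub] with ξ h1 h2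
  refine ⟨h1, fun t => ?_⟩
  obtain ⟨N, hN⟩ := exists_nat_gt t
  obtain ⟨n, hn⟩ := h2 N
  refine ⟨n, hN.trans (hn.trans_le ?_)⟩
  rw [arrivalEpoch, Finset.sum_range_succ]
  linarith [Finset.sum_nonneg fun k (_ : k ∈ Finset.range n) => (h1 k).le]

/-- The integrand `J` is predictable: its value at time `v` does not depend on the interarrival
times that are not over before `v`. -/
def Predictable {β : Type*} (J : ℝ → (ℕ → ℝ) → β) : Prop :=
  ∀ n ξ ξ' v, RegularArrivals ξ → RegularArrivals ξ' → (∀ k < n, ξ k = ξ' k) → 0 < v →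
    v ≤ arrivalEpoch ξ n → v ≤ arrivalEpoch ξ' n → J v ξ = J v ξ'

omit hlam in
lemma measurable_arrivalEpoch (n : ℕ) : Measurable fun ξ : ℕ → ℝ => arrivalEpoch ξ n :=
  Finset.measurable_sum _ fun k _ => measurable_pi_apply k

omit hlam in
lemma RegularArrivals.update {ξ : ℕ → ℝ} (h : RegularArrivals ξ) (n : ℕ) {x : ℝ} (hx : 0 < x) :
    RegularArrivals (Function.update ξ n x) := by
  have hpos : ∀ k, 0 < Function.update ξ n x k := by
    intro k
    by_cases hk : k = n
    · subst hk; simpa using hx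
    · simpa [Function.update_of_ne hk] using h.1 k
  refine ⟨hpos, fun t => ?_⟩
  obtain ⟨m, hm⟩ := h.2 (t + ξ n)
  refine ⟨m, ?_⟩
  have hle : arrivalEpoch ξ m ≤ arrivalEpoch (Function.update ξ n x) m + ξ n := by
    have hterm : ∀ k ∈ Finset.range (m + 1),
        ξ k ≤ Function.update ξ n x k + (if k = n then ξ n else 0) := by
      intro k _
      by_cases hk : k = n
      · subst hk; simp [hx.le]
      · simp [hk]
    refine (Finset.sum_le_sum hterm).trans ?_
    rw [Finset.sum_add_distrib, Finset.sum_ite_eq']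
    unfold arrivalEpoch
    split_ifs
    · exact le_rfl
    · linarith [h.1 n]
  linarith

omit hlam in
/-- Changing the `n`-th interarrival time moves the `n`-th arrival epoch only by what is added
after the preceding one. -/
lemma arrivalEpoch_update (ξ : ℕ → ℝ) (n : ℕ) (x : ℝ) :
    arrivalEpoch (Function.update ξ n x) n = (∑ k ∈ Finset.range n, ξ k) + x := by
  rw [arrivalEpoch, Finset.sum_range_succ, Function.update_self]
  congr 1
  refine Finset.sum_congr rfl fun k hk => ?_
  rw [Function.update_of_ne (Finset.mem_range.mp hk).ne]

/-- Compensation for the `n`-th arrival alone: given the preceding interarrival times, the hazard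
rate of the next arrival is `lam`, and a predictable integrand does not see when it occurs. -/
lemma lintegral_arrival_eq (n : ℕ) {J : ℝ → (ℕ → ℝ) → ℝ≥0∞} (hJ : Measurable (Function.uncurry J))
    (hp : Predictable J) :
    ∫⁻ ξ, J (arrivalEpoch ξ n) ξ ∂iidLaw (expMeasure lam) =
      ENNReal.ofReal lam * ∫⁻ ξ, (∫⁻ v in Set.Ioc (∑ k ∈ Finset.range n, ξ k) (arrivalEpoch ξ n),
        J v ξ) ∂iidLaw (expMeasure lam) := by
  have := isProbabilityMeasure_expMeasure hlam
  have hb : Measurable fun ξ : ℕ → ℝ => ∑ k ∈ Finset.range n, ξ k :=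
    Finset.measurable_sum _ fun k _ => measurable_pi_apply k
  have hF1 : Measurable fun ξ => J (arrivalEpoch ξ n) ξ :=
    hJ.comp ((measurable_arrivalEpoch n).prodMk measurable_id)
  have hF2 : Measurable fun ξ : ℕ → ℝ => ∫⁻ u in Set.Ioc 0 (ξ n),
      J ((∑ k ∈ Finset.range n, ξ k) + u) ξ := by
    have h1 : ∀ ξ : ℕ → ℝ, ∫⁻ u in Set.Ioc 0 (ξ n), J ((∑ k ∈ Finset.range n, ξ k) + u) ξ =
        ∫⁻ u, (if 0 < u ∧ u ≤ ξ n then J ((∑ k ∈ Finset.range n, ξ k) + u) ξ else 0) := by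
      intro ξ
      rw [← lintegral_indicator measurableSet_Ioc]
      simp [Set.indicator_apply]
    simp_rw [h1]
    refine Measurable.lintegral_prod_right' (f := fun p : (ℕ → ℝ) × ℝ =>
      if 0 < p.2 ∧ p.2 ≤ p.1 n then J ((∑ k ∈ Finset.range n, p.1 k) + p.2) p.1 else 0) ?_
    refine Measurable.ite ?_ ?_ measurable_const
    · exact (measurableSet_lt measurable_const measurable_snd).inter
        (measurableSet_le measurable_snd ((measurable_pi_apply n).comp measurable_fst))
    · exact hJ.comp (((hb.comp measurable_fst).add measurable_snd).prodMk measurable_fst)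
  have hshift : ∀ ξ : ℕ → ℝ,
      ∫⁻ v in Set.Ioc (∑ k ∈ Finset.range n, ξ k) (arrivalEpoch ξ n), J v ξ =
      ∫⁻ u in Set.Ioc 0 (ξ n), J ((∑ k ∈ Finset.range n, ξ k) + u) ξ := by
    intro ξ
    set b := ∑ k ∈ Finset.range n, ξ k with hbdef
    have ha : arrivalEpoch ξ n = b + ξ n := Finset.sum_range_succ _ _
    have hmp := measurePreserving_add_left (volume : Measure ℝ) b
    have he : MeasurableEmbedding (fun u : ℝ => b + u) := (MeasurableEquiv.addLeft b).measurableEmbedding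
    rw [ha, ← hmp.setLIntegral_comp_preimage_emb he]
    congr 2
    simp
  simp_rw [hshift]
  rw [lintegral_update_iidLaw _ n hF1, lintegral_update_iidLaw _ n hF2,
    ← lintegral_const_mul' _ _ ENNReal.ofReal_ne_top]
  refine lintegral_congr_ae ?_
  filter_upwards [ae_regularArrivals hlam] with ξ hξ
  have hbu : ∀ x, ∑ k ∈ Finset.range n, Function.update ξ n x k = ∑ k ∈ Finset.range n, ξ k :=
    fun x => Finset.sum_congr rfl fun k hk => by
      rw [Function.update_of_ne (Finset.mem_range.mp hk).ne]
  simp_rw [hbu, arrivalEpoch_update, Function.update_self]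
  set b := ∑ k ∈ Finset.range n, ξ k with hbdef
  have hb0 : 0 ≤ b := Finset.sum_nonneg fun k _ => (hξ.1 k).le
  have hupd : Measurable fun x : ℝ => Function.update ξ n x := measurable_update ξ
  have hg : Measurable fun x => J (b + x) (Function.update ξ n x) :=
    hJ.comp ((measurable_const.add measurable_id).prodMk hupd)
  rw [lintegral_expMeasure_eq hlam hg]
  congr 1
  refine lintegral_congr_ae ?_
  filter_upwards [ae_pos_expMeasure hlam] with x hx
  refine setLIntegral_congr_fun measurableSet_Ioc fun u hu => ?_
  refine hp n _ _ _ (hξ.update n hu.1) (hξ.update n hx) (fun k hk => ?_) (by linarith [hu.1]) ?_ ?_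
  · rw [Function.update_of_ne hk.ne, Function.update_of_ne hk.ne]
  · rw [arrivalEpoch_update]
  · rw [arrivalEpoch_update]; linarith [hu.2]

omit hlam in
lemma RegularArrivals.goodPath {ξ : ℕ → ℝ} (h : RegularArrivals ξ) : GoodPath 0 0 ξ 0 :=
  ⟨h.1, h.2, fun _ => le_rfl, fun _ => rfl, fun h0 => absurd h0 (lt_irrefl _)⟩

omit hlam in
/-- The intervals between successive arrival epochs partition the positive half-line. -/
lemma RegularArrivals.lintegral_Ioi {ξ : ℕ → ℝ} (h : RegularArrivals ξ) (g : ℝ → ℝ≥0∞) :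
    ∑' n, ∫⁻ v in Set.Ioc (∑ k ∈ Finset.range n, ξ k) (arrivalEpoch ξ n), g v =
      ∫⁻ v in Set.Ioi 0, g v := by
  set b : ℕ → ℝ := fun n => ∑ k ∈ Finset.range n, ξ k with hb
  have hbm : Monotone b := monotone_nat_of_le_succ fun n => by
    simp only [hb, Finset.sum_range_succ]; linarith [h.1 n]
  have hdisj : Pairwise (Function.onFun Disjoint fun n => Set.Ioc (b n) (b (n + 1))) := by
    have := hbm.pairwise_disjoint_on_Ioc_succ
    simpa [Order.succ_eq_add_one] using this
  have hun : ⋃ n, Set.Ioc (b n) (b (n + 1)) = Set.Ioi 0 := by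
    ext v
    simp only [Set.mem_iUnion, Set.mem_Ioc, Set.mem_Ioi]
    constructor
    · rintro ⟨n, h1, -⟩
      exact (Finset.sum_nonneg fun k _ => (h.1 k).le).trans_lt h1
    · intro hv
      refine ⟨arrivalCountBefore ξ v, ?_, (h.goodPath.arrivalCountBefore_le_iff _ v).mp le_rfl⟩
      rcases hc : arrivalCountBefore ξ v with _ | c
      · simpa [hb] using hv
      · exact (h.goodPath.lt_arrivalCountBefore_iff c v).mp (by omega)
  rw [← hun, lintegral_iUnion (fun _ => measurableSet_Ioc) hdisj]
  rfl

/-- **Compensation of Poisson arrivals**: the expected sum of a predictable integrand over the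
arrival epochs up to time `t` is `lam` times its expected integral. -/
theorem lintegral_sum_arrivals {J : ℝ → (ℕ → ℝ) → ℝ≥0∞} (hJ : Measurable (Function.uncurry J))
    (hp : Predictable J) (t : ℝ) :
    ∫⁻ ξ, ∑ n ∈ Finset.range (arrivalCount ξ t), J (arrivalEpoch ξ n) ξ
        ∂iidLaw (expMeasure lam) =
      ENNReal.ofReal lam * ∫⁻ ξ, (∫⁻ v in Set.Ioc 0 t, J v ξ) ∂iidLaw (expMeasure lam) := by
  have := isProbabilityMeasure_expMeasure hlam
  set J' : ℝ → (ℕ → ℝ) → ℝ≥0∞ := fun v ξ => if v ≤ t then J v ξ else 0 with hJ'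
  have hJ'm : Measurable (Function.uncurry J') :=
    Measurable.ite (measurableSet_le measurable_fst measurable_const) hJ measurable_const
  have hp' : Predictable J' := by
    intro n ξ ξ' v h1 h2 h3 h4 h5 h6
    simp only [hJ', hp n ξ ξ' v h1 h2 h3 h4 h5 h6]
  have hL : ∀ᵐ ξ ∂iidLaw (expMeasure lam),
      ∑ n ∈ Finset.range (arrivalCount ξ t), J (arrivalEpoch ξ n) ξ =
      ∑' n, J' (arrivalEpoch ξ n) ξ := by
    filter_upwards [ae_regularArrivals hlam] with ξ hξ
    rw [tsum_eq_sum (s := Finset.range (arrivalCount ξ t))]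
    · refine Finset.sum_congr rfl fun n hn => ?_
      rw [Finset.mem_range, hξ.goodPath.lt_arrivalCount_iff] at hn
      simp only [hJ', if_pos hn]
    · intro n hn
      rw [Finset.mem_range, hξ.goodPath.lt_arrivalCount_iff] at hn
      simp only [hJ', if_neg hn]
  have hR : ∀ᵐ ξ ∂iidLaw (expMeasure lam), (∫⁻ v in Set.Ioc 0 t, J v ξ) =
      ∑' n, ∫⁻ v in Set.Ioc (∑ k ∈ Finset.range n, ξ k) (arrivalEpoch ξ n), J' v ξ := by
    filter_upwards [ae_regularArrivals hlam] with ξ hξ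
    rw [hξ.lintegral_Ioi]
    have : (fun v => J' v ξ) = (Set.Iic t).indicator fun v => J v ξ := by
      ext v; simp [hJ', Set.indicator_apply]
    rw [this, setLIntegral_indicator measurableSet_Iic, Set.inter_comm, Set.Ioi_inter_Iic]
  have hmb : ∀ n, Measurable fun ξ : ℕ → ℝ =>
      ∫⁻ v in Set.Ioc (∑ k ∈ Finset.range n, ξ k) (arrivalEpoch ξ n), J' v ξ := by
    intro n
    have h1 : ∀ ξ : ℕ → ℝ,
        ∫⁻ v in Set.Ioc (∑ k ∈ Finset.range n, ξ k) (arrivalEpoch ξ n), J' v ξ =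
        ∫⁻ v, (if ∑ k ∈ Finset.range n, ξ k < v ∧ v ≤ arrivalEpoch ξ n then J' v ξ else 0) := by
      intro ξ
      rw [← lintegral_indicator measurableSet_Ioc]
      simp [Set.indicator_apply]
    simp_rw [h1]
    refine Measurable.lintegral_prod_right' (f := fun p : (ℕ → ℝ) × ℝ =>
      if ∑ k ∈ Finset.range n, p.1 k < p.2 ∧ p.2 ≤ arrivalEpoch p.1 n then J' p.2 p.1 else 0) ?_
    have hb : Measurable fun ξ : ℕ → ℝ => ∑ k ∈ Finset.range n, ξ k :=
      Finset.measurable_sum _ fun k _ => measurable_pi_apply k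
    refine Measurable.ite ?_ (hJ'm.comp measurable_swap) measurable_const
    exact (measurableSet_lt (hb.comp measurable_fst) measurable_snd).inter
        (measurableSet_le measurable_snd ((measurable_arrivalEpoch n).comp measurable_fst))
  rw [lintegral_congr_ae hL, lintegral_congr_ae hR, lintegral_tsum, lintegral_tsum,
    ← ENNReal.tsum_mul_left]
  · exact tsum_congr fun n => lintegral_arrival_eq hlam n hJ'm hp'
  · exact fun n => (hmb n).aemeasurable
  · exact fun n => (hJ'm.comp ((measurable_arrivalEpoch n).prodMk measurable_id)).aemeasurable

end Exponential

/-! ### Measurability of the queueing processes -/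

section Measurability

lemma measurable_ncard {α : Type*} [MeasurableSpace α] {p : ℕ → α → Prop}
    (hp : ∀ i, MeasurableSet {x | p i x}) : Measurable fun x => {i | p i x}.ncard := by
  classical
  have h1 : ∀ x, (({i | p i x}.ncard : ℕ) : ℝ) =
      (∑' i, if p i x then (1 : ℝ≥0∞) else 0).toReal := by
    intro x
    have : (∑' i, if p i x then (1 : ℝ≥0∞) else 0) = (({i | p i x}.encard : ℕ∞) : ℝ≥0∞) := by
      rw [← ENNReal.tsum_set_one, tsum_subtype {i | p i x} (fun _ => (1 : ℝ≥0∞))]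
      refine tsum_congr fun i => ?_
      simp [Set.indicator_apply]
    rw [this, Set.ncard_def]
    induction {i | p i x}.encard using ENat.recTopCoe <;> simp
  have h2 : Measurable fun x => (({i | p i x}.ncard : ℕ) : ℝ) := by
    simp_rw [h1]
    exact (Measurable.tsum fun i =>
      Measurable.ite (hp i) measurable_const measurable_const).ennreal_toReal
  refine measurable_to_countable' fun n => ?_
  have : (fun x => {i | p i x}.ncard) ⁻¹' {n} =
      (fun x => (({i | p i x}.ncard : ℕ) : ℝ)) ⁻¹' {(n : ℝ)} := by
    ext x; simp
  rw [this]
  exact h2 (measurableSet_singleton _)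

variable {α : Type*} [MeasurableSpace α] {q : α → ℕ} {r T : α → ℝ} {x s : α → ℕ → ℝ}

lemma measurable_apply_nat {g : ℕ → α → ℝ} (hg : ∀ i, Measurable (g i)) {n : α → ℕ}
    (hn : Measurable n) : Measurable fun a => g (n a) a := by
  have : Measurable fun p : ℕ × α => g p.1 p.2 := measurable_from_prod_countable_right hg
  exact this.comp (hn.prodMk measurable_id)

lemma measurable_arrivalCount (hx : Measurable x) (hT : Measurable T) :
    Measurable fun a => arrivalCount (x a) (T a) :=
  measurable_ncard fun n => measurableSet_le ((measurable_arrivalEpoch n).comp hx) hT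

lemma measurable_arrivalCountBefore (hx : Measurable x) (hT : Measurable T) :
    Measurable fun a => arrivalCountBefore (x a) (T a) :=
  measurable_ncard fun n => measurableSet_lt ((measurable_arrivalEpoch n).comp hx) hT

lemma measurable_availableTime (hq : Measurable q) (hx : Measurable x) (i : ℕ) :
    Measurable fun a => availableTime (q a) (x a) i := by
  refine Measurable.ite (measurableSet_lt measurable_const hq) measurable_const ?_
  exact measurable_apply_nat (g := fun n a => arrivalEpoch (x a) n)
    (fun n => (measurable_arrivalEpoch n).comp hx) ((measurable_from_nat (f := fun m => i - m)).comp hq)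

lemma measurable_requirement (hq : Measurable q) (hr : Measurable r) (hs : Measurable s) (i : ℕ) :
    Measurable fun a => requirement (q a) (r a) (s a) i := by
  refine Measurable.ite ?_ hr ((measurable_pi_apply i).comp hs)
  exact (MeasurableSet.const _).inter (measurableSet_lt measurable_const hq)

lemma measurable_departureTime (hq : Measurable q) (hr : Measurable r) (hx : Measurable x)
    (hs : Measurable s) (i : ℕ) :
    Measurable fun a => departureTime (q a) (r a) (x a) (s a) i := by
  induction i with
  | zero => exact (measurable_availableTime hq hx 0).add (measurable_requirement hq hr hs 0)
  | succ i ih =>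
    exact ((measurable_availableTime hq hx (i + 1)).max ih).add
      (measurable_requirement hq hr hs (i + 1))

lemma measurable_startTime (hq : Measurable q) (hr : Measurable r) (hx : Measurable x)
    (hs : Measurable s) (i : ℕ) :
    Measurable fun a => startTime (q a) (r a) (x a) (s a) i := by
  cases i with
  | zero => exact measurable_availableTime hq hx 0
  | succ i =>
    exact (measurable_availableTime hq hx (i + 1)).max
      (measurable_departureTime hq hr hx hs i)

lemma measurable_departures (hq : Measurable q) (hr : Measurable r) (hx : Measurable x)
    (hs : Measurable s) (hT : Measurable T) :
    Measurable fun a => departures (q a) (r a) (x a) (s a) (T a) :=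
  measurable_ncard fun i => measurableSet_le (measurable_departureTime hq hr hx hs i) hT

lemma measurable_departuresBefore (hq : Measurable q) (hr : Measurable r) (hx : Measurable x)
    (hs : Measurable s) (hT : Measurable T) :
    Measurable fun a => departuresBefore (q a) (r a) (x a) (s a) (T a) :=
  measurable_ncard fun i => measurableSet_lt (measurable_departureTime hq hr hx hs i) hT

lemma measurable_queueLength (hq : Measurable q) (hr : Measurable r) (hx : Measurable x)
    (hs : Measurable s) (hT : Measurable T) :
    Measurable fun a => queueLength (q a) (r a) (x a) (s a) (T a) :=
  measurable_ncard fun i => (measurableSet_le (measurable_availableTime hq hx i) hT).inter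
    (measurableSet_lt hT (measurable_departureTime hq hr hx hs i))

lemma measurable_residualService (hq : Measurable q) (hr : Measurable r) (hx : Measurable x)
    (hs : Measurable s) (hT : Measurable T) :
    Measurable fun a => residualService (q a) (r a) (x a) (s a) (T a) := by
  refine Measurable.ite (measurable_queueLength hq hr hx hs hT (measurableSet_singleton 0))
    measurable_const (Measurable.sub ?_ hT)
  exact measurable_apply_nat (g := fun i a => departureTime (q a) (r a) (x a) (s a) i)
    (fun i => measurable_departureTime hq hr hx hs i) (measurable_departures hq hr hx hs hT)

lemma measurableSet_serving (hq : Measurable q) (hr : Measurable r) (hx : Measurable x)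
    (hs : Measurable s) (hT : Measurable T) :
    MeasurableSet {a | startTime (q a) (r a) (x a) (s a)
      (departuresBefore (q a) (r a) (x a) (s a) (T a)) < T a} := by
  refine measurableSet_lt ?_ hT
  exact measurable_apply_nat (g := fun i a => startTime (q a) (r a) (x a) (s a) i)
    (fun i => measurable_startTime hq hr hx hs i) (measurable_departuresBefore hq hr hx hs hT)

lemma measurable_waitingBefore (hq : Measurable q) (hr : Measurable r) (hx : Measurable x)
    (hs : Measurable s) (hT : Measurable T) :
    Measurable fun a => waitingBefore (q a) (r a) (x a) (s a) (T a) := by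
  refine Measurable.ite (measurableSet_serving hq hr hx hs hT) ?_ measurable_const
  exact ((hq.add (measurable_arrivalCountBefore hx hT)).sub
    (measurable_departuresBefore hq hr hx hs hT)).sub measurable_const

lemma measurable_residualBefore (hq : Measurable q) (hr : Measurable r) (hx : Measurable x)
    (hs : Measurable s) (hT : Measurable T) :
    Measurable fun a => residualBefore (q a) (r a) (x a) (s a) (T a) := by
  refine Measurable.ite (measurableSet_serving hq hr hx hs hT) (Measurable.sub ?_ hT)
    measurable_const
  exact measurable_apply_nat (g := fun i a => departureTime (q a) (r a) (x a) (s a) i)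
    (fun i => measurable_departureTime hq hr hx hs i) (measurable_departuresBefore hq hr hx hs hT)

end Measurability

/-! ### The state before an epoch is predictable -/

section Predictability

variable {q₀ : ℕ} {r₀ : ℝ} {ξ ξ' S : ℕ → ℝ} {n : ℕ}

lemma arrivalEpoch_congr (hag : ∀ k < n, ξ k = ξ' k) {k : ℕ} (hk : k < n) :
    arrivalEpoch ξ k = arrivalEpoch ξ' k :=
  Finset.sum_congr rfl fun j hj => hag j (by rw [Finset.mem_range] at hj; omega)

lemma availableTime_congr (hag : ∀ k < n, ξ k = ξ' k) {i : ℕ} (hi : i < q₀ + n) :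
    availableTime q₀ ξ i = availableTime q₀ ξ' i := by
  unfold availableTime
  split_ifs with h
  · rfl
  · exact arrivalEpoch_congr hag (by omega)

lemma departureTime_congr (hag : ∀ k < n, ξ k = ξ' k) {i : ℕ} (hi : i < q₀ + n) :
    departureTime q₀ r₀ ξ S i = departureTime q₀ r₀ ξ' S i := by
  induction i with
  | zero => simp only [departureTime, availableTime_congr hag hi]
  | succ i ih => simp only [departureTime, availableTime_congr hag hi, ih (by omega)]

lemma startTime_congr (hag : ∀ k < n, ξ k = ξ' k) {i : ℕ} (hi : i < q₀ + n) :
    startTime q₀ r₀ ξ S i = startTime q₀ r₀ ξ' S i := by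
  cases i with
  | zero => exact availableTime_congr hag hi
  | succ i => simp only [startTime, availableTime_congr hag hi,
      departureTime_congr hag (show i < q₀ + n by omega)]

/-- The state just before `v` does not depend on interarrival times that are not over before
`v`. -/
lemma stateBefore_congr (h : GoodPath q₀ r₀ ξ S) (h' : GoodPath q₀ r₀ ξ' S)
    (hag : ∀ k < n, ξ k = ξ' k) {v : ℝ} (hv : 0 < v) (h1 : v ≤ arrivalEpoch ξ n)
    (h2 : v ≤ arrivalEpoch ξ' n) :
    arrivalCountBefore ξ v = arrivalCountBefore ξ' v ∧
    waitingBefore q₀ r₀ ξ S v = waitingBefore q₀ r₀ ξ' S v ∧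
    residualBefore q₀ r₀ ξ S v = residualBefore q₀ r₀ ξ' S v := by
  have eA : arrivalCountBefore ξ v = arrivalCountBefore ξ' v := by
    refine eq_of_forall_lt_iff fun m => ?_
    rw [h.lt_arrivalCountBefore_iff, h'.lt_arrivalCountBefore_iff]
    rcases lt_or_ge m n with hm | hm
    · rw [arrivalEpoch_congr hag hm]
    · exact iff_of_false (not_lt.mpr (h1.trans (h.arrivalEpoch_strictMono.monotone hm)))
        (not_lt.mpr (h2.trans (h'.arrivalEpoch_strictMono.monotone hm)))
  have hav : v ≤ availableTime q₀ ξ (q₀ + n) := by simpa [availableTime] using h1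
  have hav' : v ≤ availableTime q₀ ξ' (q₀ + n) := by simpa [availableTime] using h2
  have eD : departuresBefore q₀ r₀ ξ S v = departuresBefore q₀ r₀ ξ' S v := by
    refine eq_of_forall_lt_iff fun m => ?_
    rw [h.lt_departuresBefore_iff m hv.le, h'.lt_departuresBefore_iff m hv.le]
    rcases lt_or_ge m (q₀ + n) with hm | hm
    · rw [departureTime_congr hag hm]
    · exact iff_of_false
        (not_lt.mpr ((hav.trans (h.availableTime_mono hm)).trans (h.availableTime_le_departureTime m)))
        (not_lt.mpr ((hav'.trans (h'.availableTime_mono hm)).trans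
          (h'.availableTime_le_departureTime m)))
  refine ⟨eA, ?_⟩
  unfold waitingBefore residualBefore
  rw [← eD, ← eA]
  set k := departuresBefore q₀ r₀ ξ S v
  rcases lt_or_ge k (q₀ + n) with hk | hk
  · rw [startTime_congr hag hk, departureTime_congr hag hk]
    exact ⟨rfl, rfl⟩
  · have n1 : ¬ startTime q₀ r₀ ξ S k < v := not_lt.mpr
      ((hav.trans (h.availableTime_mono hk)).trans (availableTime_le_startTime q₀ r₀ ξ S k))
    have n2 : ¬ startTime q₀ r₀ ξ' S k < v := not_lt.mpr
      ((hav'.trans (h'.availableTime_mono hk)).trans (availableTime_le_startTime q₀ r₀ ξ' S k))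
    simp only [if_neg n1, if_neg n2, and_self]

/-- The departure of customer `i` does not depend on the service times of later customers. -/
lemma departureTime_update_of_lt (x : ℝ) {i j : ℕ} (hij : i < j) :
    departureTime q₀ r₀ ξ (Function.update S j x) i = departureTime q₀ r₀ ξ S i := by
  induction i with
  | zero => simp only [departureTime, requirement, Function.update_of_ne hij.ne]
  | succ i ih =>
    simp only [departureTime, requirement, Function.update_of_ne hij.ne, ih (by omega)]

lemma startTime_update (x : ℝ) (j : ℕ) :
    startTime q₀ r₀ ξ (Function.update S j x) j = startTime q₀ r₀ ξ S j := by
  cases j with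
  | zero => rfl
  | succ j => simp only [startTime, departureTime_update_of_lt x (Nat.lt_succ_self j)]

end Predictability

/-! ### Moments of the arrival count -/

section ArrivalMoments

variable {lam : ℝ} (hlam : 0 < lam)
include hlam

omit hlam in
lemma predictable_arrivalCountBefore (φ : ℕ → ℝ≥0∞) :
    Predictable fun v ξ => φ (arrivalCountBefore ξ v) := by
  intro n ξ ξ' v h h' hag hv h1 h2
  simp only [(stateBefore_congr h.goodPath h'.goodPath hag hv h1 h2).1]

/-- The factorial moments of the Poisson distribution. -/
lemma lintegral_descFactorial_arrivalCount (k : ℕ) {t : ℝ} (ht : 0 ≤ t) :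
    ∫⁻ ξ, ((arrivalCount ξ t).descFactorial k : ℝ≥0∞) ∂iidLaw (expMeasure lam) =
      ENNReal.ofReal ((lam * t) ^ k) := by
  have := isProbabilityMeasure_expMeasure hlam
  induction k generalizing t with
  | zero => simp
  | succ k ih =>
    have hsum : ∀ N : ℕ, ((N.descFactorial (k + 1) : ℕ) : ℝ≥0∞) =
        ∑ n ∈ Finset.range N, ((k + 1 : ℕ) : ℝ≥0∞) * (n.descFactorial k : ℝ≥0∞) := by
      intro N
      induction N with
      | zero => simp
      | succ N ihN =>
        rw [Finset.sum_range_succ, ← ihN, ← Nat.cast_mul, ← Nat.cast_add]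
        congr 1
        have : (N + 1).descFactorial (k + 1) = (N + 1) * N.descFactorial k :=
          Nat.succ_descFactorial_succ N k
        rw [this, Nat.descFactorial_succ]
        rcases le_or_gt k N with hk | hk
        · obtain ⟨m, rfl⟩ := Nat.exists_eq_add_of_le hk
          rw [Nat.add_sub_cancel_left]; ring
        · rw [Nat.descFactorial_of_lt hk]; ring
    have h1 : ∀ᵐ ξ ∂iidLaw (expMeasure lam),
        (((arrivalCount ξ t).descFactorial (k + 1) : ℕ) : ℝ≥0∞) =
        ∑ n ∈ Finset.range (arrivalCount ξ t), ((k + 1 : ℕ) : ℝ≥0∞) *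
          ((arrivalCountBefore ξ (arrivalEpoch ξ n)).descFactorial k : ℝ≥0∞) := by
      filter_upwards [ae_regularArrivals hlam] with ξ hξ
      rw [hsum]
      exact Finset.sum_congr rfl fun n _ => by
        rw [hξ.goodPath.arrivalCountBefore_arrivalEpoch]
    have hmB : Measurable fun p : ℝ × (ℕ → ℝ) => arrivalCountBefore p.2 p.1 :=
      measurable_arrivalCountBefore measurable_snd measurable_fst
    have hmA : Measurable fun p : (ℕ → ℝ) × ℝ => arrivalCount p.1 p.2 :=
      measurable_arrivalCount measurable_fst measurable_snd
    rw [lintegral_congr_ae h1, lintegral_sum_arrivals hlam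
      (J := fun v ξ => ((k + 1 : ℕ) : ℝ≥0∞) * ((arrivalCountBefore ξ v).descFactorial k : ℝ≥0∞))
      ((measurable_from_nat (f := fun n : ℕ =>
        ((k + 1 : ℕ) : ℝ≥0∞) * (n.descFactorial k : ℝ≥0∞))).comp hmB)
      (predictable_arrivalCountBefore fun n =>
        ((k + 1 : ℕ) : ℝ≥0∞) * (n.descFactorial k : ℝ≥0∞)) t]
    have h2 : ∀ᵐ ξ ∂iidLaw (expMeasure lam),
        ∫⁻ v in Set.Ioc 0 t, ((k + 1 : ℕ) : ℝ≥0∞) *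
          ((arrivalCountBefore ξ v).descFactorial k : ℝ≥0∞) =
        ∫⁻ v in Set.Ioc 0 t, ((k + 1 : ℕ) : ℝ≥0∞) *
          ((arrivalCount ξ v).descFactorial k : ℝ≥0∞) := by
      filter_upwards [ae_regularArrivals hlam] with ξ hξ
      refine setLIntegral_congr_fun_ae measurableSet_Ioc ?_
      filter_upwards [hξ.goodPath.stateBefore_ae_eq] with v hv hv'
      rw [(hv hv'.1.le).1]
    have hm : Measurable fun p : (ℕ → ℝ) × ℝ => ((k + 1 : ℕ) : ℝ≥0∞) *
          ((arrivalCount p.1 p.2).descFactorial k : ℝ≥0∞) :=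
      (measurable_from_nat (f := fun n : ℕ =>
        ((k + 1 : ℕ) : ℝ≥0∞) * (n.descFactorial k : ℝ≥0∞))).comp hmA
    rw [lintegral_congr_ae h2, lintegral_lintegral_swap hm.aemeasurable]
    have h3 : ∫⁻ v in Set.Ioc 0 t, (∫⁻ ξ, ((k + 1 : ℕ) : ℝ≥0∞) *
        ((arrivalCount ξ v).descFactorial k : ℝ≥0∞) ∂iidLaw (expMeasure lam)) =
        ∫⁻ v in Set.Ioc 0 t, ENNReal.ofReal ((k + 1 : ℕ) * (lam * v) ^ k) := by
      refine setLIntegral_congr_fun measurableSet_Ioc fun v hv => ?_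
      rw [lintegral_const_mul' _ _ (ENNReal.natCast_ne_top _), ih hv.1.le,
        ENNReal.ofReal_mul (Nat.cast_nonneg _), ENNReal.ofReal_natCast]
    have hcont : Continuous fun v : ℝ => ((k + 1 : ℕ) : ℝ) * (lam * v) ^ k := by fun_prop
    rw [h3, ← ofReal_integral_eq_lintegral_ofReal, ← ENNReal.ofReal_mul hlam.le,
      ← intervalIntegral.integral_of_le ht]
    · congr 1
      simp_rw [mul_pow]
      rw [intervalIntegral.integral_const_mul, intervalIntegral.integral_const_mul, integral_pow]
      field_simp
      push_cast
      ring
    · exact (hcont.integrableOn_Icc).mono_set Set.Ioc_subset_Icc_self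
    · filter_upwards [ae_restrict_mem measurableSet_Ioc] with v hv
      have := mul_pos hlam hv.1
      positivity

lemma integrable_descFactorial_arrivalCount (k : ℕ) {t : ℝ} (ht : 0 ≤ t) :
    Integrable (fun ξ => ((arrivalCount ξ t).descFactorial k : ℝ)) (iidLaw (expMeasure lam)) ∧
    ∫ ξ, ((arrivalCount ξ t).descFactorial k : ℝ) ∂iidLaw (expMeasure lam) = (lam * t) ^ k := by
  have hm : Measurable fun ξ : ℕ → ℝ => ((arrivalCount ξ t).descFactorial k : ℝ) :=
    (measurable_from_nat (f := fun n : ℕ => (n.descFactorial k : ℝ))).comp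
      (measurable_arrivalCount measurable_id measurable_const)
  have h0 : ∀ ξ : ℕ → ℝ, (0 : ℝ) ≤ ((arrivalCount ξ t).descFactorial k : ℝ) :=
    fun ξ => Nat.cast_nonneg _
  have hl : ∫⁻ ξ, ENNReal.ofReal ((arrivalCount ξ t).descFactorial k : ℝ)
      ∂iidLaw (expMeasure lam) = ENNReal.ofReal ((lam * t) ^ k) := by
    simp_rw [ENNReal.ofReal_natCast]
    exact lintegral_descFactorial_arrivalCount hlam k ht
  refine ⟨⟨hm.aestronglyMeasurable, ?_⟩, ?_⟩
  · rw [hasFiniteIntegral_iff_ofReal (Eventually.of_forall h0), hl]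
    exact ENNReal.ofReal_lt_top
  · rw [integral_eq_lintegral_of_nonneg_ae (Eventually.of_forall h0) hm.aestronglyMeasurable, hl,
      ENNReal.toReal_ofReal (by positivity)]

/-- All moments of the arrival count are finite. -/
lemma lintegral_one_add_arrivalCount_pow_lt_top (p : ℕ) {t : ℝ} (ht : 0 ≤ t) :
    ∫⁻ ξ, ENNReal.ofReal ((1 + (arrivalCount ξ t : ℝ)) ^ p) ∂iidLaw (expMeasure lam) < ∞ := by
  have := isProbabilityMeasure_expMeasure hlam
  have hb : ∀ n : ℕ, (1 + (n : ℝ)) ^ p ≤ 2 ^ p * (n.descFactorial p : ℝ) + (2 * p + 1) ^ p := by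
    intro n
    rcases le_or_gt (2 * p) n with hn | hn
    · have h1 : ((n + 1 - p : ℕ) : ℝ) ^ p ≤ (n.descFactorial p : ℝ) := by
        exact_mod_cast Nat.pow_sub_le_descFactorial n p
      have h2 : (1 + (n : ℝ)) ≤ 2 * ((n + 1 - p : ℕ) : ℝ) := by
        have : 1 + n ≤ 2 * (n + 1 - p) := by omega
        exact_mod_cast this
      calc (1 + (n : ℝ)) ^ p ≤ (2 * ((n + 1 - p : ℕ) : ℝ)) ^ p := by gcongr
        _ = 2 ^ p * ((n + 1 - p : ℕ) : ℝ) ^ p := mul_pow _ _ _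
        _ ≤ 2 ^ p * (n.descFactorial p : ℝ) := by gcongr
        _ ≤ _ := le_add_of_nonneg_right (by positivity)
    · have h2 : (1 + (n : ℝ)) ≤ 2 * p + 1 := by
        have : 1 + n ≤ 2 * p + 1 := by omega
        exact_mod_cast this
      calc (1 + (n : ℝ)) ^ p ≤ (2 * p + 1) ^ p := by gcongr
        _ ≤ _ := le_add_of_nonneg_left (by positivity)
  refine (lintegral_mono fun ξ => ENNReal.ofReal_le_ofReal (hb (arrivalCount ξ t))).trans_lt ?_
  have hi : Integrable (fun ξ : ℕ → ℝ => 2 ^ p * ((arrivalCount ξ t).descFactorial p : ℝ) +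
      (2 * (p : ℝ) + 1) ^ p) (iidLaw (expMeasure lam)) :=
    ((integrable_descFactorial_arrivalCount hlam p ht).1.const_mul _).add (integrable_const _)
  exact (hasFiniteIntegral_iff_ofReal (Eventually.of_forall fun ξ => by positivity)).mp hi.2

end ArrivalMoments

/-! ### Bounds along sample paths -/

/-- A polynomial bound, valid throughout `[0, t]`, for functions of the state of quadratic growth
that are multiplied by powers of the number of arrivals. -/
def envelope (q₀ : ℕ) (r₀ : ℝ) (ξ S : ℕ → ℝ) (t : ℝ) (p : ℕ) : ℝ :=
  (1 + (arrivalCount ξ t : ℝ)) ^ p *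
    (1 + (q₀ : ℝ) ^ 2 + r₀ ^ 2 + ∑ j ∈ Finset.range (q₀ + arrivalCount ξ t), S j ^ 2)

lemma envelope_nonneg (q₀ : ℕ) (r₀ : ℝ) (ξ S : ℕ → ℝ) (t : ℝ) (p : ℕ) :
    0 ≤ envelope q₀ r₀ ξ S t p :=
  mul_nonneg (by positivity)
    (add_nonneg (by positivity) (Finset.sum_nonneg fun j _ => sq_nonneg _))

lemma envelope_succ (q₀ : ℕ) (r₀ : ℝ) (ξ S : ℕ → ℝ) (t : ℝ) (p : ℕ) :
    envelope q₀ r₀ ξ S t (p + 1) = (1 + (arrivalCount ξ t : ℝ)) * envelope q₀ r₀ ξ S t p := by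
  unfold envelope; ring

lemma measurable_envelope {α : Type*} [MeasurableSpace α] {q : α → ℕ} {r : α → ℝ}
    {x s : α → ℕ → ℝ} (hq : Measurable q) (hr : Measurable r) (hx : Measurable x)
    (hs : Measurable s) (t : ℝ) (p : ℕ) :
    Measurable fun a => envelope (q a) (r a) (x a) (s a) t p := by
  have hA : Measurable fun a => arrivalCount (x a) t := measurable_arrivalCount hx measurable_const
  have hA' : Measurable fun a => ((arrivalCount (x a) t : ℕ) : ℝ) :=
    (measurable_from_nat (f := fun n : ℕ => (n : ℝ))).comp hA
  have hq' : Measurable fun a => ((q a : ℕ) : ℝ) :=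
    (measurable_from_nat (f := fun n : ℕ => (n : ℝ))).comp hq
  have hS : Measurable fun a => ∑ j ∈ Finset.range (q a + arrivalCount (x a) t), s a j ^ 2 :=
    measurable_apply_nat (g := fun N a => ∑ j ∈ Finset.range N, s a j ^ 2)
      (fun N => Finset.measurable_sum _ fun j _ => ((measurable_pi_apply j).comp hs).pow_const 2)
      (hq.add hA)
  exact ((measurable_const.add hA').pow_const p).mul
    (((measurable_const.add (hq'.pow_const 2)).add (hr.pow_const 2)).add hS)

/-- Squared requirements are dominated by the corresponding part of the envelope. -/
lemma sq_requirement_le (q₀ : ℕ) (r₀ : ℝ) (S : ℕ → ℝ) {j N : ℕ} (hj : j < N) :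
    requirement q₀ r₀ S j ^ 2 ≤ r₀ ^ 2 + ∑ j ∈ Finset.range N, S j ^ 2 := by
  have h1 : S j ^ 2 ≤ ∑ j ∈ Finset.range N, S j ^ 2 :=
    Finset.single_le_sum (f := fun j => S j ^ 2) (fun i _ => sq_nonneg _) (Finset.mem_range.mpr hj)
  unfold requirement
  split_ifs
  · linarith [sq_nonneg (S j)]
  · linarith [sq_nonneg r₀]

namespace GoodPath

variable {q₀ : ℕ} {r₀ : ℝ} {ξ S : ℕ → ℝ} (h : GoodPath q₀ r₀ ξ S)
include h

/-- A residual service time in `[0, t]` is at most `r₀` or one of the service times of the customers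
that have arrived by time `t`. -/
lemma state_bound {v t : ℝ} (hv : 0 ≤ v) (hvt : v ≤ t) :
    waiting q₀ r₀ ξ S v ≤ q₀ + arrivalCount ξ t ∧ 0 ≤ residualService q₀ r₀ ξ S v ∧
    residualService q₀ r₀ ξ S v ^ 2 ≤
      r₀ ^ 2 + ∑ j ∈ Finset.range (q₀ + arrivalCount ξ t), S j ^ 2 := by
  have hA := h.arrivalCount_mono hvt
  set i := departures q₀ r₀ ξ S v
  have h1 : readyTime q₀ r₀ ξ S i ≤ v := h.readyTime_departures_le hv
  have h2 : v < departureTime q₀ r₀ ξ S i := h.lt_departureTime_departures hv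
  rcases lt_or_ge v (startTime q₀ r₀ ξ S i) with h3 | h3
  · obtain ⟨e1, e2⟩ := h.state_of_idle h1 h3
    rw [waiting, e1, e2]
    refine ⟨by omega, le_rfl, ?_⟩
    have := Finset.sum_nonneg fun j (_ : j ∈ Finset.range (q₀ + arrivalCount ξ t)) => sq_nonneg (S j)
    nlinarith [sq_nonneg r₀]
  · obtain ⟨e1, -, e2⟩ := h.state_of_busy h3 h2
    have hi : i < q₀ + arrivalCount ξ v := (h.availableTime_le_iff i hv).mp
      ((availableTime_le_startTime q₀ r₀ ξ S i).trans h3)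
    refine ⟨by rw [waiting, e1]; omega, by rw [e2]; linarith, ?_⟩
    refine le_trans ?_ (sq_requirement_le q₀ r₀ S (show i < q₀ + arrivalCount ξ t by omega))
    rw [e2]
    have := departureTime_eq q₀ r₀ ξ S i
    exact pow_le_pow_left₀ (by linarith) (by linarith) 2

/-- The bounds of `state_bound` for the state just before a given time. -/
lemma stateBefore_bound {v t : ℝ} (hv : 0 < v) (hvt : v ≤ t) :
    waitingBefore q₀ r₀ ξ S v ≤ q₀ + arrivalCount ξ t ∧ 0 ≤ residualBefore q₀ r₀ ξ S v ∧
    residualBefore q₀ r₀ ξ S v ^ 2 ≤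
      r₀ ^ 2 + ∑ j ∈ Finset.range (q₀ + arrivalCount ξ t), S j ^ 2 := by
  have hA := h.arrivalCountBefore_le hvt
  unfold waitingBefore residualBefore
  set i := departuresBefore q₀ r₀ ξ S v with hi'
  have h2 : v ≤ departureTime q₀ r₀ ξ S i := by
    by_contra hlt
    exact lt_irrefl _ ((h.lt_departuresBefore_iff i hv.le).mpr (not_le.mp hlt))
  split_ifs with h3
  · have hi : i < q₀ + arrivalCountBefore ξ v := (h.availableTime_lt_iff i hv).mp
      ((availableTime_le_startTime q₀ r₀ ξ S i).trans_lt h3)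
    refine ⟨by omega, by linarith, ?_⟩
    refine le_trans ?_ (sq_requirement_le q₀ r₀ S (show i < q₀ + arrivalCount ξ t by omega))
    have := departureTime_eq q₀ r₀ ξ S i
    exact pow_le_pow_left₀ (by linarith) (by linarith) 2
  · refine ⟨by omega, le_rfl, ?_⟩
    have := Finset.sum_nonneg fun j (_ : j ∈ Finset.range (q₀ + arrivalCount ξ t)) => sq_nonneg (S j)
    nlinarith [sq_nonneg r₀]

end GoodPath

lemma growth_le_envelope {q₀ : ℕ} {r₀ : ℝ} {ξ S : ℕ → ℝ} {t : ℝ} {y : ℕ} {r : ℝ}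
    (hy : y ≤ q₀ + arrivalCount ξ t + 1)
    (hr : r ^ 2 ≤ r₀ ^ 2 + ∑ j ∈ Finset.range (q₀ + arrivalCount ξ t), S j ^ 2) :
    1 + (y : ℝ) ^ 2 + r ^ 2 ≤ 3 * envelope q₀ r₀ ξ S t 2 := by
  unfold envelope
  set s := ∑ j ∈ Finset.range (q₀ + arrivalCount ξ t), S j ^ 2 with hs
  have hs0 : 0 ≤ s := Finset.sum_nonneg fun j _ => sq_nonneg _
  set a : ℝ := 1 + (arrivalCount ξ t : ℝ) with ha
  have ha1 : 1 ≤ a := by rw [ha]; linarith [Nat.cast_nonneg (α := ℝ) (arrivalCount ξ t)]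
  have hy' : (y : ℝ) ≤ q₀ + a := by
    have : (y : ℝ) ≤ q₀ + arrivalCount ξ t + 1 := by exact_mod_cast hy
    linarith
  have hy2 : (y : ℝ) ^ 2 ≤ 2 * (q₀ : ℝ) ^ 2 + 2 * a ^ 2 := by
    nlinarith [sq_nonneg ((q₀ : ℝ) - a), Nat.cast_nonneg (α := ℝ) y]
  have ha2 : 1 ≤ a ^ 2 := one_le_pow₀ ha1
  have hw : 0 ≤ (q₀ : ℝ) ^ 2 + r₀ ^ 2 + s := by positivity
  nlinarith [mul_le_mul_of_nonneg_right ha2 hw]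

/-! ### Test functions and the generator -/

/-- The functions of the number waiting and the residual service time to which the evolution
formula is applied: continuously differentiable in the residual service time, of quadratic growth,
and with no expected change at the start of a service. The last condition lets a customer at the
head of the line be regarded as already in service with residual service time still to be drawn. -/
structure TestFunction (G : Measure ℝ) (f f' : ℕ → ℝ → ℝ) : Prop where
  hasDerivAt : ∀ y r, HasDerivAt (f y) (f' y r) r
  continuous_deriv : ∀ y, Continuous (f' y)
  growth : ∃ C, 0 ≤ C ∧ ∀ (y : ℕ) (r : ℝ), 0 ≤ r →
    |f y r| ≤ C * (1 + (y : ℝ) ^ 2 + r ^ 2) ∧ |f' y r| ≤ C * (1 + (y : ℝ) ^ 2 + r ^ 2)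
  integral_eq : ∀ y, ∫ x, f y x ∂G = f (y + 1) 0

/-- The weight `α (A t - lam t) + β`, a martingale. -/
def weight (lam α β : ℝ) (a : ℕ) (v : ℝ) : ℝ := α * ((a : ℝ) - lam * v) + β

/-- The time derivative of `weight`. -/
def weightDeriv (lam α : ℝ) (_ : ℕ) (_ : ℝ) : ℝ := -(α * lam)

lemma hasDerivAt_weight (lam α β : ℝ) (a : ℕ) (v : ℝ) :
    HasDerivAt (weight lam α β a) (weightDeriv lam α a v) v := by
  have := ((((hasDerivAt_id' v).const_mul lam).const_sub (a : ℝ)).const_mul α).add_const β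
  have e : α * -(lam * 1) = weightDeriv lam α a v := by simp [weightDeriv]
  rw [← e]
  exact this

/-- A constant bounding `weight` and its derivative on `[0, t]`, relative to the arrival count. -/
def weightBound (lam α β t : ℝ) : ℝ := |α| * (1 + lam + lam * t) + |β|

section Bounds

variable {lam α β t : ℝ} (hlam : 0 < lam) (ht : 0 ≤ t)
include hlam ht

lemma weightBound_nonneg : 0 ≤ weightBound lam α β t := by
  unfold weightBound; positivity

omit ht in
lemma abs_weight_le (a : ℕ) {v : ℝ} (hv : 0 ≤ v) (hvt : v ≤ t) :
    |weight lam α β a v| ≤ weightBound lam α β t * (1 + a) := by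
  unfold weight weightBound
  have ha : (0 : ℝ) ≤ a := Nat.cast_nonneg a
  have h1 : |(a : ℝ) - lam * v| ≤ (1 + lam + lam * t) * (1 + a) := by
    have : lam * v ≤ lam * t := by gcongr
    have h0 : 0 ≤ lam * v := by positivity
    rw [abs_le]
    constructor <;> nlinarith [mul_nonneg hlam.le ha, mul_nonneg (h0.trans this) ha]
  calc |α * ((a : ℝ) - lam * v) + β| ≤ |α| * |(a : ℝ) - lam * v| + |β| := by
        rw [← abs_mul]; exact abs_add_le _ _
    _ ≤ |α| * ((1 + lam + lam * t) * (1 + a)) + |β| * (1 + a) := by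
        gcongr
        nlinarith [abs_nonneg β]
    _ = _ := by ring

lemma abs_weightDeriv_le (a : ℕ) (v : ℝ) :
    |weightDeriv lam α a v| ≤ weightBound lam α β t := by
  unfold weightDeriv weightBound
  rw [abs_neg, abs_mul, abs_of_pos hlam]
  have : 0 ≤ |α| * (1 + lam * t) := by positivity
  nlinarith [abs_nonneg β]

variable {q₀ : ℕ} {r₀ : ℝ} {ξ S : ℕ → ℝ} {f f' : ℕ → ℝ → ℝ} {C : ℝ} (hC : 0 ≤ C)
  (hf : ∀ (y : ℕ) (r : ℝ), 0 ≤ r →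
    |f y r| ≤ C * (1 + (y : ℝ) ^ 2 + r ^ 2) ∧ |f' y r| ≤ C * (1 + (y : ℝ) ^ 2 + r ^ 2))
  {a y : ℕ} {v r : ℝ} (hv : 0 ≤ v) (hvt : v ≤ t) (ha : a ≤ arrivalCount ξ t)
  (hy : y ≤ q₀ + arrivalCount ξ t) (hr : 0 ≤ r)
  (hr2 : r ^ 2 ≤ r₀ ^ 2 + ∑ j ∈ Finset.range (q₀ + arrivalCount ξ t), S j ^ 2)
include hC hf hv hvt ha hy hr hr2

lemma abs_weight_mul_le :
    |weight lam α β a v * f y r| ≤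
      3 * weightBound lam α β t * C * envelope q₀ r₀ ξ S t 3 := by
  have hw := weightBound_nonneg (α := α) (β := β) hlam ht
  have ha' : (a : ℝ) ≤ arrivalCount ξ t := by exact_mod_cast ha
  rw [abs_mul, envelope_succ]
  calc |weight lam α β a v| * |f y r|
      ≤ (weightBound lam α β t * (1 + arrivalCount ξ t)) *
        (C * (3 * envelope q₀ r₀ ξ S t 2)) := by
        refine mul_le_mul ((abs_weight_le hlam a hv hvt).trans (by gcongr)) ?_
          (abs_nonneg _) (by positivity)
        refine ((hf y r hr).1).trans ?_
        gcongr
        exact growth_le_envelope (hy.trans (Nat.le_succ _)) hr2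
    _ = _ := by ring

/-- The drift, the jumps at arrivals and the jumps at starts of services are bounded, throughout
`[0, t]`, by multiples of an envelope. -/
lemma abs_drift_le :
    |drift (weight lam α β) (weightDeriv lam α) f f' a v y r| ≤
      6 * weightBound lam α β t * C * envelope q₀ r₀ ξ S t 3 := by
  have hw := weightBound_nonneg (α := α) (β := β) hlam ht
  have ha' : (a : ℝ) ≤ arrivalCount ξ t := by exact_mod_cast ha
  have hE := envelope_nonneg q₀ r₀ ξ S t 2
  have hg := growth_le_envelope (S := S) (r₀ := r₀) (hy.trans (Nat.le_succ _)) hr2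
  have h1 : |weightDeriv lam α a v * f y r| ≤
      3 * weightBound lam α β t * C * envelope q₀ r₀ ξ S t 3 := by
    rw [abs_mul, envelope_succ]
    calc |weightDeriv lam α a v| * |f y r|
        ≤ (weightBound lam α β t * (1 + arrivalCount ξ t)) *
          (C * (3 * envelope q₀ r₀ ξ S t 2)) := by
          refine mul_le_mul ((abs_weightDeriv_le (β := β) hlam ht a v).trans ?_) ?_
            (abs_nonneg _) (by positivity)
          · exact le_mul_of_one_le_right hw (by linarith [Nat.cast_nonneg (α := ℝ) (arrivalCount ξ t)])
          · refine ((hf y r hr).1).trans ?_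
            gcongr
      _ = _ := by ring
  have h2 : |weight lam α β a v * (if 0 < r then f' y r else 0)| ≤
      3 * weightBound lam α β t * C * envelope q₀ r₀ ξ S t 3 := by
    rw [abs_mul, envelope_succ]
    calc |weight lam α β a v| * |if 0 < r then f' y r else 0|
        ≤ (weightBound lam α β t * (1 + arrivalCount ξ t)) *
          (C * (3 * envelope q₀ r₀ ξ S t 2)) := by
          refine mul_le_mul ((abs_weight_le hlam a hv hvt).trans (by gcongr)) ?_
            (abs_nonneg _) (by positivity)
          split_ifs
          · refine ((hf y r hr).2).trans ?_
            gcongr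
          · rw [abs_zero]; positivity
      _ = _ := by ring
  unfold drift
  exact (abs_sub _ _).trans (by linarith)

lemma abs_arrivalJump_le :
    |arrivalJump (weight lam α β) f a v y r| ≤
      9 * weightBound lam α β t * C * envelope q₀ r₀ ξ S t 3 := by
  have hw := weightBound_nonneg (α := α) (β := β) hlam ht
  have ha' : (a : ℝ) ≤ arrivalCount ξ t := by exact_mod_cast ha
  have hE := envelope_nonneg q₀ r₀ ξ S t 2
  have h1 := abs_weight_mul_le (α := α) (β := β) hlam ht hC hf hv hvt ha hy hr hr2
  have h2 : |weight lam α β (a + 1) v * f (y + 1) r| ≤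
      6 * weightBound lam α β t * C * envelope q₀ r₀ ξ S t 3 := by
    rw [abs_mul, envelope_succ]
    calc |weight lam α β (a + 1) v| * |f (y + 1) r|
        ≤ (weightBound lam α β t * (2 * (1 + arrivalCount ξ t))) *
          (C * (3 * envelope q₀ r₀ ξ S t 2)) := by
          refine mul_le_mul ((abs_weight_le hlam (a + 1) hv hvt).trans ?_) ?_
            (abs_nonneg _) (by positivity)
          · gcongr
            push_cast
            linarith [Nat.cast_nonneg (α := ℝ) (arrivalCount ξ t)]
          · refine ((hf (y + 1) r hr).1).trans ?_
            gcongr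
            exact growth_le_envelope (Nat.succ_le_succ hy) hr2
      _ = _ := by ring
  unfold arrivalJump
  exact (abs_sub _ _).trans (by linarith)

omit hv hvt ha hy hr hr2 in
lemma abs_startJump_le (h : GoodPath q₀ r₀ ξ S) (j : ℕ) :
    |if startTime q₀ r₀ ξ S j ≤ t then startJump (weight lam α β) f q₀ r₀ ξ S j else 0| ≤
      6 * weightBound lam α β t * C * envelope q₀ r₀ ξ S t 3 := by
  have hw := weightBound_nonneg (α := α) (β := β) hlam ht
  have hE := envelope_nonneg q₀ r₀ ξ S t 3
  split_ifs with hj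
  · have h0 : 0 ≤ startTime q₀ r₀ ξ S j :=
      (h.readyTime_nonneg j).trans (h.readyTime_le_startTime j)
    have hA := h.arrivalCount_mono hj
    have hlt := (h.availableTime_le_iff j h0).mp (availableTime_le_startTime q₀ r₀ ξ S j)
    have hs := Finset.sum_nonneg fun j (_ : j ∈ Finset.range (q₀ + arrivalCount ξ t)) =>
      sq_nonneg (S j)
    have b1 := abs_weight_mul_le (α := α) (β := β) (S := S) (q₀ := q₀) (r₀ := r₀)
      (y := q₀ + arrivalCount ξ (startTime q₀ r₀ ξ S j) - j - 1)
      (r := requirement q₀ r₀ S j) hlam ht hC hf h0 hj hA (by omega) (h.requirement_nonneg j)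
      (sq_requirement_le q₀ r₀ S (by omega))
    have b2 := abs_weight_mul_le (α := α) (β := β) (S := S) (q₀ := q₀) (r₀ := r₀)
      (y := q₀ + arrivalCount ξ (startTime q₀ r₀ ξ S j) - j)
      (r := 0) hlam ht hC hf h0 hj hA (by omega) le_rfl (by nlinarith [sq_nonneg r₀])
    rw [startJump_eq]
    exact (abs_sub _ _).trans (by linarith)
  · rw [abs_zero]; positivity

end Bounds

section EnvelopeIntegrable

variable {lam : ℝ} (hlam : 0 < lam) (G : Measure ℝ) [IsProbabilityMeasure G]
include hlam

omit hlam in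
lemma integrable_sum_sq (hG2 : Integrable (fun x : ℝ => x ^ 2) G) (N : ℕ) :
    Integrable (fun S : ℕ → ℝ => ∑ j ∈ Finset.range N, S j ^ 2) (iidLaw G) ∧
    ∫ S, ∑ j ∈ Finset.range N, S j ^ 2 ∂iidLaw G = N * moment G 2 := by
  have hmp := fun j : ℕ => measurePreserving_eval_infinitePi (fun _ : ℕ => G) j
  have h1 : ∀ j, Integrable (fun S : ℕ → ℝ => S j ^ 2) (iidLaw G) := fun j =>
    (hmp j).integrable_comp_of_integrable hG2
  refine ⟨integrable_finsetSum _ fun j _ => h1 j, ?_⟩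
  rw [integral_finsetSum _ fun j _ => h1 j]
  have h2 : ∀ j : ℕ, ∫ S : ℕ → ℝ, S j ^ 2 ∂iidLaw G = moment G 2 := by
    intro j
    have := integral_map (μ := iidLaw G) (φ := fun S : ℕ → ℝ => S j)
      (measurable_pi_apply j).aemeasurable (f := fun x : ℝ => x ^ 2)
      (by fun_prop : Measurable fun x : ℝ => x ^ 2).aestronglyMeasurable
    rw [show Measure.map (fun S : ℕ → ℝ => S j) (iidLaw G) = G from (hmp j).map_eq] at this
    exact this.symm
  simp [h2]

/-- The expectation of the envelope is bounded uniformly in terms of the initial state. -/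
lemma lintegral_envelope_le (hG2 : Integrable (fun x : ℝ => x ^ 2) G) (p : ℕ) {t : ℝ}
    (ht : 0 ≤ t) : ∃ K : ℝ≥0∞, K < ∞ ∧ ∀ (q₀ : ℕ) (r₀ : ℝ),
    ∫⁻ ω, ENNReal.ofReal (envelope q₀ r₀ ω.1 ω.2 t p)
      ∂((iidLaw (expMeasure lam)).prod (iidLaw G)) ≤
      K * ENNReal.ofReal (1 + (q₀ : ℝ) ^ 2 + r₀ ^ 2) := by
  have := isProbabilityMeasure_expMeasure hlam
  have hg2 : 0 ≤ moment G 2 := integral_nonneg fun x => sq_nonneg x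
  refine ⟨(∫⁻ ξ, ENNReal.ofReal ((1 + (arrivalCount ξ t : ℝ)) ^ (p + 1)) ∂iidLaw (expMeasure lam)) *
    ENNReal.ofReal (1 + 2 * moment G 2),
    ENNReal.mul_lt_top (lintegral_one_add_arrivalCount_pow_lt_top hlam (p + 1) ht)
      ENNReal.ofReal_lt_top, fun q₀ r₀ => ?_⟩
  have hm : Measurable fun ω : (ℕ → ℝ) × (ℕ → ℝ) =>
      ENNReal.ofReal (envelope q₀ r₀ ω.1 ω.2 t p) :=
    (measurable_envelope measurable_const measurable_const measurable_fst measurable_snd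
      t p).ennreal_ofReal
  rw [lintegral_prod _ hm.aemeasurable, mul_assoc, ← ENNReal.ofReal_mul (by positivity),
    ← lintegral_mul_const' _ _ ENNReal.ofReal_ne_top]
  refine lintegral_mono fun ξ => ?_
  set N := arrivalCount ξ t with hN
  obtain ⟨hi, he⟩ := integrable_sum_sq G hG2 (q₀ + N)
  have hint : Integrable (fun S : ℕ → ℝ => envelope q₀ r₀ ξ S t p) (iidLaw G) :=
    ((integrable_const (1 + (q₀ : ℝ) ^ 2 + r₀ ^ 2)).add hi).const_mul _
  rw [← ofReal_integral_eq_lintegral_ofReal hint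
    (Eventually.of_forall fun S => envelope_nonneg q₀ r₀ ξ S t p),
    ← ENNReal.ofReal_mul (by positivity)]
  refine ENNReal.ofReal_le_ofReal ?_
  have hv : ∫ S, envelope q₀ r₀ ξ S t p ∂iidLaw G =
      (1 + (N : ℝ)) ^ p * (1 + (q₀ : ℝ) ^ 2 + r₀ ^ 2 + (q₀ + N : ℕ) * moment G 2) := by
    unfold envelope
    rw [integral_const_mul, integral_add (integrable_const _) hi, he, integral_const]
    simp [hN]
  rw [hv, pow_succ (1 + (N : ℝ)), mul_assoc ((1 + (N : ℝ)) ^ p)]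
  refine mul_le_mul_of_nonneg_left ?_ (by positivity)
  push_cast
  have hN0 : (0 : ℝ) ≤ N := Nat.cast_nonneg _
  set q : ℝ := (q₀ : ℝ)
  set D : ℝ := 1 + q ^ 2 + r₀ ^ 2 with hD
  have hq1 : q ≤ D := by nlinarith [sq_nonneg (q - 1), sq_nonneg r₀]
  have hD1 : 1 ≤ D := by nlinarith [sq_nonneg q, sq_nonneg r₀]
  have h1 : q + N ≤ (1 + N) * D * 2 := by nlinarith
  have h2 : D ≤ (1 + N) * D := by nlinarith
  nlinarith [mul_le_mul_of_nonneg_right h1 hg2]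

lemma integrable_envelope (hG2 : Integrable (fun x : ℝ => x ^ 2) G) (p : ℕ) {t : ℝ}
    (ht : 0 ≤ t) (q₀ : ℕ) (r₀ : ℝ) :
    Integrable (fun ω : (ℕ → ℝ) × (ℕ → ℝ) => envelope q₀ r₀ ω.1 ω.2 t p)
      ((iidLaw (expMeasure lam)).prod (iidLaw G)) := by
  obtain ⟨K, hK, hle⟩ := lintegral_envelope_le hlam G hG2 p ht
  refine ⟨(measurable_envelope measurable_const measurable_const measurable_fst measurable_snd
      t p).aestronglyMeasurable, ?_⟩
  rw [hasFiniteIntegral_iff_ofReal (Eventually.of_forall fun _ => envelope_nonneg _ _ _ _ _ _)]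
  exact (hle q₀ r₀).trans_lt (ENNReal.mul_lt_top hK ENNReal.ofReal_lt_top)

end EnvelopeIntegrable

/-! ### The expected evolution from a fixed initial state -/

section RealCompensation

variable {lam : ℝ} (hlam : 0 < lam)

lemma measurable_sum_arrivals {J : ℝ → (ℕ → ℝ) → ℝ} (hJ : Measurable (Function.uncurry J))
    (t : ℝ) :
    Measurable fun ξ => ∑ n ∈ Finset.range (arrivalCount ξ t), J (arrivalEpoch ξ n) ξ :=
  measurable_apply_nat (g := fun N ξ => ∑ n ∈ Finset.range N, J (arrivalEpoch ξ n) ξ)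
    (fun _ => Finset.measurable_sum _ fun n _ =>
      hJ.comp ((measurable_arrivalEpoch n).prodMk measurable_id))
    (measurable_arrivalCount measurable_id measurable_const)

lemma measurable_intervalIntegral {α : Type*} [MeasurableSpace α] {J : ℝ → α → ℝ}
    (hJ : Measurable (Function.uncurry J)) {t : ℝ} (ht : 0 ≤ t) :
    Measurable fun a => ∫ v in 0..t, J v a := by
  simp_rw [intervalIntegral.integral_of_le ht]
  have h : StronglyMeasurable (Function.uncurry fun (a : α) (v : ℝ) => J v a) :=
    (hJ.comp measurable_swap).stronglyMeasurable
  exact h.integral_prod_right.measurable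

include hlam

lemma integral_sum_arrivals_of_nonneg {J : ℝ → (ℕ → ℝ) → ℝ}
    (hJ : Measurable (Function.uncurry J)) (hp : Predictable J) (h0 : ∀ v ξ, 0 ≤ J v ξ)
    {t : ℝ} (ht : 0 ≤ t)
    (hfin : ∫⁻ ξ, (∫⁻ v in Set.Ioc 0 t, ENNReal.ofReal (J v ξ)) ∂iidLaw (expMeasure lam) < ∞) :
    Integrable (fun ξ => ∑ n ∈ Finset.range (arrivalCount ξ t), J (arrivalEpoch ξ n) ξ)
      (iidLaw (expMeasure lam)) ∧
    Integrable (fun ξ => ∫ v in 0..t, J v ξ) (iidLaw (expMeasure lam)) ∧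
    ∫ ξ, ∑ n ∈ Finset.range (arrivalCount ξ t), J (arrivalEpoch ξ n) ξ
        ∂iidLaw (expMeasure lam) =
      lam * ∫ ξ, (∫ v in 0..t, J v ξ) ∂iidLaw (expMeasure lam) := by
  have := isProbabilityMeasure_expMeasure hlam
  have hs0 : ∀ ξ, 0 ≤ ∑ n ∈ Finset.range (arrivalCount ξ t), J (arrivalEpoch ξ n) ξ :=
    fun ξ => Finset.sum_nonneg fun n _ => h0 _ _
  have hi0 : ∀ ξ, 0 ≤ ∫ v in 0..t, J v ξ := fun ξ =>
    intervalIntegral.integral_nonneg ht fun v _ => h0 v ξ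
  have hc := lintegral_sum_arrivals hlam (J := fun v ξ => ENNReal.ofReal (J v ξ))
    hJ.ennreal_ofReal (fun n ξ ξ' v h1 h2 h3 h4 h5 h6 => by
      simp only [hp n ξ ξ' v h1 h2 h3 h4 h5 h6]) t
  simp_rw [← ENNReal.ofReal_sum_of_nonneg (fun n _ => h0 _ _)] at hc
  have hms := measurable_sum_arrivals hJ t
  have hmi := measurable_intervalIntegral hJ ht
  have hlt : ∀ᵐ ξ ∂iidLaw (expMeasure lam),
      (∫⁻ v in Set.Ioc 0 t, ENNReal.ofReal (J v ξ)) < ∞ := by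
    refine ae_lt_top ?_ hfin.ne
    exact Measurable.lintegral_prod_right' (f := fun p : (ℕ → ℝ) × ℝ => ENNReal.ofReal (J p.2 p.1))
      (hJ.comp measurable_swap).ennreal_ofReal
  have hii : ∀ᵐ ξ ∂iidLaw (expMeasure lam),
      ENNReal.ofReal (∫ v in 0..t, J v ξ) = ∫⁻ v in Set.Ioc 0 t, ENNReal.ofReal (J v ξ) := by
    filter_upwards [hlt] with ξ hξ
    rw [intervalIntegral.integral_of_le ht, ofReal_integral_eq_lintegral_ofReal]
    · refine ⟨(hJ.comp (measurable_id.prodMk measurable_const)).aestronglyMeasurable, ?_⟩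
      rwa [hasFiniteIntegral_iff_ofReal (Eventually.of_forall fun v => h0 v ξ)]
    · exact Eventually.of_forall fun v => h0 v ξ
  rw [← lintegral_congr_ae hii] at hc hfin
  refine ⟨⟨hms.aestronglyMeasurable, ?_⟩, ⟨hmi.aestronglyMeasurable, ?_⟩, ?_⟩
  · rw [hasFiniteIntegral_iff_ofReal (Eventually.of_forall hs0), hc]
    exact ENNReal.mul_lt_top ENNReal.ofReal_lt_top hfin
  · rwa [hasFiniteIntegral_iff_ofReal (Eventually.of_forall hi0)]
  · rw [integral_eq_lintegral_of_nonneg_ae (Eventually.of_forall hs0) hms.aestronglyMeasurable, hc,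
      integral_eq_lintegral_of_nonneg_ae (Eventually.of_forall hi0) hmi.aestronglyMeasurable,
      ENNReal.toReal_mul, ENNReal.toReal_ofReal hlam.le]

/-- Compensation of Poisson arrivals for real integrands. -/
theorem integral_sum_arrivals {J : ℝ → (ℕ → ℝ) → ℝ}
    (hJ : Measurable (Function.uncurry J)) (hp : Predictable J) {t : ℝ} (ht : 0 ≤ t)
    (hfin : ∫⁻ ξ, (∫⁻ v in Set.Ioc 0 t, ENNReal.ofReal |J v ξ|) ∂iidLaw (expMeasure lam) < ∞) :
    ∫ ξ, ∑ n ∈ Finset.range (arrivalCount ξ t), J (arrivalEpoch ξ n) ξ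
        ∂iidLaw (expMeasure lam) =
      lam * ∫ ξ, (∫ v in 0..t, J v ξ) ∂iidLaw (expMeasure lam) := by
  have := isProbabilityMeasure_expMeasure hlam
  have hpos := integral_sum_arrivals_of_nonneg hlam (J := fun v ξ => max (J v ξ) 0)
    (hJ.max measurable_const) (fun n ξ ξ' v h1 h2 h3 h4 h5 h6 => by
      simp only [hp n ξ ξ' v h1 h2 h3 h4 h5 h6]) (fun _ _ => le_max_right _ _) ht
    ((lintegral_mono fun ξ => lintegral_mono fun v => ENNReal.ofReal_le_ofReal
      (max_le (le_abs_self _) (abs_nonneg _))).trans_lt hfin)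
  have hneg := integral_sum_arrivals_of_nonneg hlam (J := fun v ξ => max (-J v ξ) 0)
    (hJ.neg.max measurable_const) (fun n ξ ξ' v h1 h2 h3 h4 h5 h6 => by
      simp only [hp n ξ ξ' v h1 h2 h3 h4 h5 h6]) (fun _ _ => le_max_right _ _) ht
    ((lintegral_mono fun ξ => lintegral_mono fun v => ENNReal.ofReal_le_ofReal
      (max_le (neg_le_abs _) (abs_nonneg _))).trans_lt hfin)
  have hsub : ∀ v ξ, J v ξ = max (J v ξ) 0 - max (-J v ξ) 0 := by
    intro v ξ
    rcases le_total 0 (J v ξ) with h | h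
    · rw [max_eq_left h, max_eq_right (by linarith)]; ring
    · rw [max_eq_right h, max_eq_left (by linarith)]; ring
  have h1 : ∀ ξ, ∑ n ∈ Finset.range (arrivalCount ξ t), J (arrivalEpoch ξ n) ξ =
      (∑ n ∈ Finset.range (arrivalCount ξ t), max (J (arrivalEpoch ξ n) ξ) 0) -
      ∑ n ∈ Finset.range (arrivalCount ξ t), max (-J (arrivalEpoch ξ n) ξ) 0 := by
    intro ξ
    rw [← Finset.sum_sub_distrib]
    exact Finset.sum_congr rfl fun n _ => hsub _ _
  have hlt : ∀ᵐ ξ ∂iidLaw (expMeasure lam),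
      (∫⁻ v in Set.Ioc 0 t, ENNReal.ofReal |J v ξ|) < ∞ := by
    refine ae_lt_top ?_ hfin.ne
    exact Measurable.lintegral_prod_right' (f := fun p : (ℕ → ℝ) × ℝ => ENNReal.ofReal |J p.2 p.1|)
      (measurable_norm.comp (hJ.comp measurable_swap)).ennreal_ofReal
  have h2 : ∀ᵐ ξ ∂iidLaw (expMeasure lam), ∫ v in 0..t, J v ξ =
      (∫ v in 0..t, max (J v ξ) 0) - ∫ v in 0..t, max (-J v ξ) 0 := by
    filter_upwards [hlt] with ξ hξ
    have hi : IntervalIntegrable (fun v => J v ξ) volume 0 t := by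
      rw [intervalIntegrable_iff_integrableOn_Ioc_of_le ht]
      refine ⟨(hJ.comp (measurable_id.prodMk measurable_const)).aestronglyMeasurable, ?_⟩
      rw [hasFiniteIntegral_iff_norm]
      exact hξ
    have hp1 : IntervalIntegrable (fun v => max (J v ξ) 0) volume 0 t := by
      rw [intervalIntegrable_iff_integrableOn_Ioc_of_le ht] at hi ⊢
      exact hi.pos_part
    have hn1 : IntervalIntegrable (fun v => max (-J v ξ) 0) volume 0 t := by
      rw [intervalIntegrable_iff_integrableOn_Ioc_of_le ht] at hi ⊢
      exact hi.neg_part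
    rw [← intervalIntegral.integral_sub hp1 hn1]
    exact intervalIntegral.integral_congr fun v _ => hsub v ξ
  simp_rw [h1]
  rw [integral_congr_ae h2, integral_sub hpos.1 hneg.1, integral_sub hpos.2.1 hneg.2.1, hpos.2.2,
    hneg.2.2]
  ring

end RealCompensation

lemma measurable_uncurry_nat {f : ℕ → ℝ → ℝ} (hf : ∀ y, Measurable (f y)) {α : Type*}
    [MeasurableSpace α] {n : α → ℕ} {r : α → ℝ} (hn : Measurable n) (hr : Measurable r) :
    Measurable fun a => f (n a) (r a) := by
  have : Measurable fun p : ℕ × ℝ => f p.1 p.2 := measurable_from_prod_countable_right hf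
  exact this.comp (hn.prodMk hr)

lemma measurable_weight (lam α β : ℝ) (a : ℕ) : Measurable (weight lam α β a) := by
  unfold weight; fun_prop

lemma TestFunction.measurable {G : Measure ℝ} {f f' : ℕ → ℝ → ℝ} (hf : TestFunction G f f') (y : ℕ) :
    Measurable (f y) :=
  (continuous_iff_continuousAt.mpr fun r => (hf.hasDerivAt y r).continuousAt).measurable

lemma measurable_drift {G : Measure ℝ} {f f' : ℕ → ℝ → ℝ} (hf : TestFunction G f f')
    (lam α β : ℝ) {E : Type*} [MeasurableSpace E] {a y : E → ℕ} {v r : E → ℝ} (ha : Measurable a)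
    (hv : Measurable v) (hy : Measurable y) (hr : Measurable r) :
    Measurable fun e => drift (weight lam α β) (weightDeriv lam α) f f' (a e) (v e) (y e) (r e) := by
  unfold drift
  refine Measurable.sub (Measurable.mul ?_ (measurable_uncurry_nat hf.measurable hy hr))
    (Measurable.mul (measurable_uncurry_nat (measurable_weight lam α β) ha hv) ?_)
  · exact measurable_const
  · exact Measurable.ite (measurableSet_lt measurable_const hr)
      (measurable_uncurry_nat (fun y => (hf.continuous_deriv y).measurable) hy hr) measurable_const

lemma measurable_arrivalJump {G : Measure ℝ} {f f' : ℕ → ℝ → ℝ} (hf : TestFunction G f f')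
    (lam α β : ℝ) {E : Type*} [MeasurableSpace E] {a y : E → ℕ} {v r : E → ℝ} (ha : Measurable a)
    (hv : Measurable v) (hy : Measurable y) (hr : Measurable r) :
    Measurable fun e => arrivalJump (weight lam α β) f (a e) (v e) (y e) (r e) := by
  unfold arrivalJump
  have ha1 : Measurable fun e => a e + 1 := ha.add measurable_const
  have hy1 : Measurable fun e => y e + 1 := hy.add measurable_const
  exact ((measurable_uncurry_nat (measurable_weight lam α β) ha1 hv).mul
    (measurable_uncurry_nat hf.measurable hy1 hr)).sub
    ((measurable_uncurry_nat (measurable_weight lam α β) ha hv).mul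
    (measurable_uncurry_nat hf.measurable hy hr))

/-- The law of the interarrival and service times. -/
abbrev inputLaw (lam : ℝ) (G : Measure ℝ) : Measure ((ℕ → ℝ) × (ℕ → ℝ)) :=
  (iidLaw (expMeasure lam)).prod (iidLaw G)

section FixedInitialState

variable {lam : ℝ} (hlam : 0 < lam) {G : Measure ℝ} [IsProbabilityMeasure G]
  (hG : ∀ᵐ x ∂G, 0 ≤ x) (hG2 : Integrable (fun x : ℝ => x ^ 2) G)
  {f f' : ℕ → ℝ → ℝ} (hf : TestFunction G f f') (α β : ℝ)
  {q₀ : ℕ} {r₀ : ℝ} (hq : q₀ = 0 → r₀ = 0) (hr : 0 < q₀ → 0 < r₀) {t : ℝ} (ht : 0 ≤ t)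

include hG hq hr in
lemma RegularArrivals.ae_goodPath {ξ : ℕ → ℝ} (hξ : RegularArrivals ξ) :
    ∀ᵐ S ∂iidLaw G, GoodPath q₀ r₀ ξ S := by
  filter_upwards [ae_forall_iidLaw G hG] with S hS
  exact ⟨hξ.1, hξ.2, hS, hq, hr⟩

include hlam hG hq hr in
lemma ae_goodPath : ∀ᵐ ω ∂inputLaw lam G, GoodPath q₀ r₀ ω.1 ω.2 := by
  have := isProbabilityMeasure_expMeasure hlam
  have h1 : ∀ᵐ ω ∂inputLaw lam G, RegularArrivals ω.1 :=
    Measure.quasiMeasurePreserving_fst.ae (ae_regularArrivals hlam)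
  have h2 : ∀ᵐ ω ∂inputLaw lam G, ∀ n, 0 ≤ ω.2 n :=
    Measure.quasiMeasurePreserving_snd.ae (ae_forall_iidLaw G hG)
  filter_upwards [h1, h2] with ω h1 h2
  exact ⟨h1.1, h1.2, h2, hq, hr⟩

include hG hG2 in
lemma TestFunction.integrable (hf : TestFunction G f f') (y : ℕ) : Integrable (f y) G := by
  obtain ⟨C, hC, hb⟩ := hf.growth
  refine Integrable.mono' (g := fun x => C * (1 + (y : ℝ) ^ 2 + x ^ 2))
    (((integrable_const _).add hG2).const_mul C) (hf.measurable y).aestronglyMeasurable ?_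
  filter_upwards [hG] with x hx
  exact (hb y x hx).1

omit [IsProbabilityMeasure G] in
include hf in
lemma measurable_startTerm (j : ℕ) : Measurable fun ω : (ℕ → ℝ) × (ℕ → ℝ) =>
    if startTime q₀ r₀ ω.1 ω.2 j ≤ t then
      startJump (weight lam α β) f q₀ r₀ ω.1 ω.2 j else 0 := by
  have hσ : Measurable fun ω : (ℕ → ℝ) × (ℕ → ℝ) => startTime q₀ r₀ ω.1 ω.2 j :=
    measurable_startTime measurable_const measurable_const measurable_fst measurable_snd j
  have hA : Measurable fun ω : (ℕ → ℝ) × (ℕ → ℝ) =>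
      arrivalCount ω.1 (startTime q₀ r₀ ω.1 ω.2 j) := measurable_arrivalCount measurable_fst hσ
  have hR : Measurable fun ω : (ℕ → ℝ) × (ℕ → ℝ) => requirement q₀ r₀ ω.2 j :=
    measurable_requirement measurable_const measurable_const measurable_snd j
  refine Measurable.ite (measurableSet_le hσ measurable_const) ?_ measurable_const
  unfold startJump
  refine (measurable_uncurry_nat (measurable_weight lam α β) hA hσ).mul (Measurable.sub ?_ ?_)
  · exact measurable_uncurry_nat hf.measurable
      (((measurable_const.add hA).sub measurable_const).sub measurable_const) hR
  · exact measurable_uncurry_nat hf.measurable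
      ((measurable_const.add hA).sub measurable_const) measurable_const

include hG2 in
lemma integrable_envelope_right (ξ : ℕ → ℝ) (p : ℕ) :
    Integrable (fun S => envelope q₀ r₀ ξ S t p) (iidLaw G) :=
  ((integrable_const _).add (integrable_sum_sq G hG2 _).1).const_mul _

include hlam hG hG2 hf hq hr ht

/-- The start of a service not under way at time `0` has no expected effect on a test function. -/
lemma integral_startTerm_eq_zero {ξ : ℕ → ℝ} (hξ : RegularArrivals ξ) {j : ℕ}
    (hj : ¬ (j = 0 ∧ 0 < q₀)) :
    ∫ S, (if startTime q₀ r₀ ξ S j ≤ t then startJump (weight lam α β) f q₀ r₀ ξ S j else 0)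
      ∂iidLaw G = 0 := by
  obtain ⟨C, hC, hb⟩ := hf.growth
  have hm : Measurable fun S : ℕ → ℝ => if startTime q₀ r₀ ξ S j ≤ t then
      startJump (weight lam α β) f q₀ r₀ ξ S j else 0 :=
    (measurable_startTerm hf α β j).comp
      (measurable_const.prodMk measurable_id)
  have hint : Integrable (fun S : ℕ → ℝ => if startTime q₀ r₀ ξ S j ≤ t then
      startJump (weight lam α β) f q₀ r₀ ξ S j else 0) (iidLaw G) := by
    refine Integrable.mono' ((integrable_envelope_right (q₀ := q₀) (r₀ := r₀) (t := t) hG2 ξ 3).const_mul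
      (6 * weightBound lam α β t * C)) hm.aestronglyMeasurable ?_
    filter_upwards [hξ.ae_goodPath hG hq hr] with S hS
    exact abs_startJump_le hlam ht hC hb hS j
  rw [integral_update_iidLaw G j hm hint]
  refine integral_eq_zero_of_ae ?_
  filter_upwards [hξ.ae_goodPath hG hq hr] with S hS
  simp only [startJump, startTime_update, requirement, if_neg hj, Function.update_self,
    Pi.zero_apply]
  split_ifs with hle
  · set k := q₀ + arrivalCount ξ (startTime q₀ r₀ ξ S j) - j with hk
    have hlt := (hS.availableTime_le_iff j ((hS.readyTime_nonneg j).trans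
      (hS.readyTime_le_startTime j))).mp (availableTime_le_startTime q₀ r₀ ξ S j)
    have hk1 : k - 1 + 1 = k := by omega
    rw [integral_const_mul, integral_sub (hf.integrable hG hG2 _) (integrable_const _),
      hf.integral_eq, hk1]
    simp
  · exact integral_zero _ _

/-- Only a service under way at time `0` contributes to the expected sum over the starts of services,
because its length `r₀` is not drawn from `G`. -/
lemma integral_startSum {ξ : ℕ → ℝ} (hξ : RegularArrivals ξ) :
    ∫ S, (∑ j ∈ Finset.range (q₀ + arrivalCount ξ t), if startTime q₀ r₀ ξ S j ≤ t then
        startJump (weight lam α β) f q₀ r₀ ξ S j else 0) ∂iidLaw G =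
      weight lam α β 0 0 * (f (q₀ - 1) r₀ - f q₀ 0) := by
  obtain ⟨C, hC, hb⟩ := hf.growth
  have hint : ∀ j, Integrable (fun S : ℕ → ℝ => if startTime q₀ r₀ ξ S j ≤ t then
      startJump (weight lam α β) f q₀ r₀ ξ S j else 0) (iidLaw G) := by
    intro j
    have hm : Measurable fun S : ℕ → ℝ => if startTime q₀ r₀ ξ S j ≤ t then
        startJump (weight lam α β) f q₀ r₀ ξ S j else 0 :=
      (measurable_startTerm hf α β j).comp
        (measurable_const.prodMk measurable_id)
    refine Integrable.mono' ((integrable_envelope_right (q₀ := q₀) (r₀ := r₀) (t := t) hG2 ξ 3).const_mul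
      (6 * weightBound lam α β t * C)) hm.aestronglyMeasurable ?_
    filter_upwards [hξ.ae_goodPath hG hq hr] with S hS
    exact abs_startJump_le hlam ht hC hb hS j
  rw [integral_finsetSum _ fun j _ => hint j]
  rcases Nat.eq_zero_or_pos q₀ with h0 | h0
  · rw [Finset.sum_eq_zero fun j _ => integral_startTerm_eq_zero hlam hG hG2 hf α β hq hr ht hξ
      fun hj => hj.2.ne' h0, hq h0, h0]
    simp
  · rw [Finset.sum_eq_single_of_mem 0 (Finset.mem_range.mpr (by omega)) fun j _ hj0 =>
      integral_startTerm_eq_zero hlam hG hG2 hf α β hq hr ht hξ fun hj => hj0 hj.1]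
    have hσ : ∀ S : ℕ → ℝ, startTime q₀ r₀ ξ S 0 = 0 := fun S => by
      simp [startTime, availableTime, h0]
    have hA : arrivalCount ξ 0 = 0 := hξ.goodPath.arrivalCount_zero
    simp [startJump, hσ, ht, hA, requirement, h0]

/-- The integrand of the expected evolution: the generator of the state process with the arrival
count, applied to `weight * f`. -/
def generatorTerm (lam α β : ℝ) (f f' : ℕ → ℝ → ℝ) (a : ℕ) (v : ℝ) (y : ℕ) (r : ℝ) : ℝ :=
  drift (weight lam α β) (weightDeriv lam α) f f' a v y r +
    lam * arrivalJump (weight lam α β) f a v y r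

set_option maxHeartbeats 400000 in
/-- **Dynkin's formula** for the product of a test function of the state and an affine function of
the compensated arrival count. -/
theorem dynkin :
    ∫ ω, weight lam α β (arrivalCount ω.1 t) t *
        f (waiting q₀ r₀ ω.1 ω.2 t) (residualService q₀ r₀ ω.1 ω.2 t) ∂inputLaw lam G =
      β * f (q₀ - 1) r₀ + ∫ ω, (∫ v in 0..t, generatorTerm lam α β f f' (arrivalCount ω.1 v) v
        (waiting q₀ r₀ ω.1 ω.2 v) (residualService q₀ r₀ ω.1 ω.2 v)) ∂inputLaw lam G := by
  have := isProbabilityMeasure_expMeasure hlam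
  obtain ⟨C, hC, hb⟩ := hf.growth
  have hK := weightBound_nonneg (α := α) (β := β) hlam ht
  set K := weightBound lam α β t * C with hKdef
  have hK0 : 0 ≤ K := mul_nonneg hK hC
  have hgood := ae_goodPath hlam hG hq hr
  have henv := fun p => integrable_envelope hlam G hG2 p ht q₀ r₀
  -- the four pieces of the evolution formula
  obtain ⟨dr, hdr⟩ : ∃ dr : ℝ → (ℕ → ℝ) × (ℕ → ℝ) → ℝ, dr = fun v ω =>
      drift (weight lam α β) (weightDeriv lam α) f f' (arrivalCountBefore ω.1 v) v
        (waitingBefore q₀ r₀ ω.1 ω.2 v) (residualBefore q₀ r₀ ω.1 ω.2 v) := ⟨_, rfl⟩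
  obtain ⟨ju, hju⟩ : ∃ ju : ℝ → (ℕ → ℝ) × (ℕ → ℝ) → ℝ, ju = fun v ω =>
      arrivalJump (weight lam α β) f (arrivalCountBefore ω.1 v) v
        (waitingBefore q₀ r₀ ω.1 ω.2 v) (residualBefore q₀ r₀ ω.1 ω.2 v) := ⟨_, rfl⟩
  have hmA : Measurable fun p : ℝ × ((ℕ → ℝ) × (ℕ → ℝ)) => arrivalCountBefore p.2.1 p.1 :=
    measurable_arrivalCountBefore (measurable_fst.comp measurable_snd) measurable_fst
  have hmY : Measurable fun p : ℝ × ((ℕ → ℝ) × (ℕ → ℝ)) => waitingBefore q₀ r₀ p.2.1 p.2.2 p.1 :=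
    measurable_waitingBefore measurable_const measurable_const (measurable_fst.comp measurable_snd)
      (measurable_snd.comp measurable_snd) measurable_fst
  have hmR : Measurable fun p : ℝ × ((ℕ → ℝ) × (ℕ → ℝ)) => residualBefore q₀ r₀ p.2.1 p.2.2 p.1 :=
    measurable_residualBefore measurable_const measurable_const (measurable_fst.comp measurable_snd)
      (measurable_snd.comp measurable_snd) measurable_fst
  have hmdr : Measurable (Function.uncurry dr) := by
    rw [hdr]
    exact measurable_drift hf lam α β hmA measurable_fst hmY hmR
  have hmju : Measurable (Function.uncurry ju) := by
    rw [hju]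
    exact measurable_arrivalJump hf lam α β hmA measurable_fst hmY hmR
  have hdrb : ∀ ω, GoodPath q₀ r₀ ω.1 ω.2 → ∀ v, 0 < v → v ≤ t →
      |dr v ω| ≤ 6 * K * envelope q₀ r₀ ω.1 ω.2 t 3 := by
    intro ω h v hv hvt
    obtain ⟨b1, b2, b3⟩ := h.stateBefore_bound hv hvt
    have := abs_drift_le (α := α) (β := β) hlam ht hC hb hv.le hvt (h.arrivalCountBefore_le hvt)
      b1 b2 b3
    rw [hKdef, ← mul_assoc, hdr]; exact this
  have hjub : ∀ ω, GoodPath q₀ r₀ ω.1 ω.2 → ∀ v, 0 < v → v ≤ t →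
      |ju v ω| ≤ 9 * K * envelope q₀ r₀ ω.1 ω.2 t 3 := by
    intro ω h v hv hvt
    obtain ⟨b1, b2, b3⟩ := h.stateBefore_bound hv hvt
    have := abs_arrivalJump_le (α := α) (β := β) hlam ht hC hb hv.le hvt
      (h.arrivalCountBefore_le hvt) b1 b2 b3
    rw [hKdef, ← mul_assoc, hju]; exact this
  have hIint : ∀ (g : ℝ → (ℕ → ℝ) × (ℕ → ℝ) → ℝ) (c : ℝ), Measurable (Function.uncurry g) →
      (∀ ω, GoodPath q₀ r₀ ω.1 ω.2 → ∀ v, 0 < v → v ≤ t →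
        |g v ω| ≤ c * envelope q₀ r₀ ω.1 ω.2 t 3) →
      Integrable (fun ω => ∫ v in 0..t, g v ω) (inputLaw lam G) := by
    intro g c hg hgb
    refine Integrable.mono' (((henv 3).const_mul c).mul_const |t - 0|)
      (measurable_intervalIntegral hg ht).aestronglyMeasurable ?_
    filter_upwards [hgood] with ω h
    refine intervalIntegral.norm_integral_le_of_norm_le_const fun v hv => ?_
    rw [Set.uIoc_of_le ht] at hv
    exact hgb ω h v hv.1 hv.2
  have hIdr := hIint dr _ hmdr hdrb
  have hIju := hIint ju _ hmju hjub
  have hsumI : Integrable (fun ω : (ℕ → ℝ) × (ℕ → ℝ) =>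
      ∑ n ∈ Finset.range (arrivalCount ω.1 t), ju (arrivalEpoch ω.1 n) ω) (inputLaw lam G) := by
    refine Integrable.mono' ((henv 4).const_mul (9 * K)) ?_ ?_
    · have hpair : ∀ n, Measurable fun ω : (ℕ → ℝ) × (ℕ → ℝ) => (arrivalEpoch ω.1 n, ω) := fun n =>
        ((measurable_arrivalEpoch n).comp measurable_fst).prodMk measurable_id
      have hterm : ∀ n, Measurable fun ω : (ℕ → ℝ) × (ℕ → ℝ) => ju (arrivalEpoch ω.1 n) ω :=
        fun n => hmju.comp (hpair n)
      have hmg : ∀ N : ℕ, Measurable fun ω : (ℕ → ℝ) × (ℕ → ℝ) =>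
          ∑ n ∈ Finset.range N, ju (arrivalEpoch ω.1 n) ω := fun N =>
        Finset.measurable_sum _ fun n _ => hterm n
      exact (measurable_apply_nat hmg
        (measurable_arrivalCount measurable_fst measurable_const)).aestronglyMeasurable
    · filter_upwards [hgood] with ω h
      refine (Finset.abs_sum_le_sum_abs _ _).trans ((Finset.sum_le_sum fun n hn => hjub ω h _
        (h.arrivalEpoch_pos n) ((h.lt_arrivalCount_iff n t).mp (Finset.mem_range.mp hn))).trans ?_)
      rw [Finset.sum_const, Finset.card_range, nsmul_eq_mul, envelope_succ q₀ r₀ ω.1 ω.2 t 3]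
      nlinarith [mul_nonneg hK0 (envelope_nonneg q₀ r₀ ω.1 ω.2 t 3)]
  have hstartI : Integrable (fun ω : (ℕ → ℝ) × (ℕ → ℝ) =>
      ∑ j ∈ Finset.range (q₀ + arrivalCount ω.1 t), if startTime q₀ r₀ ω.1 ω.2 j ≤ t then
        startJump (weight lam α β) f q₀ r₀ ω.1 ω.2 j else 0) (inputLaw lam G) := by
    refine Integrable.mono' ((henv 4).const_mul ((1 + q₀) * (6 * K))) ?_ ?_
    · have hmN : Measurable fun ω : (ℕ → ℝ) × (ℕ → ℝ) => q₀ + arrivalCount ω.1 t :=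
        (measurable_from_nat (f := fun m : ℕ => q₀ + m)).comp
          (measurable_arrivalCount measurable_fst measurable_const)
      have hmg : ∀ N : ℕ, Measurable fun ω : (ℕ → ℝ) × (ℕ → ℝ) =>
          ∑ j ∈ Finset.range N, if startTime q₀ r₀ ω.1 ω.2 j ≤ t then
          startJump (weight lam α β) f q₀ r₀ ω.1 ω.2 j else 0 := fun N =>
        Finset.measurable_sum _ fun n _ => measurable_startTerm hf α β n
      exact (measurable_apply_nat hmg hmN).aestronglyMeasurable
    · filter_upwards [hgood] with ω h
      refine (Finset.abs_sum_le_sum_abs _ _).trans ((Finset.sum_le_sum fun j _ =>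
        abs_startJump_le hlam ht hC hb h j).trans ?_)
      rw [Finset.sum_const, Finset.card_range, nsmul_eq_mul, envelope_succ q₀ r₀ ω.1 ω.2 t 3]
      have hE := mul_nonneg hK0 (envelope_nonneg q₀ r₀ ω.1 ω.2 t 3)
      have : ((q₀ + arrivalCount ω.1 t : ℕ) : ℝ) ≤ (1 + q₀) * (1 + arrivalCount ω.1 t) := by
        push_cast
        nlinarith [mul_nonneg (Nat.cast_nonneg (α := ℝ) q₀)
          (Nat.cast_nonneg (α := ℝ) (arrivalCount ω.1 t))]
      have e6 : 6 * weightBound lam α β t * C * envelope q₀ r₀ ω.1 ω.2 t 3 =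
          6 * (K * envelope q₀ r₀ ω.1 ω.2 t 3) := by rw [hKdef]; ring
      rw [e6]
      refine (mul_le_mul_of_nonneg_right this (by linarith)).trans (le_of_eq ?_)
      ring
  -- the path identity, integrated
  have hpath : ∀ᵐ ω ∂inputLaw lam G, weight lam α β (arrivalCount ω.1 t) t *
        f (waiting q₀ r₀ ω.1 ω.2 t) (residualService q₀ r₀ ω.1 ω.2 t) =
      weight lam α β 0 0 * f q₀ 0 + (∫ v in 0..t, dr v ω) +
      ∑ n ∈ Finset.range (arrivalCount ω.1 t), ju (arrivalEpoch ω.1 n) ω +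
      ∑ j ∈ Finset.range (q₀ + arrivalCount ω.1 t), if startTime q₀ r₀ ω.1 ω.2 j ≤ t then
        startJump (weight lam α β) f q₀ r₀ ω.1 ω.2 j else 0 := by
    filter_upwards [hgood] with ω h
    have hs : ∑ n ∈ Finset.range (arrivalCount ω.1 t), ju (arrivalEpoch ω.1 n) ω =
        ∑ n ∈ Finset.range (arrivalCount ω.1 t), arrivalJump (weight lam α β) f n
          (arrivalEpoch ω.1 n) (waitingBefore q₀ r₀ ω.1 ω.2 (arrivalEpoch ω.1 n))
          (residualBefore q₀ r₀ ω.1 ω.2 (arrivalEpoch ω.1 n)) :=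
      Finset.sum_congr rfl fun n _ => by simp only [hju, h.arrivalCountBefore_arrivalEpoch]
    rw [(h.evolution (hasDerivAt_weight lam α β) (fun _ => continuous_const) hf.hasDerivAt
      hf.continuous_deriv ht).2, hs, hdr]
  have hI1 : Integrable (fun ω => weight lam α β 0 0 * f q₀ 0 + ∫ v in 0..t, dr v ω)
      (inputLaw lam G) := (integrable_const _).add hIdr
  have hI2 : Integrable (fun ω : (ℕ → ℝ) × (ℕ → ℝ) => weight lam α β 0 0 * f q₀ 0 +
      (∫ v in 0..t, dr v ω) + ∑ n ∈ Finset.range (arrivalCount ω.1 t), ju (arrivalEpoch ω.1 n) ω)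
      (inputLaw lam G) := hI1.add hsumI
  rw [integral_congr_ae hpath, integral_add hI2 hstartI, integral_add hI1 hsumI,
    integral_add (integrable_const _) hIdr]
  -- the starts of services
  have e1 : ∫ ω : (ℕ → ℝ) × (ℕ → ℝ), (∑ j ∈ Finset.range (q₀ + arrivalCount ω.1 t),
      if startTime q₀ r₀ ω.1 ω.2 j ≤ t then
        startJump (weight lam α β) f q₀ r₀ ω.1 ω.2 j else 0) ∂inputLaw lam G =
      weight lam α β 0 0 * (f (q₀ - 1) r₀ - f q₀ 0) := by
    rw [integral_prod _ hstartI]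
    have : ∀ᵐ ξ ∂iidLaw (expMeasure lam), ∫ S, (∑ j ∈ Finset.range (q₀ + arrivalCount ξ t),
        if startTime q₀ r₀ ξ S j ≤ t then startJump (weight lam α β) f q₀ r₀ ξ S j else 0)
        ∂iidLaw G = weight lam α β 0 0 * (f (q₀ - 1) r₀ - f q₀ 0) := by
      filter_upwards [ae_regularArrivals hlam] with ξ hξ
      exact integral_startSum hlam hG hG2 hf α β hq hr ht hξ
    rw [integral_congr_ae this]
    simp
  -- the arrivals
  have e2 : ∫ ω : (ℕ → ℝ) × (ℕ → ℝ), (∑ n ∈ Finset.range (arrivalCount ω.1 t),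
      ju (arrivalEpoch ω.1 n) ω) ∂inputLaw lam G =
      lam * ∫ ω, (∫ v in 0..t, ju v ω) ∂inputLaw lam G := by
    rw [integral_prod_symm _ hsumI, integral_prod_symm _ hIju, ← integral_const_mul]
    refine integral_congr_ae ?_
    filter_upwards [ae_forall_iidLaw G hG, (henv 3).prod_left_ae] with S hS hE
    have hgp : ∀ ξ, RegularArrivals ξ → GoodPath q₀ r₀ ξ S := fun ξ h => ⟨h.1, h.2, hS, hq, hr⟩
    refine integral_sum_arrivals hlam (J := fun v ξ => ju v (ξ, S))
      (hmju.comp (measurable_fst.prodMk (measurable_snd.prodMk measurable_const))) ?_ ht ?_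
    · intro n ξ ξ' v h h' hag hv h1 h2
      obtain ⟨c1, c2, c3⟩ := stateBefore_congr (hgp ξ h) (hgp ξ' h') hag hv h1 h2
      simp only [hju, c1, c2, c3]
    · refine lt_of_le_of_lt (lintegral_mono_ae (g := fun ξ =>
        ENNReal.ofReal (9 * K * envelope q₀ r₀ ξ S t 3) * ENNReal.ofReal t) ?_) ?_
      · filter_upwards [ae_regularArrivals hlam] with ξ hξ
        refine (setLIntegral_mono_ae (g := fun _ =>
          ENNReal.ofReal (9 * K * envelope q₀ r₀ ξ S t 3)) aemeasurable_const
          (Eventually.of_forall fun v hv => ENNReal.ofReal_le_ofReal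
            (hjub (ξ, S) (hgp ξ hξ) v hv.1 hv.2))).trans ?_
        rw [setLIntegral_const, Real.volume_Ioc, sub_zero]
      · rw [lintegral_mul_const' _ _ ENNReal.ofReal_ne_top]
        refine ENNReal.mul_lt_top ?_ ENNReal.ofReal_lt_top
        exact (hasFiniteIntegral_iff_ofReal (Eventually.of_forall fun ξ =>
          mul_nonneg (by positivity) (envelope_nonneg q₀ r₀ ξ S t 3))).mp (hE.const_mul (9 * K)).2
  rw [e1, e2]
  have e3 : ∫ ω, (∫ v in 0..t, generatorTerm lam α β f f' (arrivalCount ω.1 v) v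
        (waiting q₀ r₀ ω.1 ω.2 v) (residualService q₀ r₀ ω.1 ω.2 v)) ∂inputLaw lam G =
      (∫ ω, (∫ v in 0..t, dr v ω) ∂inputLaw lam G) +
      lam * ∫ ω, (∫ v in 0..t, ju v ω) ∂inputLaw lam G := by
    rw [← integral_const_mul, ← integral_add hIdr (hIju.const_mul lam)]
    refine integral_congr_ae ?_
    filter_upwards [hgood] with ω h
    have hii : ∀ (g : ℝ → (ℕ → ℝ) × (ℕ → ℝ) → ℝ) (c : ℝ), Measurable (Function.uncurry g) →
        (∀ v, 0 < v → v ≤ t → |g v ω| ≤ c) →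
        IntervalIntegrable (fun v => g v ω) volume 0 t := by
      intro g c hg hgb
      rw [intervalIntegrable_iff_integrableOn_Ioc_of_le ht]
      refine Measure.integrableOn_of_bounded (M := c) (by simp)
        (hg.comp (measurable_id.prodMk measurable_const)).aestronglyMeasurable ?_
      filter_upwards [ae_restrict_mem measurableSet_Ioc] with v hv
      exact hgb v hv.1 hv.2
    rw [← intervalIntegral.integral_const_mul, ← intervalIntegral.integral_add
      (hii dr _ hmdr (hdrb ω h)) ((hii ju _ hmju (hjub ω h)).const_mul lam)]
    refine intervalIntegral.integral_congr_ae ?_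
    filter_upwards [h.stateBefore_ae_eq] with v hv hvt
    rw [Set.uIoc_of_le ht] at hvt
    obtain ⟨c1, c2, c3⟩ := hv hvt.1.le
    simp only [hdr, hju, generatorTerm, c1, c2, c3]
  rw [e3]
  have hw0 : weight lam α β 0 0 = β := by simp [weight]
  rw [hw0, integral_const]
  simp only [probReal_univ, smul_eq_mul]
  ring

end FixedInitialState

/-! ### The stationary process -/

/-- The state `(Q(t), R(t))` as a function of the initial state and the inputs. -/
def stateAt (t : ℝ) (p : (ℕ × ℝ) × ((ℕ → ℝ) × (ℕ → ℝ))) : ℕ × ℝ :=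
  (queueLength p.1.1 p.1.2 p.2.1 p.2.2 t, residualService p.1.1 p.1.2 p.2.1 p.2.2 t)

lemma measurable_stateAt_uncurry :
    Measurable fun z : ((ℕ × ℝ) × ((ℕ → ℝ) × (ℕ → ℝ))) × ℝ => stateAt z.2 z.1 := by
  have hq : Measurable fun z : ((ℕ × ℝ) × ((ℕ → ℝ) × (ℕ → ℝ))) × ℝ => z.1.1.1 := by fun_prop
  have hr : Measurable fun z : ((ℕ × ℝ) × ((ℕ → ℝ) × (ℕ → ℝ))) × ℝ => z.1.1.2 := by fun_prop
  have hx : Measurable fun z : ((ℕ × ℝ) × ((ℕ → ℝ) × (ℕ → ℝ))) × ℝ => z.1.2.1 := by fun_prop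
  have hs : Measurable fun z : ((ℕ × ℝ) × ((ℕ → ℝ) × (ℕ → ℝ))) × ℝ => z.1.2.2 := by fun_prop
  exact (measurable_queueLength hq hr hx hs measurable_snd).prodMk
    (measurable_residualService hq hr hx hs measurable_snd)

lemma measurable_stateAt (t : ℝ) : Measurable (stateAt t) := by
  have hq : Measurable fun z : (ℕ × ℝ) × ((ℕ → ℝ) × (ℕ → ℝ)) => z.1.1 := by fun_prop
  have hr : Measurable fun z : (ℕ × ℝ) × ((ℕ → ℝ) × (ℕ → ℝ)) => z.1.2 := by fun_prop
  have hx : Measurable fun z : (ℕ × ℝ) × ((ℕ → ℝ) × (ℕ → ℝ)) => z.2.1 := by fun_prop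
  have hs : Measurable fun z : (ℕ × ℝ) × ((ℕ → ℝ) × (ℕ → ℝ)) => z.2.2 := by fun_prop
  have h1 := measurable_queueLength hq hr hx hs (T := fun _ => t) measurable_const
  have h2 := measurable_residualService hq hr hx hs (T := fun _ => t) measurable_const
  exact h1.prodMk h2

/-- The number of customers waiting in a given state. -/
def numWaiting (x : ℕ × ℝ) : ℕ := x.1 - 1

lemma measurable_numWaiting : Measurable fun x : ℕ × ℝ => numWaiting x :=
  (measurable_from_nat (f := fun n : ℕ => n - 1)).comp measurable_fst

lemma measurable_numWaiting_succ : Measurable fun x : ℕ × ℝ => numWaiting x + 1 :=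
  (measurable_from_nat (f := fun n : ℕ => n - 1 + 1)).comp measurable_fst

/-- The law `ν` of the state is invariant: the canonical form of stationarity, on the product of
the state space and the space of inputs. -/
structure StationaryLaw (lam : ℝ) (G : Measure ℝ) (ν : Measure (ℕ × ℝ)) : Prop where
  consistent : ∀ᵐ x ∂ν, (x.1 = 0 → x.2 = 0) ∧ (0 < x.1 → 0 < x.2)
  invariant : ∀ t : ℝ, 0 ≤ t → (ν.prod (inputLaw lam G)).map (stateAt t) = ν

namespace IsStationary

variable {Ω : Type*} [MeasurableSpace Ω] {μ : Measure Ω} [IsProbabilityMeasure μ]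
  {lam : ℝ} (hlam : 0 < lam) {G : Measure ℝ} [IsProbabilityMeasure G]
  {q₀ : Ω → ℕ} {r₀ : Ω → ℝ} {ξ S : ℕ → Ω → ℝ} (h : IsStationary μ lam G q₀ r₀ ξ S)
include hlam h

lemma measurable_data : Measurable fun ω =>
    ((q₀ ω, r₀ ω), ((fun n => ξ n ω), (fun n => S n ω))) :=
  (h.measurable_q₀.prodMk h.measurable_r₀).prodMk
    ((measurable_pi_lambda _ h.measurable_ξ).prodMk (measurable_pi_lambda _ h.measurable_S))

lemma map_data : μ.map (fun ω => ((q₀ ω, r₀ ω), ((fun n => ξ n ω), (fun n => S n ω)))) =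
    (μ.map fun ω => (q₀ ω, r₀ ω)).prod (inputLaw lam G) := by
  have := isProbabilityMeasure_expMeasure hlam
  have mξ : Measurable fun ω n => ξ n ω := measurable_pi_lambda _ h.measurable_ξ
  have mS : Measurable fun ω n => S n ω := measurable_pi_lambda _ h.measurable_S
  rw [(indepFun_iff_map_prod_eq_prod_map_map
      (h.measurable_q₀.prodMk h.measurable_r₀).aemeasurable (mξ.prodMk mS).aemeasurable).mp
      h.indep_initial,
    (indepFun_iff_map_prod_eq_prod_map_map mξ.aemeasurable mS.aemeasurable).mp h.indep_inputs]
  have h1 := (iIndepFun.hasLaw_infinitePi h.law_ξ h.indep_ξ mξ.aemeasurable).map_eq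
  have h2 := (iIndepFun.hasLaw_infinitePi h.law_S h.indep_S mS.aemeasurable).map_eq
  rw [h1, h2]

lemma stationaryLaw : StationaryLaw lam G (μ.map fun ω => (q₀ ω, r₀ ω)) where
  consistent := by
    rw [ae_map_iff (h.measurable_q₀.prodMk h.measurable_r₀).aemeasurable]
    · exact h.residual_initial
    · refine MeasurableSet.inter ?_ ?_
      · exact (MeasurableSet.imp (measurable_fst (measurableSet_singleton 0))
          (measurable_snd (measurableSet_singleton 0)))
      · exact (MeasurableSet.imp (measurable_fst measurableSet_Ioi)
          (measurable_snd measurableSet_Ioi))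
  invariant t ht := by
    rw [← h.map_data hlam, Measure.map_map (measurable_stateAt t) (h.measurable_data hlam)]
    exact h.invariant t ht

lemma varianceCurve_eq (t : ℝ) : varianceCurve μ q₀ r₀ ξ S t =
    variance (fun p : (ℕ × ℝ) × ((ℕ → ℝ) × (ℕ → ℝ)) =>
      (departures p.1.1 p.1.2 p.2.1 p.2.2 t : ℝ))
      ((μ.map fun ω => (q₀ ω, r₀ ω)).prod (inputLaw lam G)) := by
  rw [← h.map_data hlam, variance_map _ (h.measurable_data hlam).aemeasurable]
  · rfl
  · refine ((measurable_from_nat (f := fun n : ℕ => (n : ℝ))).comp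
      (measurable_departures ?_ ?_ ?_ ?_ measurable_const)).aemeasurable <;> fun_prop

end IsStationary

namespace StationaryLaw

variable {lam : ℝ} (hlam : 0 < lam) {G : Measure ℝ} [IsProbabilityMeasure G]
  (hG : ∀ᵐ x ∂G, 0 ≤ x) {ν : Measure (ℕ × ℝ)} [IsProbabilityMeasure ν]
  (h : StationaryLaw lam G ν)

include h in
lemma ae_nonneg : ∀ᵐ x ∂ν, 0 ≤ x.2 := by
  filter_upwards [h.consistent] with x hx
  rcases Nat.eq_zero_or_pos x.1 with h0 | h0
  · exact (hx.1 h0).ge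
  · exact (hx.2 h0).le

include hlam hG h in
lemma ae_goodPath : ∀ᵐ p ∂ν.prod (inputLaw lam G), GoodPath p.1.1 p.1.2 p.2.1 p.2.2 := by
  have := isProbabilityMeasure_expMeasure hlam
  have h1 : ∀ᵐ p ∂ν.prod (inputLaw lam G), RegularArrivals p.2.1 :=
    Measure.quasiMeasurePreserving_snd.ae
      (Measure.quasiMeasurePreserving_fst.ae (ae_regularArrivals hlam))
  have h2 : ∀ᵐ p ∂ν.prod (inputLaw lam G), ∀ n, 0 ≤ p.2.2 n :=
    Measure.quasiMeasurePreserving_snd.ae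
      (Measure.quasiMeasurePreserving_snd.ae (ae_forall_iidLaw G hG))
  have h3 : ∀ᵐ p ∂ν.prod (inputLaw lam G), (p.1.1 = 0 → p.1.2 = 0) ∧ (0 < p.1.1 → 0 < p.1.2) :=
    Measure.quasiMeasurePreserving_fst.ae h.consistent
  filter_upwards [h1, h2, h3] with p h1 h2 h3
  exact ⟨h1.1, h1.2, h2, h3.1, h3.2⟩

include h

lemma integrable_stateAt_iff {F : ℕ × ℝ → ℝ} (hF : Measurable F) {t : ℝ} (ht : 0 ≤ t) :
    Integrable (fun p => F (stateAt t p)) (ν.prod (inputLaw lam G)) ↔ Integrable F ν := by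
  have := integrable_map_measure (μ := ν.prod (inputLaw lam G)) (f := stateAt t) (g := F)
    (hF.aestronglyMeasurable) (measurable_stateAt t).aemeasurable
  rw [h.invariant t ht] at this
  exact this.symm

lemma integral_stateAt {F : ℕ × ℝ → ℝ} (hF : Measurable F) {t : ℝ} (ht : 0 ≤ t) :
    ∫ p, F (stateAt t p) ∂(ν.prod (inputLaw lam G)) = ∫ x, F x ∂ν := by
  have := integral_map (μ := ν.prod (inputLaw lam G)) (φ := stateAt t)
    (measurable_stateAt t).aemeasurable (f := F) hF.aestronglyMeasurable
  rw [h.invariant t ht] at this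
  exact this.symm

end StationaryLaw

section

variable {lam : ℝ} (hlam : 0 < lam) {G : Measure ℝ} [IsProbabilityMeasure G]
  (hG : ∀ᵐ x ∂G, 0 ≤ x) (hG2 : Integrable (fun x : ℝ => x ^ 2) G)
  {ν : Measure (ℕ × ℝ)} [IsProbabilityMeasure ν]
  (h : StationaryLaw lam G ν) {f f' : ℕ → ℝ → ℝ} (hf : TestFunction G f f')

/-- The integrand in Dynkin's formula, as a function of the sample point and time. -/
def generatorAt (lam α : ℝ) (β : ℕ × ℝ → ℝ) (f f' : ℕ → ℝ → ℝ)
    (p : (ℕ × ℝ) × ((ℕ → ℝ) × (ℕ → ℝ))) (v : ℝ) : ℝ :=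
  generatorTerm lam α (β p.1) f f' (arrivalCount p.2.1 v) v (numWaiting (stateAt v p)) (stateAt v p).2

/-- The generator of the state process. -/
def generator (lam : ℝ) (f f' : ℕ → ℝ → ℝ) (x : ℕ × ℝ) : ℝ :=
  lam * (f (numWaiting x + 1) x.2 - f (numWaiting x) x.2) - (if 0 < x.2 then f' (numWaiting x) x.2 else 0)

lemma generatorAt_eq (lam α : ℝ) (β : ℕ × ℝ → ℝ) (f f' : ℕ → ℝ → ℝ)
    (p : (ℕ × ℝ) × ((ℕ → ℝ) × (ℕ → ℝ))) (v : ℝ) :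
    generatorAt lam α β f f' p v =
      (α * ((arrivalCount p.2.1 v : ℝ) - lam * v) + β p.1) * generator lam f f' (stateAt v p) +
      α * lam * (f (numWaiting (stateAt v p) + 1) (stateAt v p).2 -
        f (numWaiting (stateAt v p)) (stateAt v p).2) := by
  unfold generatorAt generatorTerm generator drift arrivalJump weight weightDeriv
  push_cast
  ring

lemma measurable_generator (lam : ℝ) (hf : TestFunction G f f') :
    Measurable (generator lam f f') := by
  refine Measurable.sub (Measurable.const_mul (Measurable.sub ?_ ?_) _)
    (Measurable.ite (measurableSet_lt measurable_const measurable_snd) ?_ measurable_const)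
  · exact measurable_uncurry_nat hf.measurable measurable_numWaiting_succ measurable_snd
  · exact measurable_uncurry_nat hf.measurable measurable_numWaiting measurable_snd
  · exact measurable_uncurry_nat (fun y => (hf.continuous_deriv y).measurable)
      measurable_numWaiting measurable_snd

include hlam hG hG2 h hf

/-- Dynkin's formula for the stationary process. The weight at time `0` may depend on the initial
state. -/
theorem dynkin_stationary (α : ℝ) (β : ℕ × ℝ → ℝ) {t : ℝ} (ht : 0 ≤ t)
    (hi : Integrable (fun p : (ℕ × ℝ) × ((ℕ → ℝ) × (ℕ → ℝ)) =>
      (α * ((arrivalCount p.2.1 t : ℝ) - lam * t) + β p.1) *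
        f (numWaiting (stateAt t p)) (stateAt t p).2) (ν.prod (inputLaw lam G)))
    (hi0 : Integrable (fun x : ℕ × ℝ => β x * f (numWaiting x) x.2) ν)
    (hL : Integrable (fun z : ((ℕ × ℝ) × ((ℕ → ℝ) × (ℕ → ℝ))) × ℝ =>
      generatorAt lam α β f f' z.1 z.2)
      ((ν.prod (inputLaw lam G)).prod (volume.restrict (Set.Ioc 0 t)))) :
    ∫ p, (α * ((arrivalCount p.2.1 t : ℝ) - lam * t) + β p.1) *
        f (numWaiting (stateAt t p)) (stateAt t p).2 ∂(ν.prod (inputLaw lam G)) =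
      ∫ x, β x * f (numWaiting x) x.2 ∂ν +
        ∫ v in 0..t, ∫ p, generatorAt lam α β f f' p v ∂(ν.prod (inputLaw lam G)) := by
  have := isProbabilityMeasure_expMeasure hlam
  rw [intervalIntegral.integral_of_le ht, ← integral_integral_swap hL]
  have hL1 : Integrable (fun p : (ℕ × ℝ) × ((ℕ → ℝ) × (ℕ → ℝ)) =>
      ∫ v in Set.Ioc 0 t, generatorAt lam α β f f' p v) (ν.prod (inputLaw lam G)) :=
    hL.integral_prod_left
  rw [integral_prod _ hi, integral_prod _ hL1, ← integral_add hi0 hL1.integral_prod_left]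
  refine integral_congr_ae ?_
  filter_upwards [h.consistent] with x hx
  have := dynkin hlam hG hG2 hf α (β x) hx.1 hx.2 ht
  simp_rw [intervalIntegral.integral_of_le ht] at this
  exact this

/-- **The stationary mean of the generator vanishes.** -/
theorem integral_generator_eq_zero
    (hi : Integrable (fun x : ℕ × ℝ => f (numWaiting x) x.2) ν)
    (hL : Integrable (generator lam f f') ν) :
    ∫ x, generator lam f f' x ∂ν = 0 := by
  have := isProbabilityMeasure_expMeasure hlam
  have hmf : Measurable fun x : ℕ × ℝ => f (numWaiting x) x.2 :=
    measurable_uncurry_nat hf.measurable measurable_numWaiting measurable_snd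
  have hmL := measurable_generator lam hf
  have e1 : ∀ p v, generatorAt lam 0 (fun _ => 1) f f' p v = generator lam f f' (stateAt v p) := by
    intro p v
    rw [generatorAt_eq]; ring
  have key := dynkin_stationary hlam hG hG2 h hf 0 (fun _ => 1) (t := 1) zero_le_one ?_ ?_ ?_
  · simp only [zero_mul, zero_add, one_mul, e1] at key
    rw [h.integral_stateAt hmf zero_le_one] at key
    have e2 : ∫ v in (0 : ℝ)..1, ∫ p, generator lam f f' (stateAt v p)
        ∂(ν.prod (inputLaw lam G)) = ∫ v in (0 : ℝ)..1, ∫ x, generator lam f f' x ∂ν := by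
      refine intervalIntegral.integral_congr fun v hv => ?_
      rw [Set.uIcc_of_le zero_le_one] at hv
      exact h.integral_stateAt hmL hv.1
    rw [e2] at key
    simp at key
    exact key
  · simpa using (h.integrable_stateAt_iff hmf zero_le_one).mpr hi
  · simpa using hi
  · simp only [e1]
    have hm : Measurable fun z : ((ℕ × ℝ) × ((ℕ → ℝ) × (ℕ → ℝ))) × ℝ =>
        generator lam f f' (stateAt z.2 z.1) := hmL.comp measurable_stateAt_uncurry
    rw [integrable_prod_iff' hm.aestronglyMeasurable]
    constructor
    · filter_upwards [ae_restrict_mem measurableSet_Ioc] with v hv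
      exact (h.integrable_stateAt_iff hmL hv.1.le).mpr hL
    · refine Integrable.congr (integrable_const (∫ x, ‖generator lam f f' x‖ ∂ν)) ?_
      filter_upwards [ae_restrict_mem measurableSet_Ioc] with v hv
      exact (h.integral_stateAt hmL.norm hv.1.le).symm

end

/-! ### The Laplace–Stieltjes transform of the service-time distribution -/

lemma nonneg_of_deriv_nonneg {g g' : ℝ → ℝ} (hd : ∀ a, HasDerivAt g (g' a) a)
    (h' : ∀ a, 0 ≤ a → 0 ≤ g' a) (h0 : g 0 = 0) {a : ℝ} (ha : 0 ≤ a) : 0 ≤ g a := by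
  rw [← h0]
  refine (monotoneOn_of_deriv_nonneg (convex_Ici (0 : ℝ))
    (fun x _ => (hd x).continuousAt.continuousWithinAt)
    (fun x _ => (hd x).differentiableAt.differentiableWithinAt) fun x hx => ?_)
    (Set.self_mem_Ici) ha ha
  rw [(hd x).deriv]
  rw [interior_Ici] at hx
  exact h' x (le_of_lt hx)

lemma hasDerivAt_exp_neg (a : ℝ) : HasDerivAt (fun a => Real.exp (-a)) (-Real.exp (-a)) a := by
  simpa using (hasDerivAt_neg a).exp

lemma one_sub_le_exp_neg (a : ℝ) : 1 - a ≤ Real.exp (-a) := by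
  linarith [Real.add_one_le_exp (-a)]

lemma exp_neg_le_quadratic {a : ℝ} (ha : 0 ≤ a) : Real.exp (-a) ≤ 1 - a + a ^ 2 / 2 := by
  have := nonneg_of_deriv_nonneg (g := fun a => 1 - a + a ^ 2 / 2 - Real.exp (-a))
    (g' := fun a => -1 + a + Real.exp (-a)) (fun a => by
      have := ((((hasDerivAt_id' a).const_sub 1).add ((hasDerivAt_pow 2 a).div_const 2))).sub
        (hasDerivAt_exp_neg a)
      exact this.congr_deriv (by push_cast; ring)) (fun a _ => by linarith [one_sub_le_exp_neg a]) (by simp) ha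
  linarith

lemma cubic_le_exp_neg {a : ℝ} (ha : 0 ≤ a) :
    1 - a + a ^ 2 / 2 - a ^ 3 / 6 ≤ Real.exp (-a) := by
  have := nonneg_of_deriv_nonneg (g := fun a => Real.exp (-a) - (1 - a + a ^ 2 / 2 - a ^ 3 / 6))
    (g' := fun a => 1 - a + a ^ 2 / 2 - Real.exp (-a)) (fun a => by
      have := (hasDerivAt_exp_neg a).sub ((((hasDerivAt_id' a).const_sub 1).add
        ((hasDerivAt_pow 2 a).div_const 2)).sub ((hasDerivAt_pow 3 a).div_const 6))
      exact this.congr_deriv (by push_cast; ring)) (fun a h => by linarith [exp_neg_le_quadratic h]) (by simp) ha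
  linarith

lemma exp_neg_le_quartic {a : ℝ} (ha : 0 ≤ a) :
    Real.exp (-a) ≤ 1 - a + a ^ 2 / 2 - a ^ 3 / 6 + a ^ 4 / 24 := by
  have := nonneg_of_deriv_nonneg
    (g := fun a => 1 - a + a ^ 2 / 2 - a ^ 3 / 6 + a ^ 4 / 24 - Real.exp (-a))
    (g' := fun a => Real.exp (-a) - (1 - a + a ^ 2 / 2 - a ^ 3 / 6)) (fun a => by
      have := (((((hasDerivAt_id' a).const_sub 1).add ((hasDerivAt_pow 2 a).div_const 2)).sub
        ((hasDerivAt_pow 3 a).div_const 6)).add ((hasDerivAt_pow 4 a).div_const 24)).sub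
        (hasDerivAt_exp_neg a)
      exact this.congr_deriv (by push_cast; ring)) (fun a h => by linarith [cubic_le_exp_neg h]) (by simp) ha
  linarith

/-- The Laplace–Stieltjes transform of `G`. -/
def transform (G : Measure ℝ) (s : ℝ) : ℝ := ∫ x, Real.exp (-(s * x)) ∂G

/-- The remainder in the second-order expansion of `transform` at `0`, divided by `-s ^ 3`. -/
def transformRemainder (G : Measure ℝ) (s : ℝ) : ℝ :=
  ∫ x, (1 - s * x + (s * x) ^ 2 / 2 - Real.exp (-(s * x))) / s ^ 3 ∂G

section Transform

variable {G : Measure ℝ} [IsProbabilityMeasure G] (hG : ∀ᵐ x ∂G, 0 ≤ x)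
  (hG3 : Integrable (fun x : ℝ => x ^ 3) G)

include hG hG3

lemma integrable_pow {k : ℕ} (hk : k ≤ 3) : Integrable (fun x : ℝ => x ^ k) G := by
  refine Integrable.mono' ((integrable_const 1).add hG3) (by fun_prop) ?_
  filter_upwards [hG] with x hx
  rw [Real.norm_of_nonneg (by positivity)]
  rcases le_total x 1 with h | h
  · have := pow_le_one₀ hx h (n := k)
    have := pow_nonneg hx 3
    simp only [Pi.add_apply]; linarith
  · have := pow_le_pow_right₀ h hk
    simp only [Pi.add_apply]; linarith

omit hG3 in
lemma integrable_exp_neg {s : ℝ} (hs : 0 ≤ s) :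
    Integrable (fun x : ℝ => Real.exp (-(s * x))) G := by
  refine Integrable.mono' (integrable_const 1) (by fun_prop) ?_
  filter_upwards [hG] with x hx
  rw [Real.norm_of_nonneg (Real.exp_pos _).le]
  exact Real.exp_le_one_iff.mpr (by simpa using mul_nonneg hs hx)

omit [IsProbabilityMeasure G] hG hG3 in
lemma transform_nonneg (s : ℝ) : 0 ≤ transform G s := integral_nonneg fun _ => (Real.exp_pos _).le

omit hG3 in
lemma transform_le_one {s : ℝ} (hs : 0 ≤ s) : transform G s ≤ 1 := by
  have h1 : ∫ _, (1 : ℝ) ∂G = 1 := by simp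
  rw [← h1]
  refine integral_mono_ae (integrable_exp_neg hG hs) (integrable_const 1) ?_
  filter_upwards [hG] with x hx
  exact Real.exp_le_one_iff.mpr (by simpa using mul_nonneg hs hx)

lemma transform_eq {s : ℝ} (hs : 0 < s) :
    transform G s =
      1 - moment G 1 * s + moment G 2 * s ^ 2 / 2 - s ^ 3 * transformRemainder G s := by
  have i1 : Integrable (fun x : ℝ => s * x) G := by
    simpa using (integrable_pow hG hG3 (k := 1) (by norm_num)).const_mul s
  have i2 : Integrable (fun x : ℝ => (s * x) ^ 2 / 2) G := by
    have := ((integrable_pow hG hG3 (k := 2) (by norm_num)).const_mul (s ^ 2)).div_const 2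
    simpa only [mul_pow] using this
  have i3 : Integrable (fun x : ℝ => 1 - s * x) G := (integrable_const 1).sub i1
  have i4 : Integrable (fun x : ℝ => 1 - s * x + (s * x) ^ 2 / 2) G := i3.add i2
  unfold transformRemainder transform
  rw [integral_div, integral_sub i4 (integrable_exp_neg hG hs.le), integral_add i3 i2,
    integral_sub (integrable_const 1) i1, integral_const_mul, integral_div]
  simp_rw [mul_pow]
  rw [integral_const_mul]
  simp only [integral_const, probReal_univ, smul_eq_mul, moment, pow_one]
  field_simp
  ring

/-- The third-order expansion of the transform at `0`. -/
lemma tendsto_transformRemainder {s : ℕ → ℝ} (hs : ∀ n, 0 < s n)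
    (h0 : Tendsto s atTop (nhds 0)) :
    Tendsto (fun n => transformRemainder G (s n)) atTop (nhds (moment G 3 / 6)) := by
  have he : moment G 3 / 6 = ∫ x, x ^ 3 / 6 ∂G := by rw [integral_div]; rfl
  rw [he]
  have key : ∀ n x, 0 ≤ x → x ^ 3 / 6 - s n * x ^ 4 / 24 ≤
      (1 - s n * x + (s n * x) ^ 2 / 2 - Real.exp (-(s n * x))) / s n ^ 3 ∧
      (1 - s n * x + (s n * x) ^ 2 / 2 - Real.exp (-(s n * x))) / s n ^ 3 ≤ x ^ 3 / 6 := by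
    intro n x hx
    have ha : 0 ≤ s n * x := mul_nonneg (hs n).le hx
    have h3 : 0 < s n ^ 3 := pow_pos (hs n) 3
    constructor
    · rw [le_div_iff₀ h3]
      have := exp_neg_le_quartic ha
      nlinarith
    · rw [div_le_iff₀ h3]
      have := cubic_le_exp_neg ha
      nlinarith
  refine tendsto_integral_of_dominated_convergence (fun x => x ^ 3 / 6) (fun n => by fun_prop)
    (hG3.div_const 6) ?_ ?_
  · intro n
    filter_upwards [hG] with x hx
    rw [Real.norm_of_nonneg]
    · exact (key n x hx).2
    · refine div_nonneg ?_ (pow_pos (hs n) 3).le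
      linarith [exp_neg_le_quadratic (mul_nonneg (hs n).le hx)]
  · filter_upwards [hG] with x hx
    refine tendsto_of_tendsto_of_tendsto_of_le_of_le ?_ tendsto_const_nhds
      (fun n => (key n x hx).1) (fun n => (key n x hx).2)
    have := ((h0.mul_const (x ^ 4)).div_const 24).const_sub (x ^ 3 / 6)
    simpa using this

end Transform

/-! ### The workload and exponential test functions -/

/-- The expected total service time still required by the customers present, when `y` of them are
waiting and the one in service has residual service time `r`. -/
def workMean (G : Measure ℝ) (y : ℕ) (r : ℝ) : ℝ := r + moment G 1 * y

/-- The second moment of the total service time still required. -/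
def workSq (G : Measure ℝ) (y : ℕ) (r : ℝ) : ℝ :=
  workMean G y r ^ 2 + (moment G 2 - moment G 1 ^ 2) * y

/-- The Laplace transform of the total service time still required. -/
def workExp (G : Measure ℝ) (s : ℝ) (y : ℕ) (r : ℝ) : ℝ :=
  transform G s ^ y * Real.exp (-(s * r))

section WorkTest

variable {G : Measure ℝ} [IsProbabilityMeasure G] (hG : ∀ᵐ x ∂G, 0 ≤ x)
  (hG3 : Integrable (fun x : ℝ => x ^ 3) G)
include hG

omit [IsProbabilityMeasure G] hG in
lemma workExp_nonneg (s : ℝ) (y : ℕ) (r : ℝ) : 0 ≤ workExp G s y r :=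
  mul_nonneg (pow_nonneg (transform_nonneg s) y) (Real.exp_pos _).le

lemma workExp_le_one {s : ℝ} (hs : 0 ≤ s) (y : ℕ) {r : ℝ} (hr : 0 ≤ r) : workExp G s y r ≤ 1 :=
  mul_le_one₀ (pow_le_one₀ (transform_nonneg s) (transform_le_one hG hs)) (Real.exp_pos _).le
    (Real.exp_le_one_iff.mpr (by simpa using mul_nonneg hs hr))

/-- The transform of the work is a test function: the work does not change when a service starts. -/
lemma testFunction_workExp {s : ℝ} (hs : 0 < s) :
    TestFunction G (workExp G s) (fun y r => -s * workExp G s y r) where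
  hasDerivAt y r := by
    have h1 : HasDerivAt (fun r => -(s * r)) (-(s * 1)) r := ((hasDerivAt_id' r).const_mul s).neg
    have := (h1.exp).const_mul (transform G s ^ y)
    exact this.congr_deriv (by unfold workExp; ring)
  continuous_deriv y := by unfold workExp; fun_prop
  growth := by
    refine ⟨1 + s, by positivity, fun y r hr => ?_⟩
    have h0 := workExp_nonneg (G := G) s y r
    have h1 := workExp_le_one hG hs.le y hr
    have h2 : 1 ≤ 1 + (y : ℝ) ^ 2 + r ^ 2 := by nlinarith [sq_nonneg (y : ℝ), sq_nonneg r]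
    constructor
    · rw [abs_of_nonneg h0]; nlinarith
    · rw [abs_mul, abs_neg, abs_of_pos hs, abs_of_nonneg h0]; nlinarith
  integral_eq y := by
    unfold workExp
    rw [integral_const_mul]
    simp [transform, pow_succ]

include hG3

omit [IsProbabilityMeasure G] hG hG3 in
lemma workMean_succ (y : ℕ) (r : ℝ) : workMean G (y + 1) r = workMean G y r + moment G 1 := by
  unfold workMean; push_cast; ring

omit [IsProbabilityMeasure G] hG hG3 in
lemma workSq_succ (y : ℕ) (r : ℝ) :
    workSq G (y + 1) r = workSq G y r + 2 * moment G 1 * workMean G y r + moment G 2 := by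
  unfold workSq workMean; push_cast; ring

omit [IsProbabilityMeasure G] hG hG3 in
lemma workExp_add (s : ℝ) (y : ℕ) (r x : ℝ) :
    workExp G s y (r + x) = workExp G s y r * Real.exp (-(s * x)) := by
  unfold workExp
  rw [mul_assoc, ← Real.exp_add]; congr 2; ring

omit [IsProbabilityMeasure G] hG hG3 in
lemma integral_workExp_add (s : ℝ) (y : ℕ) (r : ℝ) :
    ∫ x, workExp G s y (r + x) ∂G = workExp G s (y + 1) r := by
  simp_rw [workExp_add]
  rw [integral_const_mul]
  unfold workExp transform; ring

omit hG3 in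
lemma integrable_workExp_add {s : ℝ} (hs : 0 < s) (y : ℕ) (r : ℝ) :
    Integrable (fun x => workExp G s y (r + x)) G := by
  simp_rw [workExp_add]
  exact (integrable_exp_neg hG hs.le).const_mul _

/-- First-order lower bound for the transform of the work. -/
lemma one_sub_le_workExp {s : ℝ} (hs : 0 < s) (y : ℕ) {r : ℝ} (hr : 0 ≤ r) :
    1 - s * workMean G y r ≤ workExp G s y r := by
  induction y generalizing r with
  | zero => simpa [workMean, workExp] using one_sub_le_exp_neg (s * r)
  | succ y ih =>
    have i1 : Integrable (fun x : ℝ => x) G := by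
      simpa using integrable_pow hG hG3 (k := 1) (by norm_num)
    have e0 : ∀ x, 1 - s * workMean G y (r + x) = (1 - s * workMean G y r) - s * x := by
      intro x; unfold workMean; ring
    have e2 : 1 - s * workMean G (y + 1) r = ∫ x, (1 - s * workMean G y (r + x)) ∂G := by
      simp_rw [e0]
      rw [integral_sub (integrable_const _) (i1.const_mul s), integral_const_mul, workMean_succ]
      simp [moment]; ring
    rw [← integral_workExp_add, e2]
    refine integral_mono_ae ?_ (integrable_workExp_add hG hs y r) ?_
    · simp_rw [e0]
      exact (integrable_const _).sub (i1.const_mul s)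
    · filter_upwards [hG] with x hx
      exact ih (add_nonneg hr hx)

/-- Second-order upper bound for the transform of the work. -/
lemma workExp_le_quadratic {s : ℝ} (hs : 0 < s) (y : ℕ) {r : ℝ} (hr : 0 ≤ r) :
    workExp G s y r ≤ 1 - s * workMean G y r + s ^ 2 * workSq G y r / 2 := by
  induction y generalizing r with
  | zero =>
    have := exp_neg_le_quadratic (mul_nonneg hs.le hr)
    simp only [workMean, workSq, workExp, pow_zero, one_mul, CharP.cast_eq_zero, mul_zero, add_zero]
    linarith [mul_pow s r 2]
  | succ y ih =>
    have i1 : Integrable (fun x : ℝ => x) G := by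
      simpa using integrable_pow hG hG3 (k := 1) (by norm_num)
    have i2 := integrable_pow hG hG3 (k := 2) (by norm_num)
    have e0 : ∀ x, 1 - s * workMean G y (r + x) + s ^ 2 * workSq G y (r + x) / 2 =
        (1 - s * workMean G y r + s ^ 2 * workSq G y r / 2) +
          ((s ^ 2 * workMean G y r - s) * x + s ^ 2 / 2 * x ^ 2) := by
      intro x; unfold workSq workMean; ring
    have i3 : Integrable (fun x : ℝ => (s ^ 2 * workMean G y r - s) * x + s ^ 2 / 2 * x ^ 2) G :=
      (i1.const_mul _).add (i2.const_mul _)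
    have e2 : 1 - s * workMean G (y + 1) r + s ^ 2 * workSq G (y + 1) r / 2 =
        ∫ x, (1 - s * workMean G y (r + x) + s ^ 2 * workSq G y (r + x) / 2) ∂G := by
      simp_rw [e0]
      rw [integral_add (integrable_const _) i3, integral_add (i1.const_mul _) (i2.const_mul _),
        integral_const_mul, integral_const_mul, workMean_succ, workSq_succ]
      simp only [moment, pow_one, integral_const, probReal_univ, smul_eq_mul]
      ring
    rw [← integral_workExp_add, e2]
    refine integral_mono_ae (integrable_workExp_add hG hs y r) ?_ ?_
    · simp_rw [e0]
      exact (integrable_const _).add i3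
    · filter_upwards [hG] with x hx
      exact ih (add_nonneg hr hx)

/-- Second-order expansion of the transform of the work. -/
lemma tendsto_workExp {s : ℕ → ℝ} (hs : ∀ n, 0 < s n) (h0 : Tendsto s atTop (nhds 0)) (y : ℕ)
    {r : ℝ} (hr : 0 ≤ r) :
    Tendsto (fun n => (workExp G (s n) y r - 1 + s n * workMean G y r) / s n ^ 2) atTop
      (nhds (workSq G y r / 2)) := by
  induction y with
  | zero =>
    have h1 : ∀ n, r ^ 2 / 2 - s n * r ^ 3 / 6 ≤
        (workExp G (s n) 0 r - 1 + s n * workMean G 0 r) / s n ^ 2 ∧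
        (workExp G (s n) 0 r - 1 + s n * workMean G 0 r) / s n ^ 2 ≤ r ^ 2 / 2 := by
      intro n
      have ha := mul_nonneg (hs n).le hr
      have h2 := pow_pos (hs n) 2
      rw [le_div_iff₀ h2, div_le_iff₀ h2]
      simp only [workExp, workMean, pow_zero, one_mul, CharP.cast_eq_zero, mul_zero, add_zero]
      constructor
      · nlinarith [cubic_le_exp_neg ha]
      · nlinarith [exp_neg_le_quadratic ha]
    have e : workSq G 0 r / 2 = r ^ 2 / 2 := by simp [workSq, workMean]
    rw [e]
    refine tendsto_of_tendsto_of_tendsto_of_le_of_le ?_ tendsto_const_nhds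
      (fun n => (h1 n).1) (fun n => (h1 n).2)
    simpa using ((h0.mul_const (r ^ 3)).div_const 6).const_sub (r ^ 2 / 2)
  | succ y ih =>
    have hw := tendsto_transformRemainder hG hG3 hs h0
    -- the second-order coefficient of the transform of `G`
    have hd : Tendsto (fun n => moment G 2 / 2 - s n * transformRemainder G (s n)) atTop
        (nhds (moment G 2 / 2)) := by
      simpa using (h0.mul hw).const_sub (moment G 2 / 2)
    have e : ∀ n, (workExp G (s n) (y + 1) r - 1 + s n * workMean G (y + 1) r) / s n ^ 2 =
        (workExp G (s n) y r - 1 + s n * workMean G y r) / s n ^ 2 *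
          (1 - s n * moment G 1 + s n ^ 2 * (moment G 2 / 2 - s n * transformRemainder G (s n))) +
        (moment G 2 / 2 - s n * transformRemainder G (s n)) * (1 - s n * workMean G y r) +
        moment G 1 * workMean G y r := by
      intro n
      have h1 : workExp G (s n) (y + 1) r = transform G (s n) * workExp G (s n) y r := by
        unfold workExp; ring
      have := (hs n).ne'
      rw [h1, transform_eq hG hG3 (hs n), workMean_succ]
      field_simp
      ring
    simp_rw [e]
    have l1 : Tendsto (fun n => 1 - s n * moment G 1 + s n ^ 2 *
        (moment G 2 / 2 - s n * transformRemainder G (s n))) atTop (nhds 1) := by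
      simpa using ((h0.mul_const (moment G 1)).const_sub 1).add ((h0.pow 2).mul hd)
    have l2 : Tendsto (fun n => 1 - s n * workMean G y r) atTop (nhds 1) := by
      simpa using (h0.mul_const (workMean G y r)).const_sub 1
    have := ((ih.mul l1).add (hd.mul l2)).add_const (moment G 1 * workMean G y r)
    refine this.trans (le_of_eq ?_)
    rw [workSq_succ]; congr 1; ring

end WorkTest

/-! ### Stationary moments -/

/-- Fatou's lemma in terms of Bochner integrals. -/
lemma integrable_of_tendsto_of_integral_le {α : Type*} [MeasurableSpace α] {ν : Measure α}
    {F : ℕ → α → ℝ} {f : α → ℝ} (hf : Measurable f) (h0 : ∀ n, ∀ᵐ x ∂ν, 0 ≤ F n x)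
    (hi : ∀ n, Integrable (F n) ν)
    (hlim : ∀ᵐ x ∂ν, Tendsto (fun n => F n x) atTop (nhds (f x))) {B : ℕ → ℝ} {b : ℝ}
    (hB : ∀ n, ∫ x, F n x ∂ν ≤ B n) (hb : Tendsto B atTop (nhds b)) :
    Integrable f ν ∧ ∫ x, f x ∂ν ≤ b := by
  have hf0 : ∀ᵐ x ∂ν, 0 ≤ f x := by
    filter_upwards [hlim, ae_all_iff.mpr h0] with x hx hx0
    exact ge_of_tendsto' hx hx0
  have hb0 : 0 ≤ b := ge_of_tendsto' hb fun n => (integral_nonneg_of_ae (h0 n)).trans (hB n)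
  have hle : ∫⁻ x, ENNReal.ofReal (f x) ∂ν ≤ ENNReal.ofReal b := by
    calc ∫⁻ x, ENNReal.ofReal (f x) ∂ν
        = ∫⁻ x, liminf (fun n => ENNReal.ofReal (F n x)) atTop ∂ν := by
          refine lintegral_congr_ae ?_
          filter_upwards [hlim] with x hx
          exact ((ENNReal.continuous_ofReal.tendsto _).comp hx).liminf_eq.symm
      _ ≤ liminf (fun n => ∫⁻ x, ENNReal.ofReal (F n x) ∂ν) atTop :=
          lintegral_liminf_le' fun n => (hi n).aestronglyMeasurable.aemeasurable.ennreal_ofReal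
      _ ≤ liminf (fun n => ENNReal.ofReal (B n)) atTop := by
          refine liminf_le_liminf (Eventually.of_forall fun n => ?_)
          rw [← ofReal_integral_eq_lintegral_ofReal (hi n) (h0 n)]
          exact ENNReal.ofReal_le_ofReal (hB n)
      _ = ENNReal.ofReal b := ((ENNReal.continuous_ofReal.tendsto _).comp hb).liminf_eq
  have hint : Integrable f ν := by
    refine ⟨hf.aestronglyMeasurable, ?_⟩
    rw [hasFiniteIntegral_iff_ofReal hf0]
    exact hle.trans_lt ENNReal.ofReal_lt_top
  refine ⟨hint, ?_⟩
  rw [← ofReal_integral_eq_lintegral_ofReal hint hf0] at hle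
  exact (ENNReal.ofReal_le_ofReal_iff hb0).mp hle

section Moments

variable {lam : ℝ} (hlam : 0 < lam) {G : Measure ℝ} [IsProbabilityMeasure G]
  (hG : ∀ᵐ x ∂G, 0 ≤ x) (hG3 : Integrable (fun x : ℝ => x ^ 3) G)
  (hg1 : 0 < moment G 1) (hstab : lam * moment G 1 < 1)
  {ν : Measure (ℕ × ℝ)} [IsProbabilityMeasure ν] (h : StationaryLaw lam G ν)

lemma measurable_workExp (s : ℝ) : Measurable fun x : ℕ × ℝ => workExp G s (numWaiting x) x.2 :=
  measurable_uncurry_nat (fun y => by unfold workExp; fun_prop) measurable_numWaiting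
    measurable_snd

lemma measurable_workMean : Measurable fun x : ℕ × ℝ => workMean G (numWaiting x) x.2 :=
  measurable_uncurry_nat (fun y => by unfold workMean; fun_prop) measurable_numWaiting
    measurable_snd

lemma measurable_workSq : Measurable fun x : ℕ × ℝ => workSq G (numWaiting x) x.2 :=
  measurable_uncurry_nat (fun y => by unfold workSq workMean; fun_prop) measurable_numWaiting
    measurable_snd

/-- The stationary mean of the workload. -/
def meanWork (lam : ℝ) (G : Measure ℝ) : ℝ := lam * moment G 2 / (2 * (1 - lam * moment G 1))

include hlam hG hG3 h

lemma integrable_workExp {s : ℝ} (hs : 0 < s) :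
    Integrable (fun x : ℕ × ℝ => workExp G s (numWaiting x) x.2) ν := by
  refine Integrable.mono' (integrable_const 1) (measurable_workExp s).aestronglyMeasurable ?_
  filter_upwards [h.ae_nonneg] with x hx
  rw [Real.norm_of_nonneg (workExp_nonneg s _ _)]
  exact workExp_le_one hG hs.le _ hx

/-- The transform version of the Pollaczek–Khinchine formula, with the idle probability still
undetermined. -/
lemma integral_workExp_mul {s : ℝ} (hs : 0 < s) :
    (∫ x, workExp G s (numWaiting x) x.2 ∂ν) *
      ((1 - lam * moment G 1) + lam * moment G 2 / 2 * s - lam * s ^ 2 * transformRemainder G s) =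
      ∫ x, (if 0 < x.2 then 0 else 1) ∂ν := by
  have hG2 := integrable_pow hG hG3 (k := 2) (by norm_num)
  have hi := integrable_workExp hlam hG hG3 h hs
  have hm : MeasurableSet {x : ℕ × ℝ | 0 < x.2} := measurableSet_lt measurable_const measurable_snd
  have hi0 : Integrable (fun x : ℕ × ℝ => if 0 < x.2 then (0 : ℝ) else 1) ν := by
    refine Integrable.mono' (integrable_const 1)
      (Measurable.ite hm measurable_const measurable_const).aestronglyMeasurable
      (Eventually.of_forall fun x => ?_)
    split_ifs <;> simp
  have hgen : generator lam (workExp G s) (fun y r => -s * workExp G s y r) =ᵐ[ν] fun x =>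
      (s - lam * (1 - transform G s)) * workExp G s (numWaiting x) x.2 -
        s * (if 0 < x.2 then 0 else 1) := by
    filter_upwards [h.consistent] with x hx
    have h1 : workExp G s (numWaiting x + 1) x.2 = transform G s * workExp G s (numWaiting x) x.2 := by
      unfold workExp; ring
    unfold generator
    rw [h1]
    split_ifs with h0
    · ring
    · have hq : x.1 = 0 := by
        by_contra hne
        exact h0 (hx.2 (Nat.pos_of_ne_zero hne))
      have hw : workExp G s (numWaiting x) x.2 = 1 := by
        rw [hx.1 hq, numWaiting, hq]; simp [workExp]
      rw [hw]; ring
  have hig : Integrable (fun x : ℕ × ℝ => (s - lam * (1 - transform G s)) *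
      workExp G s (numWaiting x) x.2 - s * (if 0 < x.2 then 0 else 1)) ν :=
    (hi.const_mul _).sub (hi0.const_mul s)
  have key := integral_generator_eq_zero hlam hG hG2 h (testFunction_workExp hG hs) hi
    (hig.congr hgen.symm)
  rw [integral_congr_ae hgen, integral_sub (hi.const_mul _) (hi0.const_mul s), integral_const_mul,
    integral_const_mul, transform_eq hG hG3 hs] at key
  refine mul_left_cancel₀ hs.ne' ?_
  linarith

variable {s : ℕ → ℝ} (hs : ∀ n, 0 < s n) (h0 : Tendsto s atTop (nhds 0))

/-- The stationary transform of the work tends to `1` at `0`. -/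
lemma tendsto_integral_workExp (hs : ∀ n, 0 < s n) (h0 : Tendsto s atTop (nhds 0)) :
    Tendsto (fun n => ∫ x, workExp G (s n) (numWaiting x) x.2 ∂ν) atTop (nhds 1) := by
  have h1 : ∫ _, (1 : ℝ) ∂ν = 1 := by simp
  rw [← h1]
  refine tendsto_integral_of_dominated_convergence (fun _ => 1)
    (fun n => (measurable_workExp _).aestronglyMeasurable) (integrable_const 1) ?_ ?_
  · intro n
    filter_upwards [h.ae_nonneg] with x hx
    rw [Real.norm_of_nonneg (workExp_nonneg _ _ _)]
    exact workExp_le_one hG (hs n).le _ hx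
  · filter_upwards [h.ae_nonneg] with x hx
    have h2 := ((tendsto_workExp hG hG3 hs h0 (numWaiting x) hx).mul (h0.pow 2)).sub
      (h0.mul_const (workMean G (numWaiting x) x.2))
    have h3 := h2.add_const 1
    simp only [ne_eq, OfNat.ofNat_ne_zero, not_false_eq_true, zero_pow, mul_zero, zero_mul,
      sub_zero, zero_add] at h3
    refine h3.congr fun n => ?_
    have := (hs n).ne'
    field_simp
    ring

/-- The server is idle with probability `1 - ρ`. -/
lemma integral_idle : ∫ x, (if 0 < x.2 then 0 else 1) ∂ν = 1 - lam * moment G 1 := by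
  obtain ⟨s, hs, h0⟩ : ∃ s : ℕ → ℝ, (∀ n, 0 < s n) ∧ Tendsto s atTop (nhds 0) :=
    ⟨fun n => 1 / ((n : ℝ) + 1), fun n => by positivity, tendsto_one_div_add_atTop_nhds_zero_nat⟩
  have h1 := (tendsto_integral_workExp hlam hG hG3 h hs h0).mul
    (((h0.const_mul (lam * moment G 2 / 2)).const_add (1 - lam * moment G 1)).sub
      (((h0.pow 2).const_mul lam).mul (tendsto_transformRemainder hG hG3 hs h0)))
  simp only [integral_workExp_mul hlam hG hG3 h (hs _)] at h1
  have := tendsto_nhds_unique h1 tendsto_const_nhds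
  simp at this
  linarith

include hstab

/-- The Pollaczek–Khinchine formula, solved for the deviation of the transform from `1`. -/
lemma integral_workExp_eq {s : ℝ} (hs : 0 < s) :
    1 - ∫ x, workExp G s (numWaiting x) x.2 ∂ν =
      (∫ x, workExp G s (numWaiting x) x.2 ∂ν) *
        (meanWork lam G * s -
          lam / (1 - lam * moment G 1) * transformRemainder G s * s ^ 2) := by
  have h1 := integral_workExp_mul hlam hG hG3 h hs
  rw [integral_idle hlam hG hG3 h] at h1
  have h2 : 1 - lam * moment G 1 ≠ 0 := by linarith
  unfold meanWork
  set E := ∫ x, workExp G s (numWaiting x) x.2 ∂ν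
  field_simp
  linarith

lemma tendsto_first_order (hs : ∀ n, 0 < s n) (h0 : Tendsto s atTop (nhds 0)) :
    Tendsto (fun n => (1 - ∫ x, workExp G (s n) (numWaiting x) x.2 ∂ν) / s n) atTop
      (nhds (meanWork lam G)) := by
  have h1 := (tendsto_integral_workExp hlam hG hG3 h hs h0).mul
    (((tendsto_transformRemainder hG hG3 hs h0).const_mul
      (lam / (1 - lam * moment G 1))).mul h0 |>.const_sub (meanWork lam G))
  simp only [mul_zero, sub_zero, one_mul] at h1
  refine h1.congr fun n => ?_
  have := (hs n).ne'
  rw [integral_workExp_eq hlam hG hG3 hstab h (hs n)]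
  field_simp

lemma tendsto_second_order (hs : ∀ n, 0 < s n) (h0 : Tendsto s atTop (nhds 0)) :
    Tendsto (fun n => ((∫ x, workExp G (s n) (numWaiting x) x.2 ∂ν) - 1 + s n * meanWork lam G) /
      s n ^ 2) atTop
      (nhds (meanWork lam G ^ 2 + lam * moment G 3 / (6 * (1 - lam * moment G 1)))) := by
  have h1 := ((tendsto_first_order hlam hG hG3 hstab h hs h0).const_mul (meanWork lam G)).add
    ((tendsto_integral_workExp hlam hG hG3 h hs h0).mul
      ((tendsto_transformRemainder hG hG3 hs h0).const_mul (lam / (1 - lam * moment G 1))))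
  have e : meanWork lam G ^ 2 + lam * moment G 3 / (6 * (1 - lam * moment G 1)) =
      meanWork lam G * meanWork lam G + 1 * (lam / (1 - lam * moment G 1) * (moment G 3 / 6)) := by
    have h2 : 1 - lam * moment G 1 ≠ 0 := by linarith
    field_simp
  rw [e]
  refine h1.congr fun n => ?_
  have h3 := integral_workExp_eq hlam hG hG3 hstab h (hs n)
  have := (hs n).ne'
  set E := ∫ x, workExp G (s n) (numWaiting x) x.2 ∂ν
  rw [eq_div_iff (by positivity)]
  have e2 : (1 - E) / s n * s n = 1 - E := by field_simp
  calc _ = meanWork lam G * ((1 - E) / s n * s n) * s n +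
        E * (lam / (1 - lam * moment G 1) * transformRemainder G (s n)) * s n ^ 2 := by ring
    _ = _ := by rw [e2]; linarith

/-- The first moment of the work is finite, by Fatou's lemma applied to the difference quotients of
the transform. -/
lemma integrable_workMean : Integrable (fun x : ℕ × ℝ => workMean G (numWaiting x) x.2) ν ∧
    ∫ x, workMean G (numWaiting x) x.2 ∂ν ≤ meanWork lam G := by
  obtain ⟨s, hs, h0⟩ : ∃ s : ℕ → ℝ, (∀ n, 0 < s n) ∧ Tendsto s atTop (nhds 0) :=
    ⟨fun n => 1 / ((n : ℝ) + 1), fun n => by positivity, tendsto_one_div_add_atTop_nhds_zero_nat⟩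
  refine integrable_of_tendsto_of_integral_le
    (F := fun n x => (1 - workExp G (s n) (numWaiting x) x.2) / s n) measurable_workMean ?_
    (fun n => ((integrable_const 1).sub (integrable_workExp hlam hG hG3 h (hs n))).div_const _) ?_
    (B := fun n => (1 - ∫ x, workExp G (s n) (numWaiting x) x.2 ∂ν) / s n) ?_
    (tendsto_first_order hlam hG hG3 hstab h hs h0)
  · intro n
    filter_upwards [h.ae_nonneg] with x hx
    exact div_nonneg (by linarith [workExp_le_one hG (hs n).le (numWaiting x) hx]) (hs n).le
  · filter_upwards [h.ae_nonneg] with x hx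
    have h2 := ((tendsto_workExp hG hG3 hs h0 (numWaiting x) hx).mul h0).const_sub
      (workMean G (numWaiting x) x.2)
    simp only [mul_zero, sub_zero] at h2
    refine h2.congr fun n => ?_
    have := (hs n).ne'
    field_simp
    ring
  · intro n
    rw [integral_div, integral_sub (integrable_const 1) (integrable_workExp hlam hG hG3 h (hs n))]
    simp

omit h hlam hstab in
/-- The second difference quotient of the transform of the work lies between `0` and its limit. -/
lemma quotient_bounds {s : ℝ} (hs : 0 < s) (y : ℕ) {r : ℝ} (hr : 0 ≤ r) :
    0 ≤ (workExp G s y r - 1 + s * workMean G y r) / s ^ 2 ∧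
      (workExp G s y r - 1 + s * workMean G y r) / s ^ 2 ≤ workSq G y r / 2 := by
  constructor
  · exact div_nonneg (by linarith [one_sub_le_workExp hG hG3 hs y hr]) (by positivity)
  · rw [div_le_iff₀ (by positivity)]
    linarith [workExp_le_quadratic hG hG3 hs y hr]

lemma integrable_quotient {s : ℝ} (hs : 0 < s) : Integrable (fun x : ℕ × ℝ =>
    (workExp G s (numWaiting x) x.2 - 1 + s * workMean G (numWaiting x) x.2) / s ^ 2) ν ∧
    ∫ x, (workExp G s (numWaiting x) x.2 - 1 + s * workMean G (numWaiting x) x.2) / s ^ 2 ∂ν =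
      ((∫ x, workExp G s (numWaiting x) x.2 ∂ν) - 1 + s * ∫ x, workMean G (numWaiting x) x.2 ∂ν) / s ^ 2 := by
  have i1 := integrable_workExp hlam hG hG3 h hs
  have i2 := (integrable_workMean hlam hG hG3 hstab h).1
  have i3 : Integrable (fun x : ℕ × ℝ => workExp G s (numWaiting x) x.2 - 1) ν :=
    i1.sub (integrable_const 1)
  refine ⟨(i3.add (i2.const_mul s)).div_const _, ?_⟩
  rw [integral_div, integral_add i3 (i2.const_mul s), integral_sub i1 (integrable_const 1),
    integral_const_mul]
  simp

/-- The second moment of the work is finite, by Fatou's lemma applied to the second difference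
quotients of the transform. -/
lemma integrable_workSq : Integrable (fun x : ℕ × ℝ => workSq G (numWaiting x) x.2) ν := by
  obtain ⟨s, hs, h0⟩ : ∃ s : ℕ → ℝ, (∀ n, 0 < s n) ∧ Tendsto s atTop (nhds 0) :=
    ⟨fun n => 1 / ((n : ℝ) + 1), fun n => by positivity, tendsto_one_div_add_atTop_nhds_zero_nat⟩
  have h1 := (integrable_of_tendsto_of_integral_le
    (F := fun n x => (workExp G (s n) (numWaiting x) x.2 - 1 + s n * workMean G (numWaiting x) x.2) / s n ^ 2)
    (f := fun x => workSq G (numWaiting x) x.2 / 2) (measurable_workSq.div_const 2) ?_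
    (fun n => (integrable_quotient hlam hG hG3 hstab h (hs n)).1) ?_
    (B := fun n => ((∫ x, workExp G (s n) (numWaiting x) x.2 ∂ν) - 1 + s n * meanWork lam G) / s n ^ 2)
    ?_ (tendsto_second_order hlam hG hG3 hstab h hs h0)).1
  · simpa using h1.mul_const 2
  · intro n
    filter_upwards [h.ae_nonneg] with x hx
    exact (quotient_bounds hG hG3 (hs n) _ hx).1
  · filter_upwards [h.ae_nonneg] with x hx
    exact tendsto_workExp hG hG3 hs h0 _ hx
  · intro n
    rw [(integrable_quotient hlam hG hG3 hstab h (hs n)).2]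
    have := (integrable_workMean hlam hG hG3 hstab h).2
    have := hs n
    gcongr

include hg1

omit hlam h hG3 hstab hg1 in
lemma sq_moment_le (hG2 : Integrable (fun x : ℝ => x ^ 2) G) (hG1 : Integrable (fun x : ℝ => x) G) :
    moment G 1 ^ 2 ≤ moment G 2 := by
  have : 0 ≤ ∫ x, (x - moment G 1) ^ 2 ∂G := integral_nonneg fun x => sq_nonneg _
  have e : ∀ x : ℝ, (x - moment G 1) ^ 2 = x ^ 2 - 2 * moment G 1 * x + moment G 1 ^ 2 := by
    intro x; ring
  simp_rw [e] at this
  have i1 : Integrable (fun x : ℝ => x ^ 2 - 2 * moment G 1 * x) G := hG2.sub (hG1.const_mul _)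
  rw [integral_add i1 (integrable_const _),
    integral_sub hG2 (hG1.const_mul _), integral_const_mul] at this
  simp only [integral_const, probReal_univ, smul_eq_mul] at this
  have e1 : ∫ x, x ∂G = moment G 1 := by simp [moment]
  have e2 : ∫ x, x ^ 2 ∂G = moment G 2 := rfl
  rw [e1, e2] at this
  nlinarith

/-- The stationary state has second moments. -/
lemma integrable_growth :
    Integrable (fun x : ℕ × ℝ => 1 + (numWaiting x : ℝ) ^ 2 + x.2 ^ 2) ν := by
  have hi := integrable_workSq hlam hG hG3 hstab h
  have hv := sq_moment_le hG (integrable_pow hG hG3 (k := 2) (by norm_num))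
    (by simpa using integrable_pow hG hG3 (k := 1) (by norm_num))
  have hm : Measurable fun x : ℕ × ℝ => 1 + (numWaiting x : ℝ) ^ 2 + x.2 ^ 2 :=
    measurable_uncurry_nat (f := fun y r => 1 + (y : ℝ) ^ 2 + r ^ 2) (fun y => by fun_prop)
      measurable_numWaiting measurable_snd
  refine Integrable.mono' ((integrable_const 1).add (hi.const_mul (1 / moment G 1 ^ 2 + 1)))
    hm.aestronglyMeasurable ?_
  filter_upwards [h.ae_nonneg] with x hx
  rw [Real.norm_of_nonneg (by positivity)]
  simp only [Pi.add_apply]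
  have hy : (0 : ℝ) ≤ (numWaiting x : ℝ) := Nat.cast_nonneg _
  generalize numWaiting x = y at hy ⊢
  have h1 : x.2 ^ 2 + (moment G 1 * y) ^ 2 ≤ workSq G y x.2 := by
    unfold workSq workMean
    nlinarith [mul_nonneg hx (mul_nonneg hg1.le hy), mul_nonneg (sub_nonneg.mpr hv) hy]
  have h2 : (y : ℝ) ^ 2 ≤ 1 / moment G 1 ^ 2 * workSq G y x.2 := by
    rw [one_div, ← div_eq_inv_mul, le_div_iff₀ (by positivity)]
    nlinarith [sq_nonneg x.2]
  nlinarith [sq_nonneg (moment G 1 * y)]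

end Moments

/-! ### Quadratic and product test functions -/

/-- The test functions that are quadratic polynomials in the state. -/
def quadTest (G : Measure ℝ) (a b c : ℝ) (y : ℕ) (r : ℝ) : ℝ :=
  a * workSq G y r + b * (r ^ 2 + moment G 2 * y) + c * workMean G y r

/-- The derivative of `quadTest` in the residual service time. -/
def quadTestDeriv (G : Measure ℝ) (a b c : ℝ) (y : ℕ) (r : ℝ) : ℝ :=
  a * (2 * workMean G y r) + b * (2 * r) + c

lemma hasDerivAt_workMean (G : Measure ℝ) (y : ℕ) (r : ℝ) : HasDerivAt (workMean G y) 1 r :=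
  (hasDerivAt_id' r).add_const (moment G 1 * y)

lemma cast_le_growth (y : ℕ) {r : ℝ} : (y : ℝ) ≤ 1 + (y : ℝ) ^ 2 + r ^ 2 := by
  nlinarith [sq_nonneg ((y : ℝ) - 1), sq_nonneg r]

lemma abs_le_growth (y : ℕ) {r : ℝ} : |r| ≤ 1 + (y : ℝ) ^ 2 + r ^ 2 := by
  nlinarith [sq_nonneg (|r| - 1), sq_nonneg (y : ℝ), sq_abs r]

lemma abs_workMean_le (G : Measure ℝ) (y : ℕ) (r : ℝ) :
    |workMean G y r| ≤ (1 + |moment G 1|) * (1 + (y : ℝ) ^ 2 + r ^ 2) := by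
  unfold workMean
  calc |r + moment G 1 * y| ≤ |r| + |moment G 1| * y := by
        refine (abs_add_le _ _).trans ?_
        rw [abs_mul, Nat.abs_cast]
    _ ≤ (1 + (y : ℝ) ^ 2 + r ^ 2) + |moment G 1| * (1 + (y : ℝ) ^ 2 + r ^ 2) := by
        gcongr
        · exact abs_le_growth y
        · exact cast_le_growth y
    _ = _ := by ring

lemma abs_workSq_le (G : Measure ℝ) (y : ℕ) (r : ℝ) :
    |workSq G y r| ≤ (2 + 2 * moment G 1 ^ 2 + |moment G 2 - moment G 1 ^ 2|) *
      (1 + (y : ℝ) ^ 2 + r ^ 2) := by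
  unfold workSq workMean
  have h1 : (r + moment G 1 * y) ^ 2 ≤ 2 * r ^ 2 + 2 * moment G 1 ^ 2 * (y : ℝ) ^ 2 := by
    nlinarith [sq_nonneg (r - moment G 1 * y)]
  have h2 : |(moment G 2 - moment G 1 ^ 2) * (y : ℝ)| ≤
      |moment G 2 - moment G 1 ^ 2| * (1 + (y : ℝ) ^ 2 + r ^ 2) := by
    rw [abs_mul, Nat.abs_cast]
    gcongr
    exact cast_le_growth y
  refine (abs_add_le _ _).trans ?_
  rw [abs_of_nonneg (sq_nonneg _)]
  nlinarith [sq_nonneg (moment G 1), sq_nonneg (y : ℝ), sq_nonneg r,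
    mul_nonneg (sq_nonneg (moment G 1)) (sq_nonneg r)]

section Tests

variable {G : Measure ℝ} [IsProbabilityMeasure G] (hG : ∀ᵐ x ∂G, 0 ≤ x)
  (hG3 : Integrable (fun x : ℝ => x ^ 3) G)
include hG hG3

lemma testFunction_quadTest (a b c : ℝ) :
    TestFunction G (quadTest G a b c) (quadTestDeriv G a b c) where
  hasDerivAt y r := by
    have h1 := hasDerivAt_workMean G y r
    have h2 := ((((h1.pow 2).add_const ((moment G 2 - moment G 1 ^ 2) * y)).const_mul a).add
      (((hasDerivAt_pow 2 r).add_const (moment G 2 * y)).const_mul b)).add (h1.const_mul c)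
    exact h2.congr_deriv (by unfold quadTestDeriv; push_cast; ring)
  continuous_deriv y := by unfold quadTestDeriv workMean; fun_prop
  growth := by
    have hK1 : 0 ≤ 2 + 2 * moment G 1 ^ 2 + |moment G 2 - moment G 1 ^ 2| := by positivity
    have hK2 : 0 ≤ 1 + |moment G 1| := by positivity
    refine ⟨|a| * (2 + 2 * moment G 1 ^ 2 + |moment G 2 - moment G 1 ^ 2|) +
      |b| * (3 + |moment G 2|) + |c| * (2 + |moment G 1|) + 2 * |a| * (1 + |moment G 1|),
      by positivity, fun y r hr => ?_⟩
    have h1 := abs_workSq_le G y r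
    have h2 := abs_workMean_le G y r
    have h3 := cast_le_growth y (r := r)
    have h4 := abs_le_growth y (r := r)
    set B := 1 + (y : ℝ) ^ 2 + r ^ 2 with hB
    have hB1 : 1 ≤ B := by rw [hB]; nlinarith [sq_nonneg (y : ℝ), sq_nonneg r]
    have hr2 : r ^ 2 ≤ B := by rw [hB]; nlinarith [sq_nonneg (y : ℝ)]
    have h5 : |r ^ 2 + moment G 2 * y| ≤ (1 + |moment G 2|) * B := by
      refine (abs_add_le _ _).trans ?_
      rw [abs_mul, Nat.abs_cast, abs_of_nonneg (sq_nonneg r)]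
      nlinarith [mul_le_mul_of_nonneg_left h3 (abs_nonneg (moment G 2))]
    have p1 : 0 ≤ |a| * (2 + 2 * moment G 1 ^ 2 + |moment G 2 - moment G 1 ^ 2|) * B := by
      positivity
    have p2 : 0 ≤ |b| * B := by positivity
    have p3 : 0 ≤ |c| * B := by positivity
    have p4 : 0 ≤ |a| * (1 + |moment G 1|) * B := by positivity
    have p5 : 0 ≤ |b| * |moment G 2| * B := by positivity
    have p6 : 0 ≤ |c| * |moment G 1| * B := by positivity
    constructor
    · unfold quadTest
      calc _ ≤ |a| * |workSq G y r| + |b| * |r ^ 2 + moment G 2 * y| + |c| * |workMean G y r| := by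
            simp only [← abs_mul]
            exact abs_add_three _ _ _
        _ ≤ |a| * ((2 + 2 * moment G 1 ^ 2 + |moment G 2 - moment G 1 ^ 2|) * B) +
            |b| * ((1 + |moment G 2|) * B) + |c| * ((1 + |moment G 1|) * B) := by gcongr
        _ ≤ _ := by linarith
    · unfold quadTestDeriv
      calc _ ≤ |a| * |2 * workMean G y r| + |b| * |2 * r| + |c| := by
            simp only [← abs_mul]
            exact abs_add_three _ _ _
        _ = |a| * (2 * |workMean G y r|) + |b| * (2 * |r|) + |c| * 1 := by
            rw [abs_mul 2, abs_mul 2, abs_two]; ring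
        _ ≤ |a| * (2 * ((1 + |moment G 1|) * B)) + |b| * (2 * B) + |c| * B := by gcongr
        _ ≤ _ := by linarith
  integral_eq y := by
    have i1 : Integrable (fun x : ℝ => x) G := by
      simpa using integrable_pow hG hG3 (k := 1) (by norm_num)
    have i2 := integrable_pow hG hG3 (k := 2) (by norm_num)
    have e : ∀ x, quadTest G a b c y x = quadTest G a b c y 0 +
        ((a * (2 * moment G 1 * y) + c) * x + (a + b) * x ^ 2) := by
      intro x; unfold quadTest workSq workMean; ring
    have i3 : Integrable (fun x : ℝ => (a * (2 * moment G 1 * y) + c) * x + (a + b) * x ^ 2) G :=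
      (i1.const_mul _).add (i2.const_mul _)
    rw [integral_congr_ae (Eventually.of_forall e), integral_add (integrable_const _) i3,
      integral_add (i1.const_mul _) (i2.const_mul _),
      integral_const_mul, integral_const_mul]
    have e1 : ∫ x, x ∂G = moment G 1 := by simp [moment]
    have e2 : ∫ x, x ^ 2 ∂G = moment G 2 := rfl
    rw [e1, e2, integral_const]
    simp only [probReal_univ, smul_eq_mul, quadTest, workSq, workMean]
    push_cast
    ring

section Primitive

variable {ψ : ℝ → ℝ} (hψ : Continuous ψ) {B : ℝ} (hB : ∀ r, |ψ r| ≤ B)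
include hψ hB

omit hG hG3 in
lemma abs_primitive_le (r : ℝ) : |∫ x in 0..r, ψ x| ≤ B * |r| := by
  have := intervalIntegral.norm_integral_le_of_norm_le_const (a := 0) (b := r) (f := ψ) (C := B)
    fun x _ => hB x
  simpa using this

lemma integrable_primitive : Integrable (fun x => ∫ v in 0..x, ψ v) G := by
  have i1 : Integrable (fun x : ℝ => x) G := by
    simpa using integrable_pow hG hG3 (k := 1) (by norm_num)
  refine Integrable.mono' (i1.norm.const_mul B) ?_ (Eventually.of_forall (abs_primitive_le hψ hB))
  exact (continuous_iff_continuousAt.mpr fun r =>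
    (hψ.integral_hasStrictDerivAt 0 r).hasDerivAt.continuousAt).aestronglyMeasurable

/-- The test functions `φ(r) + y E φ(S)`, with `φ` the primitive of a bounded function. -/
lemma testFunction_primitive : TestFunction G
    (fun y r => (∫ v in 0..r, ψ v) + (∫ x, (∫ v in 0..x, ψ v) ∂G) * y) (fun _ r => ψ r) where
  hasDerivAt y r := (hψ.integral_hasStrictDerivAt 0 r).hasDerivAt.add_const _
  continuous_deriv _ := hψ
  growth := by
    have hB0 : 0 ≤ B := (abs_nonneg _).trans (hB 0)
    set m := ∫ x, (∫ v in 0..x, ψ v) ∂G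
    refine ⟨B + |m|, by positivity, fun y r hr => ?_⟩
    have h3 := cast_le_growth y (r := r)
    have h4 := abs_le_growth y (r := r)
    have hB1 : 1 ≤ 1 + (y : ℝ) ^ 2 + r ^ 2 := by nlinarith [sq_nonneg (y : ℝ), sq_nonneg r]
    constructor
    · refine (abs_add_le _ _).trans ?_
      rw [abs_mul, Nat.abs_cast, add_mul]
      exact add_le_add ((abs_primitive_le hψ hB r).trans (by gcongr)) (by gcongr)
    · nlinarith [hB r, abs_nonneg m]
  integral_eq y := by
    rw [integral_add (integrable_primitive hG hG3 hψ hB) (integrable_const _)]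
    simp
    ring

/-- The test functions `φ(r) y + E φ(S) y (y - 1) / 2`, with `φ` the primitive of a bounded
function. -/
lemma testFunction_primitive_mul : TestFunction G
    (fun y r => (∫ v in 0..r, ψ v) * y + (∫ x, (∫ v in 0..x, ψ v) ∂G) * ((y : ℝ) * (y - 1) / 2))
    (fun y r => ψ r * y) where
  hasDerivAt y r := ((hψ.integral_hasStrictDerivAt 0 r).hasDerivAt.mul_const _).add_const _
  continuous_deriv _ := hψ.mul continuous_const
  growth := by
    have hB0 : 0 ≤ B := (abs_nonneg _).trans (hB 0)
    set m := ∫ x, (∫ v in 0..x, ψ v) ∂G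
    refine ⟨B + |m|, by positivity, fun y r hr => ?_⟩
    have h3 := cast_le_growth y (r := r)
    have h4 : |r| * y ≤ 1 + (y : ℝ) ^ 2 + r ^ 2 := by
      nlinarith [sq_nonneg (|r| - y), sq_abs r, sq_nonneg (y : ℝ)]
    have h5 : |(y : ℝ) * (y - 1) / 2| ≤ 1 + (y : ℝ) ^ 2 + r ^ 2 := by
      rw [abs_le]; constructor <;> nlinarith [sq_nonneg (y : ℝ), sq_nonneg r]
    constructor
    · refine (abs_add_le _ _).trans ?_
      rw [abs_mul, abs_mul, Nat.abs_cast, add_mul]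
      refine add_le_add ?_ (by gcongr)
      calc |∫ v in 0..r, ψ v| * (y : ℝ) ≤ B * |r| * y := by
            gcongr; exact abs_primitive_le hψ hB r
        _ ≤ _ := by rw [mul_assoc]; gcongr
    · rw [abs_mul, Nat.abs_cast]
      have : |ψ r| * (y : ℝ) ≤ B * (1 + (y : ℝ) ^ 2 + r ^ 2) :=
        mul_le_mul (hB r) h3 (Nat.cast_nonneg y) hB0
      nlinarith [abs_nonneg m, mul_nonneg (abs_nonneg m) (by positivity : 0 ≤ 1 + (y : ℝ) ^ 2 + r ^ 2)]
  integral_eq y := by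
    rw [integral_add ((integrable_primitive hG hG3 hψ hB).mul_const _) (integrable_const _),
      integral_mul_const]
    simp
    ring

end Primitive

end Tests

/-- The truncated power `min (r⁺) K ^ k`. -/
def truncPow (K : ℝ) (k : ℕ) (r : ℝ) : ℝ := min (max r 0) K ^ k

lemma continuous_truncPow (K : ℝ) (k : ℕ) : Continuous (truncPow K k) := by
  unfold truncPow; fun_prop

lemma truncPow_nonneg {K : ℝ} (hK : 0 ≤ K) (k : ℕ) (r : ℝ) : 0 ≤ truncPow K k r :=
  pow_nonneg (le_min (le_max_right _ _) hK) k

lemma abs_truncPow_le {K : ℝ} (hK : 0 ≤ K) (k : ℕ) (r : ℝ) : |truncPow K k r| ≤ K ^ k := by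
  rw [abs_of_nonneg (truncPow_nonneg hK k r)]
  exact pow_le_pow_left₀ (le_min (le_max_right _ _) hK) (min_le_right _ _) k

lemma truncPow_le {K : ℝ} (hK : 0 ≤ K) (k : ℕ) {r : ℝ} (hr : 0 ≤ r) : truncPow K k r ≤ r ^ k := by
  unfold truncPow
  refine pow_le_pow_left₀ (le_min (le_max_right _ _) hK) ((min_le_left _ _).trans ?_) k
  rw [max_eq_left hr]

lemma truncPow_eq {K : ℝ} (k : ℕ) {r : ℝ} (hr : 0 ≤ r) (hK : r ≤ K) : truncPow K k r = r ^ k := by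
  unfold truncPow
  rw [max_eq_left hr, min_eq_left hK]

lemma primitive_truncPow_nonneg {K : ℝ} (hK : 0 ≤ K) (k : ℕ) {r : ℝ} (hr : 0 ≤ r) :
    0 ≤ ∫ v in 0..r, truncPow K k v :=
  intervalIntegral.integral_nonneg hr fun v _ => truncPow_nonneg hK k v

lemma primitive_truncPow_le {K : ℝ} (hK : 0 ≤ K) (k : ℕ) {r : ℝ} (hr : 0 ≤ r) :
    ∫ v in 0..r, truncPow K k v ≤ r ^ (k + 1) / (k + 1) := by
  have := intervalIntegral.integral_mono_on hr
    ((continuous_truncPow K k).intervalIntegrable (μ := volume) 0 r)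
    ((continuous_pow k).intervalIntegrable (μ := volume) 0 r)
    fun v hv => truncPow_le hK k hv.1
  simpa using this

lemma primitive_truncPow_eq {K : ℝ} (k : ℕ) {r : ℝ} (hr : 0 ≤ r) (hK : r ≤ K) :
    ∫ v in 0..r, truncPow K k v = r ^ (k + 1) / (k + 1) := by
  have : ∫ v in 0..r, truncPow K k v = ∫ v in 0..r, v ^ k := by
    refine intervalIntegral.integral_congr fun v hv => ?_
    rw [Set.uIcc_of_le hr] at hv
    exact truncPow_eq k hv.1 (hv.2.trans hK)
  rw [this]; simp

lemma tendsto_truncPow (k : ℕ) {r : ℝ} (hr : 0 ≤ r) :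
    Tendsto (fun n : ℕ => truncPow n k r) atTop (nhds (r ^ k)) :=
  tendsto_const_nhds.congr' <| by
    filter_upwards [eventually_ge_atTop ⌈r⌉₊] with n hn
    exact (truncPow_eq k hr (Nat.ceil_le.mp hn)).symm

lemma tendsto_primitive_truncPow (k : ℕ) {r : ℝ} (hr : 0 ≤ r) :
    Tendsto (fun n : ℕ => ∫ v in 0..r, truncPow n k v) atTop (nhds (r ^ (k + 1) / (k + 1))) :=
  tendsto_const_nhds.congr' <| by
    filter_upwards [eventually_ge_atTop ⌈r⌉₊] with n hn
    exact (primitive_truncPow_eq k hr (Nat.ceil_le.mp hn)).symm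

lemma continuous_primitive_truncPow (K : ℝ) (k : ℕ) :
    Continuous fun r => ∫ v in 0..r, truncPow K k v :=
  continuous_iff_continuousAt.mpr fun r =>
    ((continuous_truncPow K k).integral_hasStrictDerivAt 0 r).hasDerivAt.continuousAt

/-! ### The second moments of the stationary state -/

lemma StationaryLaw.ae_cases {lam : ℝ} {G : Measure ℝ} {ν : Measure (ℕ × ℝ)}
    (h : StationaryLaw lam G ν) :
    ∀ᵐ x ∂ν, 0 < x.2 ∧ (x.1 : ℝ) = numWaiting x + 1 ∨
      x.2 = 0 ∧ numWaiting x = 0 ∧ (x.1 : ℝ) = 0 := by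
  filter_upwards [h.consistent] with x hx
  rcases Nat.eq_zero_or_pos x.1 with h0 | h0
  · exact Or.inr ⟨hx.1 h0, by rw [numWaiting, h0], by rw [h0, Nat.cast_zero]⟩
  · refine Or.inl ⟨hx.2 h0, ?_⟩
    rw [numWaiting]
    have : x.1 - 1 + 1 = x.1 := by omega
    exact_mod_cast this.symm

/-- The indicator of a busy server. -/
def busy (x : ℕ × ℝ) : ℝ := if 0 < x.2 then 1 else 0

lemma measurable_busy : Measurable busy :=
  Measurable.ite (measurableSet_lt measurable_const measurable_snd) measurable_const
    measurable_const

section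

variable {lam : ℝ} (hlam : 0 < lam) {G : Measure ℝ} [IsProbabilityMeasure G]
  (hG : ∀ᵐ x ∂G, 0 ≤ x) (hG3 : Integrable (fun x : ℝ => x ^ 3) G)
  (hg1 : 0 < moment G 1) (hstab : lam * moment G 1 < 1)
  {ν : Measure (ℕ × ℝ)} [IsProbabilityMeasure ν] (h : StationaryLaw lam G ν)
  (hgr : Integrable (fun x : ℕ × ℝ => 1 + (numWaiting x : ℝ) ^ 2 + x.2 ^ 2) ν)

include h hgr

lemma integrable_of_growth {F : ℕ → ℝ → ℝ} (hF : ∀ y, Measurable (F y)) {C : ℝ}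
    (hC : ∀ (y : ℕ) (r : ℝ), 0 ≤ r → |F y r| ≤ C * (1 + (y : ℝ) ^ 2 + r ^ 2)) :
    Integrable (fun x : ℕ × ℝ => F (numWaiting x) x.2) ν := by
  refine Integrable.mono' (hgr.const_mul C)
    (measurable_uncurry_nat hF measurable_numWaiting measurable_snd).aestronglyMeasurable ?_
  filter_upwards [h.ae_nonneg] with x hx
  exact hC _ _ hx

lemma integrable_numWaiting : Integrable (fun x : ℕ × ℝ => (numWaiting x : ℝ)) ν :=
  integrable_of_growth h hgr (F := fun y _ => (y : ℝ)) (C := 1) (fun y => by fun_prop)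
    fun y r _ => by rw [Nat.abs_cast, one_mul]; exact cast_le_growth y

lemma integrable_residual : Integrable (fun x : ℕ × ℝ => x.2) ν :=
  integrable_of_growth h hgr (F := fun _ r => r) (C := 1) (fun y => by fun_prop)
    fun y r _ => by rw [one_mul]; exact abs_le_growth y

lemma integrable_numWaiting_sq : Integrable (fun x : ℕ × ℝ => (numWaiting x : ℝ) ^ 2) ν :=
  integrable_of_growth h hgr (F := fun y _ => (y : ℝ) ^ 2) (C := 1) (fun y => by fun_prop)
    fun y r _ => by rw [abs_of_nonneg (sq_nonneg _)]; nlinarith [sq_nonneg r]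

lemma integrable_residual_sq : Integrable (fun x : ℕ × ℝ => x.2 ^ 2) ν :=
  integrable_of_growth h hgr (F := fun _ r => r ^ 2) (C := 1) (fun y => by fun_prop)
    fun y r _ => by rw [abs_of_nonneg (sq_nonneg _)]; nlinarith [sq_nonneg (y : ℝ)]

lemma integrable_residual_mul : Integrable (fun x : ℕ × ℝ => x.2 * (numWaiting x : ℝ)) ν :=
  integrable_of_growth h hgr (F := fun y r => r * (y : ℝ)) (C := 1) (fun y => by fun_prop)
    fun y r hr => by
      rw [abs_of_nonneg (by positivity)]
      nlinarith [sq_nonneg (r - y), sq_nonneg (y : ℝ), sq_nonneg r]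

omit hgr in
lemma integrable_busy : Integrable busy ν := by
  refine Integrable.mono' (integrable_const 1) measurable_busy.aestronglyMeasurable
    (Eventually.of_forall fun x => ?_)
  unfold busy; split_ifs <;> simp

include hlam hG hG3

/-- The stationary mean of the generator vanishes for every test function, the integrability
conditions being met because the stationary state has second moments. -/
lemma integrable_generator_and_integral {f f' : ℕ → ℝ → ℝ} (hf : TestFunction G f f') :
    Integrable (fun x : ℕ × ℝ => f (numWaiting x) x.2) ν ∧
    Integrable (generator lam f f') ν ∧ ∫ x, generator lam f f' x ∂ν = 0 := by
  have hG2 := integrable_pow hG hG3 (k := 2) (by norm_num)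
  obtain ⟨C, hC, hb⟩ := hf.growth
  have h1 := integrable_of_growth h hgr hf.measurable fun y r hr => (hb y r hr).1
  have h2 := integrable_of_growth h hgr (F := fun y r => f (y + 1) r) (C := 3 * C)
    (fun y => hf.measurable _) fun y r hr => ((hb (y + 1) r hr).1).trans (by
      push_cast
      nlinarith [mul_nonneg hC (sq_nonneg ((y : ℝ) - 1)), mul_nonneg hC (sq_nonneg r)])
  have h3 := integrable_of_growth h hgr (F := fun y r => if 0 < r then f' y r else 0) (C := C)
    (fun y => Measurable.ite (measurableSet_lt measurable_const measurable_id)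
      (hf.continuous_deriv y).measurable measurable_const) fun y r hr => by
      split_ifs
      · exact (hb y r hr).2
      · rw [abs_zero]; positivity
  have hL : Integrable (generator lam f f') ν := ((h2.sub h1).const_mul lam).sub h3
  exact ⟨h1, hL, integral_generator_eq_zero hlam hG hG2 h hf h1 hL⟩

/-- The generator of a quadratic test function. -/
lemma generator_quadTest (a b c : ℝ) :
    generator lam (quadTest G a b c) (quadTestDeriv G a b c) =ᵐ[ν] fun x =>
      a * (lam * moment G 2 - 2 * (1 - lam * moment G 1) * (x.2 + moment G 1 * numWaiting x)) +
      b * (lam * moment G 2 - 2 * x.2) + c * (lam * moment G 1 - busy x) := by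
  filter_upwards [h.ae_cases] with x hx
  unfold generator quadTest quadTestDeriv busy
  rw [workSq_succ, workMean_succ]
  rcases hx with ⟨h0, -⟩ | ⟨h0, h1, -⟩
  · simp only [if_pos h0, workMean]; push_cast; ring
  · simp only [h0, h1, lt_irrefl, if_false, workMean]; push_cast; ring

/-- The stationary mean of the generator vanishes for quadratic test functions. As `a`, `b`, `c` are
arbitrary, this determines the means of the work, of the residual service time and of `busy`. -/
lemma integral_quadTest (a b c : ℝ) :
    a * (lam * moment G 2 - 2 * (1 - lam * moment G 1) *
      ((∫ x, x.2 ∂ν) + moment G 1 * ∫ x, (numWaiting x : ℝ) ∂ν)) +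
    b * (lam * moment G 2 - 2 * ∫ x, x.2 ∂ν) + c * (lam * moment G 1 - ∫ x, busy x ∂ν) = 0 := by
  have key := (integrable_generator_and_integral hlam hG hG3 h hgr
    (testFunction_quadTest hG hG3 a b c)).2.2
  rw [integral_congr_ae (generator_quadTest hlam hG hG3 h hgr a b c)] at key
  have iR := integrable_residual h hgr
  have iY := integrable_numWaiting h hgr
  have iB := integrable_busy h
  have j0 : Integrable (fun x : ℕ × ℝ => x.2 + moment G 1 * numWaiting x) ν :=
    iR.add (iY.const_mul _)
  have j1 : Integrable (fun x : ℕ × ℝ => a * (lam * moment G 2 - 2 * (1 - lam * moment G 1) *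
      (x.2 + moment G 1 * numWaiting x))) ν :=
    ((integrable_const _).sub (j0.const_mul _)).const_mul a
  have j2 : Integrable (fun x : ℕ × ℝ => b * (lam * moment G 2 - 2 * x.2)) ν :=
    ((integrable_const _).sub (iR.const_mul _)).const_mul b
  have j3 : Integrable (fun x : ℕ × ℝ => c * (lam * moment G 1 - busy x)) ν :=
    ((integrable_const _).sub iB).const_mul c
  have j12 : Integrable (fun x : ℕ × ℝ => a * (lam * moment G 2 - 2 * (1 - lam * moment G 1) *
      (x.2 + moment G 1 * numWaiting x)) + b * (lam * moment G 2 - 2 * x.2)) ν := j1.add j2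
  rw [integral_add j12 j3, integral_add j1 j2, integral_const_mul, integral_const_mul,
    integral_const_mul, integral_sub (integrable_const _) (j0.const_mul _),
    integral_sub (integrable_const _) (iR.const_mul _), integral_sub (integrable_const _) iB,
    integral_const_mul, integral_const_mul, integral_add iR (iY.const_mul _),
    integral_const_mul] at key
  simpa [integral_const_mul] using key

lemma integral_busy : ∫ x, busy x ∂ν = lam * moment G 1 := by
  linarith [integral_quadTest hlam hG hG3 h hgr 0 0 1]

lemma integral_residual : ∫ x, x.2 ∂ν = lam * moment G 2 / 2 := by
  linarith [integral_quadTest hlam hG hG3 h hgr 0 1 0]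

lemma integral_numWaiting (hstab : lam * moment G 1 < 1) :
    (∫ x, x.2 ∂ν) + moment G 1 * ∫ x, (numWaiting x : ℝ) ∂ν = meanWork lam G := by
  have h1 := integral_quadTest hlam hG hG3 h hgr 1 0 0
  unfold meanWork
  rw [eq_div_iff (by linarith)]
  linarith

/-- Conservation law for the residual service time: a function of it that has primitive `φ` has
stationary mean `lam E φ(S)` over the busy states. -/
lemma integral_primitive {ψ : ℝ → ℝ} (hψ : Continuous ψ) {B : ℝ} (hB : ∀ r, |ψ r| ≤ B) :
    ∫ x, busy x * ψ x.2 ∂ν = lam * ∫ x, (∫ v in 0..x, ψ v) ∂G := by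
  have hf := testFunction_primitive hG hG3 hψ hB
  have key := (integrable_generator_and_integral hlam hG hG3 h hgr hf).2.2
  set m := ∫ x, (∫ v in 0..x, ψ v) ∂G
  have i1 : Integrable (fun x : ℕ × ℝ => busy x * ψ x.2) ν := by
    refine (integrable_busy h).mul_bdd (c := B)
      (hψ.measurable.comp measurable_snd).aestronglyMeasurable (Eventually.of_forall fun x => hB _)
  have e : ∀ x, generator lam (fun y r => (∫ v in 0..r, ψ v) + m * (y : ℝ)) (fun _ r => ψ r) x =
      lam * m - busy x * ψ x.2 := by
    intro x
    unfold generator busy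
    split_ifs <;> (push_cast; ring)
  rw [integral_congr_ae (Eventually.of_forall e), integral_sub (integrable_const _) i1] at key
  simp at key
  linarith

/-- The conservation law for products of a function of the residual service time and the number
waiting. -/
lemma integral_primitive_mul {ψ : ℝ → ℝ} (hψ : Continuous ψ) {B : ℝ} (hB : ∀ r, |ψ r| ≤ B) :
    ∫ x, ψ x.2 * (numWaiting x : ℝ) ∂ν = lam * ((∫ x, (∫ v in 0..x.2, ψ v) ∂ν) +
      (∫ x, (∫ v in 0..x, ψ v) ∂G) * ∫ x, (numWaiting x : ℝ) ∂ν) := by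
  have hf := testFunction_primitive_mul hG hG3 hψ hB
  have key := (integrable_generator_and_integral hlam hG hG3 h hgr hf).2.2
  set m := ∫ x, (∫ v in 0..x, ψ v) ∂G
  have iY := integrable_numWaiting h hgr
  have i1 : Integrable (fun x : ℕ × ℝ => ψ x.2 * (numWaiting x : ℝ)) ν :=
    iY.bdd_mul (c := B)
      (hψ.measurable.comp measurable_snd).aestronglyMeasurable (Eventually.of_forall fun x => hB _)
  have hφ : Continuous fun r => ∫ v in 0..r, ψ v :=
    continuous_iff_continuousAt.mpr fun r =>
      (hψ.integral_hasStrictDerivAt 0 r).hasDerivAt.continuousAt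
  have i2 : Integrable (fun x : ℕ × ℝ => ∫ v in 0..x.2, ψ v) ν := by
    refine Integrable.mono' ((integrable_residual h hgr).norm.const_mul B)
      (hφ.measurable.comp measurable_snd).aestronglyMeasurable (Eventually.of_forall fun x => ?_)
    exact abs_primitive_le hψ hB x.2
  have i3 : Integrable (fun x : ℕ × ℝ => (∫ v in 0..x.2, ψ v) + m * (numWaiting x : ℝ)) ν :=
    i2.add (iY.const_mul m)
  have e : generator lam (fun y r => (∫ v in 0..r, ψ v) * (y : ℝ) + m * ((y : ℝ) * (y - 1) / 2))
      (fun y r => ψ r * (y : ℝ)) =ᵐ[ν] fun x =>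
      lam * ((∫ v in 0..x.2, ψ v) + m * (numWaiting x : ℝ)) - ψ x.2 * (numWaiting x : ℝ) := by
    filter_upwards [h.ae_cases] with x hx
    unfold generator
    rcases hx with ⟨h0, -⟩ | ⟨h0, h1, -⟩
    · simp only [if_pos h0]; push_cast; ring
    · simp [h0, h1]
  rw [integral_congr_ae e, integral_sub (i3.const_mul lam) i1, integral_const_mul,
    integral_add i2 (iY.const_mul m), integral_const_mul] at key
  linarith

/-- The conservation law for `r ↦ r ^ 2`, by approximation with truncated powers. -/
lemma integral_residual_sq : ∫ x, x.2 ^ 2 ∂ν = lam * moment G 3 / 3 := by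
  have h1 : Tendsto (fun n : ℕ => ∫ x, busy x * truncPow n 2 x.2 ∂ν) atTop
      (nhds (∫ x, x.2 ^ 2 ∂ν)) := by
    refine tendsto_integral_of_dominated_convergence (fun x => x.2 ^ 2)
      (fun n => (measurable_busy.mul
        ((continuous_truncPow n 2).measurable.comp measurable_snd)).aestronglyMeasurable)
      (integrable_residual_sq h hgr) (fun n => ?_) ?_
    · filter_upwards [h.ae_nonneg] with x hx
      rw [norm_mul, Real.norm_of_nonneg (truncPow_nonneg (Nat.cast_nonneg n) 2 _)]
      have hb : ‖busy x‖ ≤ 1 := by unfold busy; split_ifs <;> simp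
      have := truncPow_le (Nat.cast_nonneg (α := ℝ) n) 2 hx
      nlinarith [truncPow_nonneg (Nat.cast_nonneg (α := ℝ) n) 2 x.2, norm_nonneg (busy x)]
    · filter_upwards [h.ae_cases] with x hx
      rcases hx with ⟨h0, -⟩ | ⟨h0, -⟩
      · simpa [busy, h0] using tendsto_truncPow 2 h0.le
      · simp [busy, h0]
  have h2 : Tendsto (fun n : ℕ => lam * ∫ x, (∫ v in 0..x, truncPow n 2 v) ∂G) atTop
      (nhds (lam * ∫ x, x ^ 3 / 3 ∂G)) := by
    refine Tendsto.const_mul lam (tendsto_integral_of_dominated_convergence (fun x => x ^ 3 / 3)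
      (fun n => (continuous_primitive_truncPow n 2).aestronglyMeasurable)
      (hG3.div_const 3) (fun n => ?_) ?_)
    · filter_upwards [hG] with x hx
      rw [Real.norm_of_nonneg (primitive_truncPow_nonneg (Nat.cast_nonneg n) 2 hx)]
      refine (primitive_truncPow_le (Nat.cast_nonneg n) 2 hx).trans (le_of_eq ?_)
      norm_num
    · filter_upwards [hG] with x hx
      have := tendsto_primitive_truncPow 2 hx
      norm_num at this
      exact this
  have h3 := fun n : ℕ => integral_primitive hlam hG hG3 h hgr (continuous_truncPow n 2)
    (abs_truncPow_le (Nat.cast_nonneg (α := ℝ) n) 2)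
  simp_rw [h3] at h1
  rw [tendsto_nhds_unique h1 h2, integral_div]
  unfold moment; ring

/-- The product conservation law for `r ↦ r`, by approximation with truncated powers. -/
lemma integral_residual_mul : ∫ x, x.2 * (numWaiting x : ℝ) ∂ν =
    lam * ((∫ x, x.2 ^ 2 ∂ν) / 2 + moment G 2 / 2 * ∫ x, (numWaiting x : ℝ) ∂ν) := by
  have h1 : Tendsto (fun n : ℕ => ∫ x, truncPow n 1 x.2 * (numWaiting x : ℝ) ∂ν) atTop
      (nhds (∫ x, x.2 * (numWaiting x : ℝ) ∂ν)) := by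
    refine tendsto_integral_of_dominated_convergence (fun x => x.2 * (numWaiting x : ℝ))
      (fun n => (((continuous_truncPow n 1).measurable.comp measurable_snd).mul
        (measurable_from_nat.comp measurable_numWaiting)).aestronglyMeasurable)
      (integrable_residual_mul h hgr) (fun n => ?_) ?_
    · filter_upwards [h.ae_nonneg] with x hx
      rw [norm_mul, Real.norm_of_nonneg (truncPow_nonneg (Nat.cast_nonneg n) 1 _),
        Real.norm_of_nonneg (Nat.cast_nonneg _)]
      have := truncPow_le (Nat.cast_nonneg (α := ℝ) n) 1 hx
      rw [pow_one] at this
      gcongr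
    · filter_upwards [h.ae_nonneg] with x hx
      have := tendsto_truncPow 1 hx
      rw [pow_one] at this
      exact this.mul_const _
  have h2 : Tendsto (fun n : ℕ => ∫ x, (∫ v in 0..x, truncPow n 1 v) ∂G) atTop
      (nhds (∫ x, x ^ 2 / 2 ∂G)) := by
    refine tendsto_integral_of_dominated_convergence (fun x => x ^ 2 / 2)
      (fun n => (continuous_primitive_truncPow n 1).aestronglyMeasurable)
      ((integrable_pow hG hG3 (k := 2) (by norm_num)).div_const 2) (fun n => ?_) ?_
    · filter_upwards [hG] with x hx
      rw [Real.norm_of_nonneg (primitive_truncPow_nonneg (Nat.cast_nonneg n) 1 hx)]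
      refine (primitive_truncPow_le (Nat.cast_nonneg n) 1 hx).trans (le_of_eq ?_)
      norm_num
    · filter_upwards [hG] with x hx
      have := tendsto_primitive_truncPow 1 hx
      norm_num at this
      exact this
  have h4 : Tendsto (fun n : ℕ => ∫ x, (∫ v in 0..x.2, truncPow n 1 v) ∂ν) atTop
      (nhds (∫ x, x.2 ^ 2 / 2 ∂ν)) := by
    refine tendsto_integral_of_dominated_convergence (fun x => x.2 ^ 2 / 2)
      (fun n => ((continuous_primitive_truncPow n 1).measurable.comp
        measurable_snd).aestronglyMeasurable)
      ((integrable_residual_sq h hgr).div_const 2) (fun n => ?_) ?_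
    · filter_upwards [h.ae_nonneg] with x hx
      rw [Real.norm_of_nonneg (primitive_truncPow_nonneg (Nat.cast_nonneg n) 1 hx)]
      refine (primitive_truncPow_le (Nat.cast_nonneg n) 1 hx).trans (le_of_eq ?_)
      norm_num
    · filter_upwards [h.ae_nonneg] with x hx
      have := tendsto_primitive_truncPow 1 hx
      norm_num at this
      exact this
  have h3 := fun n : ℕ => integral_primitive_mul hlam hG hG3 h hgr (continuous_truncPow n 1)
    (abs_truncPow_le (Nat.cast_nonneg (α := ℝ) n) 1)
  simp_rw [h3] at h1
  have h5 := (h4.add (h2.mul_const (∫ x, (numWaiting x : ℝ) ∂ν))).const_mul lam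
  rw [tendsto_nhds_unique h1 h5, integral_div, integral_div]
  rfl

/-- The second moment of the workload. -/
lemma integral_workSq (hstab : lam * moment G 1 < 1) :
    ∫ x, workSq G (numWaiting x) x.2 ∂ν =
      2 * meanWork lam G ^ 2 + lam * moment G 3 / (3 * (1 - lam * moment G 1)) := by
  obtain ⟨s, hs, h0⟩ : ∃ s : ℕ → ℝ, (∀ n, 0 < s n) ∧ Tendsto s atTop (nhds 0) :=
    ⟨fun n => 1 / ((n : ℝ) + 1), fun n => by positivity, tendsto_one_div_add_atTop_nhds_zero_nat⟩
  have iV := integrable_workSq hlam hG hG3 hstab h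
  have hmean : ∫ x, workMean G (numWaiting x) x.2 ∂ν = meanWork lam G := by
    rw [← integral_numWaiting hlam hG hG3 h hgr hstab, ← integral_const_mul,
      ← integral_add (integrable_residual h hgr) ((integrable_numWaiting h hgr).const_mul _)]
    rfl
  have h1 : Tendsto (fun n => ∫ x, (workExp G (s n) (numWaiting x) x.2 - 1 +
      s n * workMean G (numWaiting x) x.2) / s n ^ 2 ∂ν) atTop
      (nhds (∫ x, workSq G (numWaiting x) x.2 / 2 ∂ν)) := by
    refine tendsto_integral_of_dominated_convergence (fun x => workSq G (numWaiting x) x.2 / 2)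
      (fun n => (integrable_quotient hlam hG hG3 hstab h (hs n)).1.aestronglyMeasurable)
      (iV.div_const 2) (fun n => ?_) ?_
    · filter_upwards [h.ae_nonneg] with x hx
      have := quotient_bounds hG hG3 (hs n) (numWaiting x) hx
      rw [Real.norm_of_nonneg this.1]
      exact this.2
    · filter_upwards [h.ae_nonneg] with x hx
      exact tendsto_workExp hG hG3 hs h0 _ hx
  have h2 := fun n => (integrable_quotient hlam hG hG3 hstab h (hs n)).2
  simp_rw [h2, hmean] at h1
  have h3 := tendsto_nhds_unique h1 (tendsto_second_order hlam hG hG3 hstab h hs h0)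
  rw [integral_div] at h3
  have h4 : 1 - lam * moment G 1 ≠ 0 := by linarith
  field_simp at h3 ⊢
  linarith

/-- The second moment of the workload in terms of the second moments of the state. -/
lemma integral_workSq_eq : ∫ x, workSq G (numWaiting x) x.2 ∂ν =
    (∫ x, x.2 ^ 2 ∂ν) + 2 * moment G 1 * (∫ x, x.2 * (numWaiting x : ℝ) ∂ν) +
      moment G 1 ^ 2 * (∫ x, (numWaiting x : ℝ) ^ 2 ∂ν) +
      (moment G 2 - moment G 1 ^ 2) * ∫ x, (numWaiting x : ℝ) ∂ν := by
  have e : ∀ x : ℕ × ℝ, workSq G (numWaiting x) x.2 =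
      ((x.2 ^ 2 + 2 * moment G 1 * (x.2 * (numWaiting x : ℝ))) +
      moment G 1 ^ 2 * (numWaiting x : ℝ) ^ 2) +
      (moment G 2 - moment G 1 ^ 2) * (numWaiting x : ℝ) := by
    intro x; unfold workSq workMean; ring
  have i1 := integrable_residual_sq h hgr
  have i2 := (integrable_residual_mul h hgr).const_mul (2 * moment G 1)
  have i3 := (integrable_numWaiting_sq h hgr).const_mul (moment G 1 ^ 2)
  have i4 := (integrable_numWaiting h hgr).const_mul (moment G 2 - moment G 1 ^ 2)
  have i12 : Integrable (fun x : ℕ × ℝ => x.2 ^ 2 +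
      2 * moment G 1 * (x.2 * (numWaiting x : ℝ))) ν := i1.add i2
  have i123 : Integrable (fun x : ℕ × ℝ => x.2 ^ 2 + 2 * moment G 1 * (x.2 * (numWaiting x : ℝ)) +
      moment G 1 ^ 2 * (numWaiting x : ℝ) ^ 2) ν := i12.add i3
  rw [integral_congr_ae (Eventually.of_forall e), integral_add i123 i4,
    integral_add i12 i3, integral_add i1 i2]
  simp only [integral_const_mul]

omit hlam hG hG3 in
/-- The number in the system is the number waiting, plus one while the server is busy. -/
lemma integrable_number : Integrable (fun x : ℕ × ℝ => (x.1 : ℝ)) ν ∧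
    Integrable (fun x : ℕ × ℝ => (x.1 : ℝ) ^ 2) ν ∧
    ∫ x, (x.1 : ℝ) ∂ν = (∫ x, (numWaiting x : ℝ) ∂ν) + ∫ x, busy x ∂ν ∧
    ∫ x, (x.1 : ℝ) ^ 2 ∂ν = (∫ x, (numWaiting x : ℝ) ^ 2 ∂ν) +
      2 * (∫ x, (numWaiting x : ℝ) ∂ν) + ∫ x, busy x ∂ν := by
  have i1 := integrable_numWaiting h hgr
  have i2 := integrable_numWaiting_sq h hgr
  have i3 := integrable_busy h
  have e1 : (fun x : ℕ × ℝ => (x.1 : ℝ)) =ᵐ[ν] fun x => (numWaiting x : ℝ) + busy x := by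
    filter_upwards [h.ae_cases] with x hx
    rcases hx with ⟨h0, h1⟩ | ⟨h0, h1, h2⟩
    · simp [busy, h0, h1]
    · simp [busy, h0, h1, h2]
  have e2 : (fun x : ℕ × ℝ => (x.1 : ℝ) ^ 2) =ᵐ[ν] fun x =>
      ((numWaiting x : ℝ) ^ 2 + 2 * (numWaiting x : ℝ)) + busy x := by
    filter_upwards [h.ae_cases] with x hx
    rcases hx with ⟨h0, h1⟩ | ⟨h0, h1, h2⟩
    · simp only [busy, h0, h1, if_true]; ring
    · simp [busy, h0, h1, h2]
  refine ⟨(i1.add i3).congr e1.symm, ((i2.add (i1.const_mul 2)).add i3).congr e2.symm, ?_, ?_⟩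
  · rw [integral_congr_ae e1, integral_add i1 i3]
  · have i12 : Integrable (fun x : ℕ × ℝ => (numWaiting x : ℝ) ^ 2 + 2 * (numWaiting x : ℝ)) ν :=
      i2.add (i1.const_mul 2)
    rw [integral_congr_ae e2, integral_add i12 i3,
      integral_add i2 (i1.const_mul 2), integral_const_mul]

end

/-! ### Central moments of the arrival count -/

section Poisson

variable {lam : ℝ} (hlam : 0 < lam)

lemma cast_descFactorial_succ (n k : ℕ) :
    (n.descFactorial (k + 1) : ℝ) = ((n : ℝ) - k) * n.descFactorial k := by
  rw [Nat.descFactorial_succ, Nat.cast_mul]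
  rcases le_or_gt k n with hk | hk
  · rw [Nat.cast_sub hk]
  · rw [Nat.descFactorial_eq_zero_iff_lt.mpr hk]; simp

lemma centered_sq_eq (n : ℕ) (m : ℝ) : ((n : ℝ) - m) ^ 2 =
    n.descFactorial 2 + (1 - 2 * m) * n.descFactorial 1 + m ^ 2 * n.descFactorial 0 := by
  simp only [cast_descFactorial_succ, Nat.descFactorial_zero]
  push_cast
  ring

lemma centered_pow_six_eq (n : ℕ) (m : ℝ) : ((n : ℝ) - m) ^ 6 =
    n.descFactorial 6 + (15 - 6 * m) * n.descFactorial 5 +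
    (15 * m ^ 2 - 60 * m + 65) * n.descFactorial 4 +
    (-20 * m ^ 3 + 90 * m ^ 2 - 150 * m + 90) * n.descFactorial 3 +
    (15 * m ^ 4 - 60 * m ^ 3 + 105 * m ^ 2 - 90 * m + 31) * n.descFactorial 2 +
    (-6 * m ^ 5 + 15 * m ^ 4 - 20 * m ^ 3 + 15 * m ^ 2 - 6 * m + 1) * n.descFactorial 1 +
    m ^ 6 * n.descFactorial 0 := by
  simp only [cast_descFactorial_succ, Nat.descFactorial_zero]
  push_cast
  ring

include hlam

lemma integral_centered {t : ℝ} (ht : 0 ≤ t) :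
    Integrable (fun ξ => (arrivalCount ξ t : ℝ) - lam * t) (iidLaw (expMeasure lam)) ∧
    ∫ ξ, ((arrivalCount ξ t : ℝ) - lam * t) ∂iidLaw (expMeasure lam) = 0 := by
  have := isProbabilityMeasure_expMeasure hlam
  have h1 := integrable_descFactorial_arrivalCount hlam 1 ht
  simp only [Nat.descFactorial_one, pow_one] at h1
  refine ⟨h1.1.sub (integrable_const _), ?_⟩
  rw [integral_sub h1.1 (integrable_const _), h1.2]
  simp

lemma integral_add_descFactorial {F : (ℕ → ℝ) → ℝ} {v t : ℝ} (ht : 0 ≤ t)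
    (hF : Integrable F (iidLaw (expMeasure lam)) ∧ ∫ ξ, F ξ ∂iidLaw (expMeasure lam) = v)
    (c : ℝ) (k : ℕ) :
    Integrable (fun ξ => F ξ + c * ((arrivalCount ξ t).descFactorial k : ℝ))
      (iidLaw (expMeasure lam)) ∧
    ∫ ξ, (F ξ + c * ((arrivalCount ξ t).descFactorial k : ℝ)) ∂iidLaw (expMeasure lam) =
      v + c * (lam * t) ^ k := by
  obtain ⟨h1, h2⟩ := integrable_descFactorial_arrivalCount hlam k ht
  refine ⟨hF.1.add (h1.const_mul c), ?_⟩
  rw [integral_add hF.1 (h1.const_mul c), integral_const_mul, h2, hF.2]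

lemma integral_centered_sq {t : ℝ} (ht : 0 ≤ t) :
    Integrable (fun ξ => ((arrivalCount ξ t : ℝ) - lam * t) ^ 2) (iidLaw (expMeasure lam)) ∧
    ∫ ξ, ((arrivalCount ξ t : ℝ) - lam * t) ^ 2 ∂iidLaw (expMeasure lam) = lam * t := by
  have h2 := integrable_descFactorial_arrivalCount hlam 2 ht
  have h1 := integral_add_descFactorial hlam ht h2 (1 - 2 * (lam * t)) 1
  have h0 := integral_add_descFactorial hlam ht h1 ((lam * t) ^ 2) 0
  simp_rw [centered_sq_eq _ (lam * t)]
  exact ⟨h0.1, h0.2.trans (by ring)⟩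

/-- The sixth central moment of the Poisson distribution is of order `t ^ 3`. -/
lemma integral_centered_pow_six {t : ℝ} (ht : 0 ≤ t) :
    Integrable (fun ξ => ((arrivalCount ξ t : ℝ) - lam * t) ^ 6) (iidLaw (expMeasure lam)) ∧
    ∫ ξ, ((arrivalCount ξ t : ℝ) - lam * t) ^ 6 ∂iidLaw (expMeasure lam) =
      15 * (lam * t) ^ 3 + 25 * (lam * t) ^ 2 + lam * t := by
  have h6 := integrable_descFactorial_arrivalCount hlam 6 ht
  have h0 := fun c5 c4 c3 c2 c1 c0 => integral_add_descFactorial hlam ht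
    (integral_add_descFactorial hlam ht (integral_add_descFactorial hlam ht
    (integral_add_descFactorial hlam ht (integral_add_descFactorial hlam ht
    (integral_add_descFactorial hlam ht h6 c5 5) c4 4) c3 3) c2 2) c1 1) c0 0
  simp_rw [centered_pow_six_eq _ (lam * t)]
  exact ⟨(h0 _ _ _ _ _ _).1, (h0 _ _ _ _ _ _).2.trans (by ring)⟩

end Poisson

/-! ### Growth of the weighted state -/

/-- The quadratic function of the state by which test functions are bounded. -/
def growth (x : ℕ × ℝ) : ℝ := 1 + (numWaiting x : ℝ) ^ 2 + x.2 ^ 2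

lemma growth_nonneg (x : ℕ × ℝ) : 0 ≤ growth x := by unfold growth; positivity

lemma measurable_growth : Measurable growth :=
  measurable_uncurry_nat (f := fun y r => 1 + (y : ℝ) ^ 2 + r ^ 2) (fun y => by fun_prop)
    measurable_numWaiting measurable_snd

/-- A quadratic function of the initial state. -/
def initialGrowth (x : ℕ × ℝ) : ℝ := 1 + (x.1 : ℝ) ^ 2 + x.2 ^ 2

lemma initialGrowth_nonneg (x : ℕ × ℝ) : 0 ≤ initialGrowth x := by unfold initialGrowth; positivity

lemma measurable_initialGrowth : Measurable initialGrowth :=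
  measurable_uncurry_nat (f := fun y r => 1 + (y : ℝ) ^ 2 + r ^ 2) (fun y => by fun_prop)
    measurable_fst measurable_snd

section Growth

variable {lam : ℝ} (hlam : 0 < lam) {G : Measure ℝ} [IsProbabilityMeasure G]
  (hG : ∀ᵐ x ∂G, 0 ≤ x) (hG2 : Integrable (fun x : ℝ => x ^ 2) G)
  {ν : Measure (ℕ × ℝ)} [IsProbabilityMeasure ν] (h : StationaryLaw lam G ν)
  (hgr : Integrable growth ν)

include h hgr in
lemma integrable_initialGrowth : Integrable initialGrowth ν := by
  have h1 : Integrable (fun x : ℕ × ℝ => 1 + (x.1 : ℝ) ^ 2) ν :=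
    (integrable_const 1).add (integrable_number h hgr).2.1
  exact h1.add (integrable_residual_sq h hgr)

include hlam hG2 h hgr in
lemma integrable_envelope_stationary (p : ℕ) {t : ℝ} (ht : 0 ≤ t) :
    Integrable (fun z : (ℕ × ℝ) × ((ℕ → ℝ) × (ℕ → ℝ)) => envelope z.1.1 z.1.2 z.2.1 z.2.2 t p)
      (ν.prod (inputLaw lam G)) := by
  have := isProbabilityMeasure_expMeasure hlam
  obtain ⟨K, hK, hle⟩ := lintegral_envelope_le hlam G hG2 p ht
  have hm : Measurable fun z : (ℕ × ℝ) × ((ℕ → ℝ) × (ℕ → ℝ)) =>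
      envelope z.1.1 z.1.2 z.2.1 z.2.2 t p :=
    measurable_envelope (by fun_prop) (by fun_prop) (by fun_prop) (by fun_prop) t p
  refine ⟨hm.aestronglyMeasurable, ?_⟩
  have h0 : ∀ z : (ℕ × ℝ) × ((ℕ → ℝ) × (ℕ → ℝ)), 0 ≤ envelope z.1.1 z.1.2 z.2.1 z.2.2 t p :=
    fun z => envelope_nonneg _ _ _ _ _ _
  have hI : ∫⁻ x, ENNReal.ofReal (initialGrowth x) ∂ν < ∞ :=
    (hasFiniteIntegral_iff_ofReal (Eventually.of_forall initialGrowth_nonneg)).mp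
      (integrable_initialGrowth h hgr).2
  have hle' : ∫⁻ x, ∫⁻ ω, ENNReal.ofReal (envelope x.1 x.2 ω.1 ω.2 t p) ∂inputLaw lam G ∂ν ≤
      K * ∫⁻ x, ENNReal.ofReal (initialGrowth x) ∂ν := by
    rw [← lintegral_const_mul _ measurable_initialGrowth.ennreal_ofReal]
    exact lintegral_mono fun x => hle x.1 x.2
  rw [hasFiniteIntegral_iff_ofReal (Eventually.of_forall h0),
    lintegral_prod _ hm.ennreal_ofReal.aemeasurable]
  exact hle'.trans_lt (ENNReal.mul_lt_top hK hI)

include hlam hG hG2 h hgr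

/-- A weight depending on the arrivals only can be separated from the growth of the state, at the
cost of two powers of the arrival count: `growth` is dominated by an envelope, and the service times
and the initial state are independent of the arrivals. -/
lemma integral_mul_growth_le : ∃ K, 0 ≤ K ∧ ∀ (t : ℝ) (W : (ℕ → ℝ) → ℝ), 0 ≤ t → Measurable W →
    (∀ ξ, 0 ≤ W ξ) →
    Integrable (fun ξ => W ξ * (1 + (arrivalCount ξ t : ℝ)) ^ 2) (iidLaw (expMeasure lam)) →
    Integrable (fun p => W p.2.1 * growth (stateAt t p)) (ν.prod (inputLaw lam G)) ∧
    ∫ p, W p.2.1 * growth (stateAt t p) ∂(ν.prod (inputLaw lam G)) ≤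
      K * ∫ ξ, W ξ * (1 + (arrivalCount ξ t : ℝ)) ^ 2 ∂iidLaw (expMeasure lam) := by
  have := isProbabilityMeasure_expMeasure hlam
  have hg2 : 0 ≤ moment G 2 := integral_nonneg fun x => sq_nonneg x
  have hD := integrable_initialGrowth h hgr
  refine ⟨(2 + 2 * moment G 2) * ∫ x, initialGrowth x ∂ν,
    mul_nonneg (by positivity) (integral_nonneg initialGrowth_nonneg), fun t W ht hW hW0 hi => ?_⟩
  have hmA : Measurable fun ξ : ℕ → ℝ => (arrivalCount ξ t : ℝ) :=
    measurable_from_nat.comp (measurable_arrivalCount measurable_id measurable_const)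
  have hm : Measurable fun p : (ℕ × ℝ) × ((ℕ → ℝ) × (ℕ → ℝ)) => W p.2.1 * growth (stateAt t p) :=
    (hW.comp (measurable_fst.comp measurable_snd)).mul
      (measurable_growth.comp (measurable_stateAt t))
  have h0 : ∀ p : (ℕ × ℝ) × ((ℕ → ℝ) × (ℕ → ℝ)), 0 ≤ W p.2.1 * growth (stateAt t p) :=
    fun p => mul_nonneg (hW0 _) (growth_nonneg _)
  have h0' : ∀ ξ : ℕ → ℝ, 0 ≤ W ξ * (1 + (arrivalCount ξ t : ℝ)) ^ 2 := fun ξ =>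
    mul_nonneg (hW0 ξ) (sq_nonneg _)
  have h0i : 0 ≤ ∫ ξ, W ξ * (1 + (arrivalCount ξ t : ℝ)) ^ 2 ∂iidLaw (expMeasure lam) :=
    integral_nonneg h0'
  -- the bound from a fixed initial state, integrated over the service times
  have hS : ∀ x : ℕ × ℝ, (x.1 = 0 → x.2 = 0) → (0 < x.1 → 0 < x.2) → ∀ ξ, RegularArrivals ξ →
      ∫⁻ S, ENNReal.ofReal (W ξ * growth (stateAt t (x, (ξ, S)))) ∂iidLaw G ≤
        ENNReal.ofReal ((2 + 2 * moment G 2) * initialGrowth x) *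
          ENNReal.ofReal (W ξ * (1 + (arrivalCount ξ t : ℝ)) ^ 2) := by
    intro x hx1 hx2 ξ hξ
    set N := arrivalCount ξ t with hN
    obtain ⟨hi, he⟩ := integrable_sum_sq G hG2 (x.1 + N)
    have hiS : Integrable (fun S : ℕ → ℝ => W ξ * (2 * (1 + N) ^ 2 * initialGrowth x +
        ∑ j ∈ Finset.range (x.1 + N), S j ^ 2)) (iidLaw G) :=
      ((integrable_const _).add hi).const_mul _
    have hN0 : (0 : ℝ) ≤ N := Nat.cast_nonneg _
    have hq0 : (0 : ℝ) ≤ x.1 := Nat.cast_nonneg _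
    have hD0 := initialGrowth_nonneg x
    calc ∫⁻ S, ENNReal.ofReal (W ξ * growth (stateAt t (x, (ξ, S)))) ∂iidLaw G
        ≤ ∫⁻ S, ENNReal.ofReal (W ξ * (2 * (1 + N) ^ 2 * initialGrowth x +
            ∑ j ∈ Finset.range (x.1 + N), S j ^ 2)) ∂iidLaw G := by
          refine lintegral_mono_ae ?_
          filter_upwards [hξ.ae_goodPath hG hx1 hx2] with S hp
          refine ENNReal.ofReal_le_ofReal (mul_le_mul_of_nonneg_left ?_ (hW0 ξ))
          obtain ⟨b1, b2, b3⟩ := hp.state_bound ht le_rfl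
          have b1' : (numWaiting (stateAt t (x, (ξ, S))) : ℝ) ≤ x.1 + N := by
            have : numWaiting (stateAt t (x, (ξ, S))) ≤ x.1 + N := b1
            exact_mod_cast this
          have b4 : (numWaiting (stateAt t (x, (ξ, S))) : ℝ) ^ 2 ≤ (x.1 + N) ^ 2 :=
            pow_le_pow_left₀ (Nat.cast_nonneg _) b1' 2
          have b5 : (stateAt t (x, (ξ, S))).2 ^ 2 ≤
            x.2 ^ 2 + ∑ j ∈ Finset.range (x.1 + N), S j ^ 2 := b3
          unfold growth
          have b6 : 1 + ((x.1 : ℝ) + N) ^ 2 + x.2 ^ 2 ≤ 2 * (1 + N) ^ 2 * initialGrowth x := by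
            unfold initialGrowth
            nlinarith [sq_nonneg ((x.1 : ℝ) - N), mul_nonneg hN0 (sq_nonneg (x.1 : ℝ)),
              mul_nonneg (sq_nonneg (N : ℝ)) (sq_nonneg (x.1 : ℝ)), mul_nonneg hN0 (sq_nonneg x.2),
              mul_nonneg (sq_nonneg (N : ℝ)) (sq_nonneg x.2), sq_nonneg x.2]
          linarith
      _ = ENNReal.ofReal (W ξ * (2 * (1 + N) ^ 2 * initialGrowth x + (x.1 + N : ℕ) * moment G 2)) := by
          rw [← ofReal_integral_eq_lintegral_ofReal hiS (Eventually.of_forall fun S =>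
            mul_nonneg (hW0 ξ) (add_nonneg (by positivity)
              (Finset.sum_nonneg fun j _ => sq_nonneg _))), integral_const_mul,
            integral_add (integrable_const _) hi, he]
          simp
      _ ≤ ENNReal.ofReal ((2 + 2 * moment G 2) * initialGrowth x * (W ξ * (1 + (N : ℝ)) ^ 2)) := by
          refine ENNReal.ofReal_le_ofReal ?_
          have b7 : ((x.1 + N : ℕ) : ℝ) ≤ 2 * (1 + N) ^ 2 * initialGrowth x := by
            push_cast
            have c1 : (x.1 : ℝ) ≤ initialGrowth x := by
              unfold initialGrowth; nlinarith [sq_nonneg ((x.1 : ℝ) - 1), sq_nonneg x.2]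
            have c2 : 1 ≤ initialGrowth x := by
              unfold initialGrowth; nlinarith [sq_nonneg (x.1 : ℝ), sq_nonneg x.2]
            have c3 : (1 : ℝ) ≤ (1 + N) ^ 2 := by nlinarith
            have c4 : (N : ℝ) ≤ (1 + N) ^ 2 := by nlinarith
            nlinarith [mul_le_mul c3 c1 hq0 (by positivity), mul_le_mul c4 c2 zero_le_one (by positivity)]
          have b8 := mul_le_mul_of_nonneg_right b7 hg2
          have := mul_le_mul_of_nonneg_left b8 (hW0 ξ)
          nlinarith
      _ = _ := ENNReal.ofReal_mul (by positivity)
  have hle : ∫⁻ p, ENNReal.ofReal (W p.2.1 * growth (stateAt t p)) ∂(ν.prod (inputLaw lam G)) ≤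
      ENNReal.ofReal ((2 + 2 * moment G 2) * (∫ x, initialGrowth x ∂ν) *
        ∫ ξ, W ξ * (1 + (arrivalCount ξ t : ℝ)) ^ 2 ∂iidLaw (expMeasure lam)) := by
    rw [lintegral_prod _ hm.ennreal_ofReal.aemeasurable]
    calc _ ≤ ∫⁻ x, ENNReal.ofReal ((2 + 2 * moment G 2) * initialGrowth x) *
          ENNReal.ofReal (∫ ξ, W ξ * (1 + (arrivalCount ξ t : ℝ)) ^ 2
            ∂iidLaw (expMeasure lam)) ∂ν := by
          refine lintegral_mono_ae ?_
          filter_upwards [h.consistent] with x hx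
          have hmx : Measurable fun w : (ℕ → ℝ) × (ℕ → ℝ) =>
              ENNReal.ofReal (W w.1 * growth (stateAt t (x, w))) :=
            (hm.comp measurable_prodMk_left).ennreal_ofReal
          rw [lintegral_prod _ hmx.aemeasurable, ofReal_integral_eq_lintegral_ofReal hi
            (Eventually.of_forall h0'), ← lintegral_const_mul' _ _ ENNReal.ofReal_ne_top]
          refine lintegral_mono_ae ?_
          filter_upwards [ae_regularArrivals hlam] with ξ hξ
          exact hS x hx.1 hx.2 ξ hξ
      _ = _ := by
          rw [lintegral_mul_const' _ _ ENNReal.ofReal_ne_top,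
            ← ofReal_integral_eq_lintegral_ofReal (hD.const_mul _) (Eventually.of_forall fun x =>
              mul_nonneg (by positivity) (initialGrowth_nonneg x)), integral_const_mul,
            ← ENNReal.ofReal_mul (mul_nonneg (by positivity) (integral_nonneg initialGrowth_nonneg))]
  have hint : Integrable (fun p => W p.2.1 * growth (stateAt t p)) (ν.prod (inputLaw lam G)) := by
    refine ⟨hm.aestronglyMeasurable, ?_⟩
    rw [hasFiniteIntegral_iff_ofReal (Eventually.of_forall h0)]
    exact hle.trans_lt ENNReal.ofReal_lt_top
  refine ⟨hint, ?_⟩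
  rw [← ofReal_integral_eq_lintegral_ofReal hint (Eventually.of_forall h0)] at hle
  exact (ENNReal.ofReal_le_ofReal_iff (mul_nonneg (mul_nonneg (by positivity)
    (integral_nonneg initialGrowth_nonneg)) h0i)).mp hle

end Growth

/-! ### Long-run averages -/

section Cesaro

variable {lam : ℝ} (hlam : 0 < lam) {G : Measure ℝ} [IsProbabilityMeasure G]
  (hG : ∀ᵐ x ∂G, 0 ≤ x) (hG2 : Integrable (fun x : ℝ => x ^ 2) G)
  {ν : Measure (ℕ × ℝ)} [IsProbabilityMeasure ν] (h : StationaryLaw lam G ν)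
  (hgr : Integrable growth ν)

include h in
lemma StationaryLaw.ae_stateAt {p : ℕ × ℝ → Prop} (hp : ∀ᵐ x ∂ν, p x) {t : ℝ} (ht : 0 ≤ t) :
    ∀ᵐ z ∂ν.prod (inputLaw lam G), p (stateAt t z) := by
  rw [← h.invariant t ht] at hp
  exact ae_of_ae_map (measurable_stateAt t).aemeasurable hp

lemma measurable_centered (lam t : ℝ) :
    Measurable fun ξ : ℕ → ℝ => (arrivalCount ξ t : ℝ) - lam * t :=
  (measurable_from_nat.comp (measurable_arrivalCount measurable_id measurable_const)).sub_const _

include hlam hG hG2 h hgr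

/-- `E[|A t - lam t| growth(X t)] = o(t)`, where the state `X t` has second moments only. Where
`|A t - lam t| ≤ ε t` the bound is `ε t E[growth]`, by stationarity; the contribution of the
complement is bounded by the sixth central moment of `A t`. -/
lemma tendsto_weighted_growth :
    (∀ t, 0 ≤ t → Integrable (fun p : (ℕ × ℝ) × ((ℕ → ℝ) × (ℕ → ℝ)) =>
      |(arrivalCount p.2.1 t : ℝ) - lam * t| * growth (stateAt t p)) (ν.prod (inputLaw lam G))) ∧
    Tendsto (fun t => (∫ p, |(arrivalCount p.2.1 t : ℝ) - lam * t| * growth (stateAt t p)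
      ∂(ν.prod (inputLaw lam G))) / t) atTop (nhds 0) := by
  have := isProbabilityMeasure_expMeasure hlam
  obtain ⟨K, hK, hle⟩ := integral_mul_growth_le hlam hG hG2 h hgr
  set E := ∫ x, growth x ∂ν with hE
  have hE0 : 0 ≤ E := integral_nonneg growth_nonneg
  -- a bound for each level `ε`, splitting according to whether the centred count exceeds `ε t`
  have key : ∀ ε t : ℝ, 0 < ε → 1 ≤ ε * t → 1 ≤ t →
      Integrable (fun p : (ℕ × ℝ) × ((ℕ → ℝ) × (ℕ → ℝ)) =>
        |(arrivalCount p.2.1 t : ℝ) - lam * t| * growth (stateAt t p)) (ν.prod (inputLaw lam G)) ∧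
      ∫ p, |(arrivalCount p.2.1 t : ℝ) - lam * t| * growth (stateAt t p)
        ∂(ν.prod (inputLaw lam G)) ≤ ε * t * E +
          K * ((2 + lam / ε) ^ 2 * (15 * lam ^ 3 + 25 * lam ^ 2 + lam) / ε ^ 3) := by
    intro ε t hε hεt ht1
    have ht : 0 ≤ t := by linarith
    set W : (ℕ → ℝ) → ℝ := fun ξ => if ε * t < |(arrivalCount ξ t : ℝ) - lam * t| then
      |(arrivalCount ξ t : ℝ) - lam * t| else 0 with hW
    have hWm : Measurable W :=
      Measurable.ite (measurableSet_lt measurable_const (measurable_centered lam t).abs)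
        (measurable_centered lam t).abs measurable_const
    have hW0 : ∀ ξ, 0 ≤ W ξ := fun ξ => by
      rw [hW]; dsimp only; split_ifs
      · exact abs_nonneg _
      · exact le_rfl
    have h6 := integral_centered_pow_six hlam ht
    have hWle : ∀ ξ, W ξ * (1 + (arrivalCount ξ t : ℝ)) ^ 2 ≤
        (2 + lam / ε) ^ 2 / (ε * t) ^ 3 * ((arrivalCount ξ t : ℝ) - lam * t) ^ 6 := by
      intro ξ
      rw [hW]; dsimp only
      set M := (arrivalCount ξ t : ℝ) - lam * t with hM
      have e6 : M ^ 6 = |M| ^ 3 * |M| ^ 3 := by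
        rw [← pow_add, show 3 + 3 = 6 from rfl]; exact (Even.pow_abs (by decide) M).symm
      split_ifs with hlt
      · have h1 : 1 + (arrivalCount ξ t : ℝ) ≤ (2 + lam / ε) * |M| := by
          have e1 : (arrivalCount ξ t : ℝ) = M + lam / ε * (ε * t) := by
            rw [hM]; field_simp; ring
          have e2 : lam / ε * (ε * t) ≤ lam / ε * |M| := by gcongr
          rw [e1]; linarith [le_abs_self M]
        have h2 : (1 + (arrivalCount ξ t : ℝ)) ^ 2 ≤ ((2 + lam / ε) * |M|) ^ 2 :=
          pow_le_pow_left₀ (by positivity) h1 2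
        have h3 : (ε * t) ^ 3 ≤ |M| ^ 3 := pow_le_pow_left₀ (by positivity) hlt.le 3
        have h4 : 0 < (ε * t) ^ 3 := by positivity
        rw [div_mul_eq_mul_div, le_div_iff₀ h4, e6]
        calc |M| * (1 + (arrivalCount ξ t : ℝ)) ^ 2 * (ε * t) ^ 3
            ≤ |M| * ((2 + lam / ε) * |M|) ^ 2 * |M| ^ 3 := by gcongr
          _ = _ := by ring
      · rw [zero_mul, e6]; positivity
    have hWi : Integrable (fun ξ => W ξ * (1 + (arrivalCount ξ t : ℝ)) ^ 2)
        (iidLaw (expMeasure lam)) := by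
      refine Integrable.mono' (h6.1.const_mul ((2 + lam / ε) ^ 2 / (ε * t) ^ 3)) (hWm.mul ((measurable_const.add
        (measurable_from_nat.comp (measurable_arrivalCount measurable_id
          measurable_const))).pow_const 2)).aestronglyMeasurable
        (Eventually.of_forall fun ξ => ?_)
      rw [Real.norm_of_nonneg (mul_nonneg (hW0 ξ) (sq_nonneg _))]
      exact hWle ξ
    obtain ⟨i1, l1⟩ := hle t W ht hWm hW0 hWi
    have i2 : Integrable (fun p : (ℕ × ℝ) × ((ℕ → ℝ) × (ℕ → ℝ)) => growth (stateAt t p))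
        (ν.prod (inputLaw lam G)) := (h.integrable_stateAt_iff measurable_growth ht).mpr hgr
    have hpt : ∀ p : (ℕ × ℝ) × ((ℕ → ℝ) × (ℕ → ℝ)),
        |(arrivalCount p.2.1 t : ℝ) - lam * t| * growth (stateAt t p) ≤
        ε * t * growth (stateAt t p) + W p.2.1 * growth (stateAt t p) := by
      intro p
      rw [← add_mul]
      refine mul_le_mul_of_nonneg_right ?_ (growth_nonneg _)
      rw [hW]; dsimp only
      split_ifs with hlt
      · linarith
      · linarith
    have i3 : Integrable (fun p : (ℕ × ℝ) × ((ℕ → ℝ) × (ℕ → ℝ)) =>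
        ε * t * growth (stateAt t p) + W p.2.1 * growth (stateAt t p))
        (ν.prod (inputLaw lam G)) := (i2.const_mul _).add i1
    have i4 : Integrable (fun p : (ℕ × ℝ) × ((ℕ → ℝ) × (ℕ → ℝ)) =>
        |(arrivalCount p.2.1 t : ℝ) - lam * t| * growth (stateAt t p))
        (ν.prod (inputLaw lam G)) := by
      refine Integrable.mono' i3 ?_ (Eventually.of_forall fun p => ?_)
      · have hc : Measurable fun p : (ℕ × ℝ) × ((ℕ → ℝ) × (ℕ → ℝ)) =>
            |(arrivalCount p.2.1 t : ℝ) - lam * t| :=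
          ((measurable_centered lam t).comp (measurable_fst.comp measurable_snd)).abs
        exact (hc.mul (measurable_growth.comp (measurable_stateAt t))).aestronglyMeasurable
      · rw [Real.norm_of_nonneg (mul_nonneg (abs_nonneg _) (growth_nonneg _))]
        exact hpt p
    refine ⟨i4, (integral_mono i4 i3 hpt).trans ?_⟩
    rw [integral_add (i2.const_mul _) i1, integral_const_mul,
      h.integral_stateAt measurable_growth ht, ← hE]
    have l2 : ∫ ξ, W ξ * (1 + (arrivalCount ξ t : ℝ)) ^ 2 ∂iidLaw (expMeasure lam) ≤
        (2 + lam / ε) ^ 2 * (15 * lam ^ 3 + 25 * lam ^ 2 + lam) / ε ^ 3 := by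
      refine (integral_mono hWi (h6.1.const_mul _) hWle).trans ?_
      rw [integral_const_mul, h6.2]
      have h7 : 15 * (lam * t) ^ 3 + 25 * (lam * t) ^ 2 + lam * t ≤
          (15 * lam ^ 3 + 25 * lam ^ 2 + lam) * t ^ 3 := by
        have a1 : t ^ 2 ≤ t ^ 3 := pow_le_pow_right₀ ht1 (by norm_num)
        have a2 : t ≤ t ^ 3 := le_self_pow₀ ht1 (by norm_num)
        have a3 : lam ^ 2 * t ^ 2 ≤ lam ^ 2 * t ^ 3 := by gcongr
        have a4 : lam * t ≤ lam * t ^ 3 := by gcongr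
        nlinarith
      calc (2 + lam / ε) ^ 2 / (ε * t) ^ 3 * (15 * (lam * t) ^ 3 + 25 * (lam * t) ^ 2 + lam * t)
          ≤ (2 + lam / ε) ^ 2 / (ε * t) ^ 3 * ((15 * lam ^ 3 + 25 * lam ^ 2 + lam) * t ^ 3) := by
            gcongr
        _ = _ := by
            have : t ≠ 0 := by linarith
            field_simp
    linarith [mul_le_mul_of_nonneg_left l2 hK]
  refine ⟨fun t ht => ?_, ?_⟩
  · -- for small `t` the bound at a fixed level does not apply; a cruder weight suffices
    have h6 := lintegral_one_add_arrivalCount_pow_lt_top hlam 3 ht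
    have hmA : Measurable fun ξ : ℕ → ℝ => (arrivalCount ξ t : ℝ) :=
      measurable_from_nat.comp (measurable_arrivalCount measurable_id measurable_const)
    have i3 : Integrable (fun ξ => (1 + (arrivalCount ξ t : ℝ)) ^ 3) (iidLaw (expMeasure lam)) := by
      refine ⟨((measurable_const.add hmA).pow_const 3).aestronglyMeasurable, ?_⟩
      rwa [hasFiniteIntegral_iff_ofReal (Eventually.of_forall fun ξ => by positivity)]
    refine (hle t (fun ξ => |(arrivalCount ξ t : ℝ) - lam * t|) ht (measurable_centered lam t).abs
      (fun ξ => abs_nonneg _) ?_).1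
    refine Integrable.mono' (i3.const_mul (1 + lam * t)) ((measurable_centered lam t).abs.mul
      ((measurable_const.add hmA).pow_const 2)).aestronglyMeasurable
      (Eventually.of_forall fun ξ => ?_)
    rw [Real.norm_of_nonneg (by positivity)]
    have hlt : 0 ≤ lam * t := by positivity
    have hA0 : (0 : ℝ) ≤ arrivalCount ξ t := Nat.cast_nonneg _
    have h1 : |(arrivalCount ξ t : ℝ) - lam * t| ≤ (1 + lam * t) * (1 + arrivalCount ξ t) := by
      rw [abs_le]; constructor <;> nlinarith [mul_nonneg hlt hA0]
    calc _ ≤ (1 + lam * t) * (1 + arrivalCount ξ t) * (1 + (arrivalCount ξ t : ℝ)) ^ 2 := by gcongr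
      _ = _ := by ring
  · rw [Metric.tendsto_atTop]
    intro δ hδ
    set ε := δ / (2 * (E + 1)) with hεdef
    have hε : 0 < ε := by positivity
    set C := K * ((2 + lam / ε) ^ 2 * (15 * lam ^ 3 + 25 * lam ^ 2 + lam) / ε ^ 3) with hC
    have hC0 : 0 ≤ C := by positivity
    refine ⟨max (max 1 (1 / ε)) (4 * C / δ + 1), fun t ht => ?_⟩
    have ht1 : 1 ≤ t := (le_max_left _ _).trans ((le_max_left _ _).trans ht)
    have ht2 : 1 ≤ ε * t := by
      have : 1 / ε ≤ t := (le_max_right _ _).trans ((le_max_left _ _).trans ht)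
      rwa [div_le_iff₀' hε] at this
    have ht3 : 4 * C / δ < t := by linarith [(le_max_right _ _).trans ht]
    obtain ⟨-, hb⟩ := key ε t hε ht2 ht1
    have hI0 : 0 ≤ ∫ p, |(arrivalCount p.2.1 t : ℝ) - lam * t| * growth (stateAt t p)
        ∂(ν.prod (inputLaw lam G)) :=
      integral_nonneg fun p => mul_nonneg (abs_nonneg _) (growth_nonneg _)
    rw [Real.dist_eq, sub_zero, abs_of_nonneg (div_nonneg hI0 (by linarith)),
      div_lt_iff₀ (by linarith)]
    refine hb.trans_lt ?_
    have h1 : ε * E ≤ δ / 2 := by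
      rw [hεdef, div_mul_eq_mul_div, div_le_div_iff₀ (by positivity) two_pos]
      nlinarith
    rw [div_lt_iff₀ hδ] at ht3
    have ht0 : 0 < t := by linarith
    nlinarith [mul_le_mul_of_nonneg_right h1 ht0.le]

variable {f f' : ℕ → ℝ → ℝ} (hf : TestFunction G f f')
include hf

/-- The integrand of Dynkin's formula is integrable over the sample space and `[0, t]` jointly, so
that expectation and time integral can be exchanged. -/
lemma integrable_generatorAt {β : ℕ × ℝ → ℝ} (hβ : Measurable β) {B : ℝ} (hB : ∀ x, |β x| ≤ B)
    {t : ℝ} (ht : 0 ≤ t) :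
    Integrable (fun z : ((ℕ × ℝ) × ((ℕ → ℝ) × (ℕ → ℝ))) × ℝ =>
      generatorAt lam 1 β f f' z.1 z.2)
      ((ν.prod (inputLaw lam G)).prod (volume.restrict (Set.Ioc 0 t))) := by
  have := isProbabilityMeasure_expMeasure hlam
  obtain ⟨C, hC, hb⟩ := hf.growth
  have hB0 : 0 ≤ B := (abs_nonneg _).trans (hB (0, 0))
  have hst := measurable_stateAt_uncurry
  have hA : Measurable fun z : ((ℕ × ℝ) × ((ℕ → ℝ) × (ℕ → ℝ))) × ℝ =>
      (arrivalCount z.1.2.1 z.2 : ℝ) :=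
    measurable_from_nat.comp (measurable_arrivalCount (by fun_prop) (by fun_prop))
  have hβ' : Measurable fun z : ((ℕ × ℝ) × ((ℕ → ℝ) × (ℕ → ℝ))) × ℝ => β z.1.1 :=
    hβ.comp (by fun_prop)
  have hgen : Measurable fun z : ((ℕ × ℝ) × ((ℕ → ℝ) × (ℕ → ℝ))) × ℝ =>
      generator lam f f' (stateAt z.2 z.1) := (measurable_generator lam hf).comp hst
  have hf1 : Measurable fun x : ℕ × ℝ => f (numWaiting x + 1) x.2 - f (numWaiting x) x.2 :=
    (measurable_uncurry_nat hf.measurable measurable_numWaiting_succ measurable_snd).sub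
      (measurable_uncurry_nat hf.measurable measurable_numWaiting measurable_snd)
  have hdel : Measurable fun z : ((ℕ × ℝ) × ((ℕ → ℝ) × (ℕ → ℝ))) × ℝ =>
      f (numWaiting (stateAt z.2 z.1) + 1) (stateAt z.2 z.1).2 -
        f (numWaiting (stateAt z.2 z.1)) (stateAt z.2 z.1).2 := hf1.comp hst
  have hmeas : Measurable fun z : ((ℕ × ℝ) × ((ℕ → ℝ) × (ℕ → ℝ))) × ℝ =>
      generatorAt lam 1 β f f' z.1 z.2 := by
    simp_rw [generatorAt_eq]
    exact ((((hA.sub (measurable_snd.const_mul lam)).const_mul 1).add hβ').mul hgen).add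
      (hdel.const_mul _)
  have henv := (integrable_envelope_stationary hlam hG2 h hgr 3 ht).comp_fst
    (volume.restrict (Set.Ioc 0 t))
  refine Integrable.mono' (henv.const_mul ((6 + 9 * lam) * weightBound lam 1 B t * C))
    hmeas.aestronglyMeasurable ?_
  have hgood : ∀ᵐ z ∂(ν.prod (inputLaw lam G)).prod (volume.restrict (Set.Ioc 0 t)),
      GoodPath z.1.1.1 z.1.1.2 z.1.2.1 z.1.2.2 :=
    Measure.quasiMeasurePreserving_fst.ae (h.ae_goodPath hlam hG)
  have htime : ∀ᵐ z ∂(ν.prod (inputLaw lam G)).prod (volume.restrict (Set.Ioc 0 t)),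
      z.2 ∈ Set.Ioc 0 t :=
    Measure.quasiMeasurePreserving_snd.ae (ae_restrict_mem measurableSet_Ioc)
  filter_upwards [hgood, htime] with z hz hv
  obtain ⟨b1, b2, b3⟩ := hz.state_bound hv.1.le hv.2
  have hA := hz.arrivalCount_mono hv.2
  have hw : weightBound lam 1 (β z.1.1) t ≤ weightBound lam 1 B t := by
    unfold weightBound
    rw [abs_of_nonneg hB0]
    linarith [hB z.1.1]
  have h1 := abs_drift_le (α := 1) (β := β z.1.1) hlam ht hC hb hv.1.le hv.2 hA b1 b2 b3
  have h2 := abs_arrivalJump_le (α := 1) (β := β z.1.1) hlam ht hC hb hv.1.le hv.2 hA b1 b2 b3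
  have hE := envelope_nonneg z.1.1.1 z.1.1.2 z.1.2.1 z.1.2.2 t 3
  have h3 : |generatorAt lam 1 β f f' z.1 z.2| ≤
      (6 + 9 * lam) * weightBound lam 1 (β z.1.1) t * C *
        envelope z.1.1.1 z.1.1.2 z.1.2.1 z.1.2.2 t 3 := by
    unfold generatorAt generatorTerm
    refine (abs_add_le _ _).trans ?_
    rw [abs_mul, abs_of_pos hlam]
    refine (add_le_add h1 (mul_le_mul_of_nonneg_left h2 hlam.le)).trans (le_of_eq ?_)
    ring
  refine h3.trans ?_
  gcongr

end Cesaro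

/-! ### The covariance of the arrival count and the queue length -/

/-- The covariance at time `t` of the queue length with the centred arrival count, increased by a
function `β` of the initial state. With `β` the centred initial queue length this is the covariance
of `Q t` with `A t + Q 0`. -/
def covar (lam : ℝ) (G : Measure ℝ) (ν : Measure (ℕ × ℝ)) (β : ℕ × ℝ → ℝ) (t : ℝ) : ℝ :=
  ∫ p, ((arrivalCount p.2.1 t : ℝ) - lam * t + β p.1) *
    (((stateAt t p).1 : ℝ) - ∫ x, (x.1 : ℝ) ∂ν) ∂(ν.prod (inputLaw lam G))

/-- The solution of Poisson's equation for the queue length: its generator is `- g₁` times the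
centred queue length. -/
def poissonSol (lam : ℝ) (G : Measure ℝ) : ℕ → ℝ → ℝ :=
  quadTest G (1 / (2 * (1 - lam * moment G 1))) (-1 / 2) (moment G 1)

/-- The stationary mean increment of `poissonSol` at an arrival. -/
def meanIncrement (lam : ℝ) (G : Measure ℝ) : ℝ :=
  (2 * moment G 1 * meanWork lam G + moment G 2) / (2 * (1 - lam * moment G 1)) -
    moment G 2 / 2 + moment G 1 ^ 2

section Covariance

variable {lam : ℝ} (hlam : 0 < lam) {G : Measure ℝ} [IsProbabilityMeasure G]
  (hG : ∀ᵐ x ∂G, 0 ≤ x) (hG3 : Integrable (fun x : ℝ => x ^ 3) G)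
  (hg1 : 0 < moment G 1) (hstab : lam * moment G 1 < 1)
  {ν : Measure (ℕ × ℝ)} [IsProbabilityMeasure ν] (h : StationaryLaw lam G ν)
  (hgr : Integrable growth ν)

include hlam

lemma integrable_centered_sq_prod {t : ℝ} (ht : 0 ≤ t) :
    Integrable (fun p : (ℕ × ℝ) × ((ℕ → ℝ) × (ℕ → ℝ)) =>
      ((arrivalCount p.2.1 t : ℝ) - lam * t) ^ 2) (ν.prod (inputLaw lam G)) := by
  have := isProbabilityMeasure_expMeasure hlam
  exact (((integral_centered_sq hlam ht).1.comp_fst (iidLaw G)).comp_snd ν)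

include h hgr

lemma integrable_number_centered_sq {t : ℝ} (ht : 0 ≤ t) (m : ℝ) :
    Integrable (fun p => (((stateAt t p).1 : ℝ) - m) ^ 2) (ν.prod (inputLaw lam G)) ∧
    ∫ p, (((stateAt t p).1 : ℝ) - m) ^ 2 ∂(ν.prod (inputLaw lam G)) =
      ∫ x, ((x.1 : ℝ) - m) ^ 2 ∂ν := by
  have hm : Measurable fun x : ℕ × ℝ => ((x.1 : ℝ) - m) ^ 2 :=
    ((measurable_from_nat.comp measurable_fst).sub_const m).pow_const 2
  obtain ⟨i1, i2, -⟩ := integrable_number h hgr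
  have hi : Integrable (fun x : ℕ × ℝ => ((x.1 : ℝ) - m) ^ 2) ν := by
    have e : ∀ x : ℕ × ℝ, (x.1 : ℝ) ^ 2 - 2 * m * x.1 + m ^ 2 = ((x.1 : ℝ) - m) ^ 2 := by
      intro x; ring
    have hs : Integrable (fun x : ℕ × ℝ => (x.1 : ℝ) ^ 2 - 2 * m * x.1 + m ^ 2) ν :=
      (i2.sub (i1.const_mul (2 * m))).add (integrable_const _)
    exact hs.congr (Eventually.of_forall e)
  exact ⟨(h.integrable_stateAt_iff hm ht).mpr hi, h.integral_stateAt hm ht⟩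

lemma integrable_covar {β : ℕ × ℝ → ℝ} (hβ : Measurable β)
    (hβ2 : Integrable (fun x => β x ^ 2) ν) {t : ℝ} (ht : 0 ≤ t) (m : ℝ) :
    Integrable (fun p : (ℕ × ℝ) × ((ℕ → ℝ) × (ℕ → ℝ)) =>
      ((arrivalCount p.2.1 t : ℝ) - lam * t + β p.1) * (((stateAt t p).1 : ℝ) - m))
      (ν.prod (inputLaw lam G)) := by
  have := isProbabilityMeasure_expMeasure hlam
  have i1 := integrable_centered_sq_prod (G := G) (ν := ν) hlam ht
  have i2 := (integrable_number_centered_sq hlam h hgr ht m).1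
  have i3 : Integrable (fun p : (ℕ × ℝ) × ((ℕ → ℝ) × (ℕ → ℝ)) => β p.1 ^ 2)
      (ν.prod (inputLaw lam G)) := hβ2.comp_fst _
  have hmA : Measurable fun p : (ℕ × ℝ) × ((ℕ → ℝ) × (ℕ → ℝ)) =>
      (arrivalCount p.2.1 t : ℝ) - lam * t :=
    (measurable_centered lam t).comp (measurable_fst.comp measurable_snd)
  have hmQ : Measurable fun p : (ℕ × ℝ) × ((ℕ → ℝ) × (ℕ → ℝ)) => ((stateAt t p).1 : ℝ) - m :=
    (measurable_from_nat.comp (measurable_fst.comp (measurable_stateAt t))).sub_const m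
  have i4 : Integrable (fun p : (ℕ × ℝ) × ((ℕ → ℝ) × (ℕ → ℝ)) =>
      ((arrivalCount p.2.1 t : ℝ) - lam * t) ^ 2 + β p.1 ^ 2 + (((stateAt t p).1 : ℝ) - m) ^ 2)
      (ν.prod (inputLaw lam G)) := (i1.add i3).add i2
  refine Integrable.mono' i4 ((hmA.add (hβ.comp measurable_fst)).mul hmQ).aestronglyMeasurable
    (Eventually.of_forall fun p => ?_)
  rw [Real.norm_eq_abs, abs_le]
  set a := (arrivalCount p.2.1 t : ℝ) - lam * t
  set b := β p.1
  set q := ((stateAt t p).1 : ℝ) - m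
  constructor
  · nlinarith [sq_nonneg (a + q), sq_nonneg (b + q), sq_nonneg (a - b), sq_nonneg (a + b + q),
      sq_nonneg a, sq_nonneg b]
  · nlinarith [sq_nonneg (a - q), sq_nonneg (b - q), sq_nonneg (a - b), sq_nonneg (a + b - q),
      sq_nonneg a, sq_nonneg b]

/-- Changing `β` in mean square changes `covar` little, uniformly in time, because the variance of
the queue length is constant in time. The parameter `η` weighs the two factors in
`|x y| ≤ x ^ 2 / (2 η) + η y ^ 2 / 2`. -/
lemma abs_covar_sub_le {β β' : ℕ × ℝ → ℝ} (hβ : Measurable β) (hβ' : Measurable β')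
    (hβ2 : Integrable (fun x => β x ^ 2) ν) (hβ2' : Integrable (fun x => β' x ^ 2) ν)
    {η : ℝ} (hη : 0 < η) {t : ℝ} (ht : 0 ≤ t) :
    |covar lam G ν β t - covar lam G ν β' t| ≤ (∫ x, (β x - β' x) ^ 2 ∂ν) / (2 * η) +
      η / 2 * ∫ x, ((x.1 : ℝ) - ∫ x, (x.1 : ℝ) ∂ν) ^ 2 ∂ν := by
  have := isProbabilityMeasure_expMeasure hlam
  unfold covar
  set m := ∫ x, (x.1 : ℝ) ∂ν
  obtain ⟨i2, e2⟩ := integrable_number_centered_sq hlam h hgr ht m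
  have hi : Integrable (fun x => (β x - β' x) ^ 2) ν := by
    refine Integrable.mono' ((hβ2.add hβ2').const_mul 2)
      ((hβ.sub hβ').pow_const 2).aestronglyMeasurable (Eventually.of_forall fun x => ?_)
    rw [Real.norm_of_nonneg (sq_nonneg _)]
    simp only [Pi.add_apply]
    nlinarith [sq_nonneg (β x + β' x)]
  have i3 : Integrable (fun p : (ℕ × ℝ) × ((ℕ → ℝ) × (ℕ → ℝ)) => (β p.1 - β' p.1) ^ 2)
      (ν.prod (inputLaw lam G)) := hi.comp_fst _
  have e3 : ∫ p : (ℕ × ℝ) × ((ℕ → ℝ) × (ℕ → ℝ)), (β p.1 - β' p.1) ^ 2 ∂(ν.prod (inputLaw lam G)) =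
      ∫ x, (β x - β' x) ^ 2 ∂ν := by
    rw [integral_fun_fst (μ := ν) (ν := inputLaw lam G) (fun x => (β x - β' x) ^ 2)]
    simp
  rw [← integral_sub (integrable_covar hlam h hgr hβ hβ2 ht m)
    (integrable_covar hlam h hgr hβ' hβ2' ht m), ← e2, ← e3, ← integral_div, ← integral_const_mul,
    ← integral_add (i3.div_const _) (i2.const_mul _), ← Real.norm_eq_abs]
  refine norm_integral_le_of_norm_le ((i3.div_const _).add (i2.const_mul _))
    (Eventually.of_forall fun p => ?_)
  set a := (arrivalCount p.2.1 t : ℝ) - lam * t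
  set q := ((stateAt t p).1 : ℝ) - m
  set d := β p.1 - β' p.1 with hd
  have e : (a + β p.1) * q - (a + β' p.1) * q = d * q := by rw [hd]; ring
  have e4 : d ^ 2 / (2 * η) + η / 2 * q ^ 2 = (d ^ 2 + (η * q) ^ 2) / (2 * η) := by
    field_simp
  rw [e, e4, Real.norm_eq_abs, le_div_iff₀ (by positivity), ← abs_of_pos hη, abs_of_pos hη]
  have : |d * q| * (2 * η) = |2 * (d * (η * q))| := by
    rw [abs_mul 2, abs_mul d (η * q), abs_mul η, abs_mul d q, abs_two, abs_of_pos hη]; ring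
  rw [this, abs_le]
  constructor <;> nlinarith [sq_nonneg (d - η * q), sq_nonneg (d + η * q)]

include hG hG3 hg1 hstab

/-- Poisson's equation. -/
lemma generator_poissonSol : generator lam (poissonSol lam G)
    (quadTestDeriv G (1 / (2 * (1 - lam * moment G 1))) (-1 / 2) (moment G 1)) =ᵐ[ν]
    fun x => -moment G 1 * ((x.1 : ℝ) - ∫ x, (x.1 : ℝ) ∂ν) := by
  filter_upwards [generator_quadTest hlam hG hG3 h hgr (1 / (2 * (1 - lam * moment G 1))) (-1 / 2)
    (moment G 1), h.ae_cases] with x hx hc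
  unfold poissonSol
  rw [hx, (integrable_number h hgr).2.2.1, integral_busy hlam hG hG3 h hgr]
  have hY := integral_numWaiting hlam hG hG3 h hgr hstab
  rw [integral_residual hlam hG hG3 h hgr] at hY
  have hb : (x.1 : ℝ) = numWaiting x + busy x := by
    rcases hc with ⟨h0, h1⟩ | ⟨h0, h1, h2⟩
    · simp [busy, h0, h1]
    · simp [busy, h0, h1, h2]
  have h2 : (1 - lam * moment G 1) ≠ 0 := by linarith
  have e : 1 / (2 * (1 - lam * moment G 1)) * (lam * moment G 2 - 2 * (1 - lam * moment G 1) *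
      (x.2 + moment G 1 * numWaiting x)) =
      meanWork lam G - (x.2 + moment G 1 * numWaiting x) := by
    unfold meanWork; field_simp
  rw [e, ← hY, hb]
  ring

lemma integral_increment_poissonSol :
    Integrable (fun x : ℕ × ℝ => poissonSol lam G (numWaiting x + 1) x.2 -
      poissonSol lam G (numWaiting x) x.2) ν ∧
    ∫ x, (poissonSol lam G (numWaiting x + 1) x.2 - poissonSol lam G (numWaiting x) x.2) ∂ν =
      meanIncrement lam G := by
  have e : ∀ x : ℕ × ℝ, poissonSol lam G (numWaiting x + 1) x.2 -
      poissonSol lam G (numWaiting x) x.2 =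
      ((moment G 2 / (2 * (1 - lam * moment G 1)) - moment G 2 / 2 + moment G 1 ^ 2) +
        (moment G 1 / (1 - lam * moment G 1)) * (x.2 + moment G 1 * (numWaiting x : ℝ))) := by
    intro x
    have h2 : (1 - lam * moment G 1) ≠ 0 := by linarith
    unfold poissonSol quadTest
    rw [workSq_succ, workMean_succ]
    unfold workMean
    push_cast
    field_simp
    ring
  have iR := integrable_residual h hgr
  have iY := (integrable_numWaiting h hgr).const_mul (moment G 1)
  have iU : Integrable (fun x : ℕ × ℝ => x.2 + moment G 1 * (numWaiting x : ℝ)) ν := iR.add iY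
  have i := (integrable_const (μ := ν) (moment G 2 / (2 * (1 - lam * moment G 1)) - moment G 2 / 2 +
    moment G 1 ^ 2)).add (iU.const_mul (moment G 1 / (1 - lam * moment G 1)))
  refine ⟨i.congr (Eventually.of_forall fun x => (e x).symm), ?_⟩
  rw [integral_congr_ae (Eventually.of_forall e), integral_add (integrable_const _)
    (iU.const_mul _), integral_const_mul, integral_add iR iY, integral_const_mul,
    integral_numWaiting hlam hG hG3 h hgr hstab]
  simp only [integral_const, probReal_univ, smul_eq_mul, meanIncrement]
  have h2 : (1 - lam * moment G 1) ≠ 0 := by linarith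
  field_simp
  ring

/-- With the weight `A t - lam t + β`, the expected integrand of Dynkin's formula consists of the
covariance, by Poisson's equation, and of a constant contributed by the simultaneous jumps of the
arrival count and of `poissonSol`. -/
lemma integral_generatorAt_poissonSol {β : ℕ × ℝ → ℝ} (hβ : Measurable β)
    (hβ2 : Integrable (fun x => β x ^ 2) ν) {t : ℝ} (ht : 0 ≤ t) :
    ∫ p, generatorAt lam 1 β (poissonSol lam G)
      (quadTestDeriv G (1 / (2 * (1 - lam * moment G 1))) (-1 / 2) (moment G 1)) p t
      ∂(ν.prod (inputLaw lam G)) =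
      -moment G 1 * covar lam G ν β t + lam * meanIncrement lam G := by
  have hf := testFunction_quadTest hG hG3 (1 / (2 * (1 - lam * moment G 1))) (-1 / 2) (moment G 1)
  have hg := h.ae_stateAt (generator_poissonSol hlam hG hG3 hg1 hstab h hgr) ht
  obtain ⟨i1, e1⟩ := integral_increment_poissonSol hlam hG hG3 hg1 hstab h hgr
  have hf1 : Measurable fun x : ℕ × ℝ => poissonSol lam G (numWaiting x + 1) x.2 -
      poissonSol lam G (numWaiting x) x.2 :=
    (measurable_uncurry_nat hf.measurable measurable_numWaiting_succ measurable_snd).sub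
      (measurable_uncurry_nat hf.measurable measurable_numWaiting measurable_snd)
  have i2 := (h.integrable_stateAt_iff hf1 ht).mpr i1
  have e2 := h.integral_stateAt hf1 ht
  have i3 := integrable_covar hlam h hgr hβ hβ2 ht (∫ x, (x.1 : ℝ) ∂ν)
  have e3 : (fun p => generatorAt lam 1 β (poissonSol lam G)
      (quadTestDeriv G (1 / (2 * (1 - lam * moment G 1))) (-1 / 2) (moment G 1)) p t)
      =ᵐ[ν.prod (inputLaw lam G)] fun p =>
      -moment G 1 * (((arrivalCount p.2.1 t : ℝ) - lam * t + β p.1) *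
        (((stateAt t p).1 : ℝ) - ∫ x, (x.1 : ℝ) ∂ν)) +
      lam * (poissonSol lam G (numWaiting (stateAt t p) + 1) (stateAt t p).2 -
        poissonSol lam G (numWaiting (stateAt t p)) (stateAt t p).2) := by
    filter_upwards [hg] with p hp
    rw [generatorAt_eq, hp]
    ring
  rw [integral_congr_ae e3, integral_add (i3.const_mul _) (i2.const_mul _), integral_const_mul,
    integral_const_mul, e2, e1]
  rfl

/-- The long-run average of `covar`, for bounded `β`: Dynkin's formula for `poissonSol` with weight
`A t - lam t + β`, divided by `t`. The boundary terms vanish in the limit by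
`tendsto_weighted_growth`. -/
theorem tendsto_average_covar {β : ℕ × ℝ → ℝ} (hβ : Measurable β) {B : ℝ} (hB : ∀ x, |β x| ≤ B) :
    (∀ t, 0 ≤ t → IntervalIntegrable (covar lam G ν β) volume 0 t) ∧
    Tendsto (fun t => (∫ v in 0..t, covar lam G ν β v) / t) atTop
      (nhds (lam * meanIncrement lam G / moment G 1)) := by
  have := isProbabilityMeasure_expMeasure hlam
  have hG2 := integrable_pow hG hG3 (k := 2) (by norm_num)
  have hf := testFunction_quadTest hG hG3 (1 / (2 * (1 - lam * moment G 1))) (-1 / 2) (moment G 1)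
  obtain ⟨C, hC, hb⟩ := hf.growth
  have hB0 : 0 ≤ B := (abs_nonneg _).trans (hB (0, 0))
  have hβ2 : Integrable (fun x => β x ^ 2) ν := by
    refine Integrable.mono' (integrable_const (B ^ 2)) (hβ.pow_const 2).aestronglyMeasurable
      (Eventually.of_forall fun x => ?_)
    rw [Real.norm_of_nonneg (sq_nonneg _), ← sq_abs]
    exact pow_le_pow_left₀ (abs_nonneg _) (hB x) 2
  have hhm : Measurable fun x : ℕ × ℝ => poissonSol lam G (numWaiting x) x.2 :=
    measurable_uncurry_nat hf.measurable measurable_numWaiting measurable_snd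
  have hhb : ∀ᵐ x ∂ν, |poissonSol lam G (numWaiting x) x.2| ≤ C * growth x := by
    filter_upwards [h.ae_nonneg] with x hx
    exact (hb _ _ hx).1
  obtain ⟨hwi, hwt⟩ := tendsto_weighted_growth hlam hG hG2 h hgr
  have hgi : ∀ t, 0 ≤ t → Integrable (fun p : (ℕ × ℝ) × ((ℕ → ℝ) × (ℕ → ℝ)) =>
      growth (stateAt t p)) (ν.prod (inputLaw lam G)) := fun t ht =>
    (h.integrable_stateAt_iff measurable_growth ht).mpr hgr
  -- the boundary terms in Dynkin's formula
  have hmA : ∀ t, Measurable fun p : (ℕ × ℝ) × ((ℕ → ℝ) × (ℕ → ℝ)) =>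
      (arrivalCount p.2.1 t : ℝ) - lam * t := fun t =>
    (measurable_centered lam t).comp (measurable_fst.comp measurable_snd)
  have hdom : ∀ t, 0 ≤ t → Integrable (fun p : (ℕ × ℝ) × ((ℕ → ℝ) × (ℕ → ℝ)) =>
      C * (|(arrivalCount p.2.1 t : ℝ) - lam * t| * growth (stateAt t p) +
        B * growth (stateAt t p))) (ν.prod (inputLaw lam G)) := fun t ht =>
    ((hwi t ht).add ((hgi t ht).const_mul B)).const_mul C
  have hle : ∀ t, 0 ≤ t → ∀ᵐ p ∂(ν.prod (inputLaw lam G)),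
      ‖(1 * ((arrivalCount p.2.1 t : ℝ) - lam * t) + β p.1) *
        poissonSol lam G (numWaiting (stateAt t p)) (stateAt t p).2‖ ≤
      C * (|(arrivalCount p.2.1 t : ℝ) - lam * t| * growth (stateAt t p) +
        B * growth (stateAt t p)) := by
    intro t ht
    filter_upwards [h.ae_stateAt hhb ht] with p hp
    rw [norm_mul, one_mul, Real.norm_eq_abs, Real.norm_eq_abs, ← add_mul, mul_left_comm]
    exact mul_le_mul ((abs_add_le _ _).trans (add_le_add le_rfl (hB _))) hp (abs_nonneg _)
      (by positivity)
  have hJ : ∀ t, 0 ≤ t → Integrable (fun p : (ℕ × ℝ) × ((ℕ → ℝ) × (ℕ → ℝ)) =>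
      (1 * ((arrivalCount p.2.1 t : ℝ) - lam * t) + β p.1) *
        poissonSol lam G (numWaiting (stateAt t p)) (stateAt t p).2) (ν.prod (inputLaw lam G)) :=
    fun t ht => Integrable.mono' (hdom t ht) ((((hmA t).const_mul 1).add
      (hβ.comp measurable_fst)).mul (hhm.comp (measurable_stateAt t))).aestronglyMeasurable
      (hle t ht)
  have hJ0 : Integrable (fun x : ℕ × ℝ => β x * poissonSol lam G (numWaiting x) x.2) ν := by
    refine Integrable.mono' (hgr.const_mul (B * C)) (hβ.mul hhm).aestronglyMeasurable ?_
    filter_upwards [hhb] with x hx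
    rw [norm_mul, Real.norm_eq_abs, Real.norm_eq_abs, mul_assoc]
    exact mul_le_mul (hB x) hx (abs_nonneg _) hB0
  have hL := fun t ht => integrable_generatorAt hlam hG hG2 h hgr hf hβ hB (t := t) ht
  have hgb : ∀ v, 0 ≤ v → covar lam G ν β v = (lam * meanIncrement lam G -
      ∫ p, generatorAt lam 1 β (poissonSol lam G)
      (quadTestDeriv G (1 / (2 * (1 - lam * moment G 1))) (-1 / 2) (moment G 1)) p v
      ∂(ν.prod (inputLaw lam G))) / moment G 1 := by
    intro v hv
    rw [integral_generatorAt_poissonSol hlam hG hG3 hg1 hstab h hgr hβ hβ2 hv]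
    field_simp
    ring
  have hgi' : ∀ t, 0 ≤ t → IntervalIntegrable (fun v => ∫ p, generatorAt lam 1 β (poissonSol lam G)
      (quadTestDeriv G (1 / (2 * (1 - lam * moment G 1))) (-1 / 2) (moment G 1)) p v
      ∂(ν.prod (inputLaw lam G))) volume 0 t := by
    intro t ht
    rw [intervalIntegrable_iff_integrableOn_Ioc_of_le ht]
    exact (hL t ht).integral_prod_right
  have hint : ∀ t, 0 ≤ t → IntervalIntegrable (covar lam G ν β) volume 0 t := by
    intro t ht
    refine ((intervalIntegrable_const (c := lam * meanIncrement lam G)).sub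
      (hgi' t ht)).div_const (moment G 1) |>.congr ?_
    intro v hv
    rw [Set.uIoc_of_le ht] at hv
    exact (hgb v hv.1.le).symm
  refine ⟨hint, ?_⟩
  set J : ℝ → ℝ := fun t => ∫ p, (1 * ((arrivalCount p.2.1 t : ℝ) - lam * t) + β p.1) *
    poissonSol lam G (numWaiting (stateAt t p)) (stateAt t p).2 ∂(ν.prod (inputLaw lam G)) with hJdef
  set J0 := ∫ x, β x * poissonSol lam G (numWaiting x) x.2 ∂ν with hJ0def
  have hform : ∀ t, 0 ≤ t → ∫ v in 0..t, covar lam G ν β v =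
      (lam * meanIncrement lam G * t - (J t - J0)) / moment G 1 := by
    intro t ht
    have hd := dynkin_stationary hlam hG hG2 h hf 1 β ht (hJ t ht) hJ0 (hL t ht)
    have e : ∫ v in 0..t, covar lam G ν β v = ∫ v in 0..t, (lam * meanIncrement lam G -
        ∫ p, generatorAt lam 1 β (poissonSol lam G)
        (quadTestDeriv G (1 / (2 * (1 - lam * moment G 1))) (-1 / 2) (moment G 1)) p v
        ∂(ν.prod (inputLaw lam G))) / moment G 1 := by
      refine intervalIntegral.integral_congr fun v hv => ?_
      rw [Set.uIcc_of_le ht] at hv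
      exact hgb v hv.1
    rw [e, intervalIntegral.integral_div, intervalIntegral.integral_sub intervalIntegrable_const
      (hgi' t ht), intervalIntegral.integral_const]
    have hd' : J t = J0 + ∫ v in 0..t, ∫ p, generatorAt lam 1 β (poissonSol lam G)
        (quadTestDeriv G (1 / (2 * (1 - lam * moment G 1))) (-1 / 2) (moment G 1)) p v
        ∂(ν.prod (inputLaw lam G)) := hd
    rw [hd', smul_eq_mul]
    ring
  have hJt : Tendsto (fun t => J t / t) atTop (nhds 0) := by
    have hlim : Tendsto (fun t => C * ((∫ p, |(arrivalCount p.2.1 t : ℝ) - lam * t| *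
        growth (stateAt t p) ∂(ν.prod (inputLaw lam G))) / t + B * (∫ x, growth x ∂ν) / t))
        atTop (nhds 0) := by
      have := (hwt.add (tendsto_const_nhds (x := B * ∫ x, growth x ∂ν) |>.div_atTop
        tendsto_id)).const_mul C
      simpa using this
    refine squeeze_zero_norm' ?_ hlim
    filter_upwards [eventually_gt_atTop 0] with t ht
    rw [norm_div, Real.norm_of_nonneg ht.le, ← add_div, ← mul_div_assoc]
    refine div_le_div_of_nonneg_right ?_ ht.le
    refine (norm_integral_le_of_norm_le (hdom t ht.le) (hle t ht.le)).trans (le_of_eq ?_)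
    rw [integral_const_mul, integral_add (hwi t ht.le) ((hgi t ht.le).const_mul B),
      integral_const_mul, h.integral_stateAt measurable_growth ht.le]
  have h0 : Tendsto (fun t : ℝ => J0 / t) atTop (nhds 0) :=
    tendsto_const_nhds.div_atTop tendsto_id
  have hfin := ((hJt.sub h0).const_sub (lam * meanIncrement lam G)).div_const (moment G 1)
  simp only [sub_zero] at hfin
  refine hfin.congr' ?_
  filter_upwards [eventually_gt_atTop 0] with t ht
  rw [hform t ht.le]
  field_simp

end Covariance

/-! ### The variance of the departure process -/

section Variance

variable {lam : ℝ} (hlam : 0 < lam) {G : Measure ℝ} [IsProbabilityMeasure G]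
  (hG : ∀ᵐ x ∂G, 0 ≤ x) {ν : Measure (ℕ × ℝ)} [IsProbabilityMeasure ν]
  (h : StationaryLaw lam G ν) (hgr : Integrable growth ν)
include hlam hG h hgr

/-- The variance of `D t = A t + Q 0 - Q t`, in terms of the covariance of `Q t` with
`A t + Q 0`; `A t` and `Q 0` are independent. -/
lemma variance_departures {t : ℝ} (ht : 0 ≤ t) :
    variance (fun p : (ℕ × ℝ) × ((ℕ → ℝ) × (ℕ → ℝ)) =>
      (departures p.1.1 p.1.2 p.2.1 p.2.2 t : ℝ)) (ν.prod (inputLaw lam G)) =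
    lam * t + 2 * (∫ x, ((x.1 : ℝ) - ∫ x, (x.1 : ℝ) ∂ν) ^ 2 ∂ν) -
      2 * covar lam G ν (fun x => (x.1 : ℝ) - ∫ x, (x.1 : ℝ) ∂ν) t := by
  have := isProbabilityMeasure_expMeasure hlam
  unfold covar
  set m := ∫ x, (x.1 : ℝ) ∂ν with hm
  set P := ν.prod (inputLaw lam G) with hP
  have hmeas : Measurable fun p : (ℕ × ℝ) × ((ℕ → ℝ) × (ℕ → ℝ)) =>
      (departures p.1.1 p.1.2 p.2.1 p.2.2 t : ℝ) :=
    measurable_from_nat.comp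
      (measurable_departures (by fun_prop) (by fun_prop) (by fun_prop) (by fun_prop)
        measurable_const)
  have hD : (fun p : (ℕ × ℝ) × ((ℕ → ℝ) × (ℕ → ℝ)) =>
      (departures p.1.1 p.1.2 p.2.1 p.2.2 t : ℝ)) =ᵐ[P] fun p =>
      (((arrivalCount p.2.1 t : ℝ) - lam * t) + ((p.1.1 : ℝ) - m)) -
        (((stateAt t p).1 : ℝ) - m) + lam * t := by
    filter_upwards [h.ae_goodPath hlam hG] with p hp
    have h1 := hp.queueLength_eq ht
    have h2 := hp.departures_le ht
    have h3 : ((stateAt t p).1 : ℝ) = p.1.1 + arrivalCount p.2.1 t -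
        departures p.1.1 p.1.2 p.2.1 p.2.2 t := by
      have : (stateAt t p).1 = p.1.1 + arrivalCount p.2.1 t -
        departures p.1.1 p.1.2 p.2.1 p.2.2 t := h1
      rw [this, Nat.cast_sub h2, Nat.cast_add]
    rw [h3]; ring
  have hmq : Measurable fun x : ℕ × ℝ => (x.1 : ℝ) - m :=
    (measurable_from_nat.comp measurable_fst).sub_const m
  obtain ⟨iN, iN2, -⟩ := integrable_number h hgr
  have iq : Integrable (fun x : ℕ × ℝ => (x.1 : ℝ) - m) ν := iN.sub (integrable_const m)
  have eq0 : ∫ x, ((x.1 : ℝ) - m) ∂ν = 0 := by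
    rw [integral_sub iN (integrable_const m)]; simp [hm]
  have iq2 : Integrable (fun x : ℕ × ℝ => ((x.1 : ℝ) - m) ^ 2) ν := by
    have := (integrable_number_centered_sq hlam h hgr le_rfl m).1
    exact (h.integrable_stateAt_iff (hmq.pow_const 2) le_rfl).mp this
  have hA := integral_centered hlam ht
  have hA2 := integral_centered_sq hlam ht
  -- the centred arrival count, initial number and final number
  have a1 : Integrable (fun p : (ℕ × ℝ) × ((ℕ → ℝ) × (ℕ → ℝ)) =>
      (arrivalCount p.2.1 t : ℝ) - lam * t) P := (hA.1.comp_fst (iidLaw G)).comp_snd ν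
  have a1e : ∫ p, ((arrivalCount p.2.1 t : ℝ) - lam * t) ∂P = 0 := by
    rw [hP, integral_fun_snd (μ := ν) (ν := inputLaw lam G)
      (fun w => (arrivalCount w.1 t : ℝ) - lam * t),
      integral_fun_fst (μ := iidLaw (expMeasure lam)) (ν := iidLaw G)
      (fun ξ => (arrivalCount ξ t : ℝ) - lam * t), hA.2]
    simp
  have a2 : Integrable (fun p : (ℕ × ℝ) × ((ℕ → ℝ) × (ℕ → ℝ)) =>
      ((arrivalCount p.2.1 t : ℝ) - lam * t) ^ 2) P := integrable_centered_sq_prod hlam ht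
  have a2e : ∫ p, ((arrivalCount p.2.1 t : ℝ) - lam * t) ^ 2 ∂P = lam * t := by
    rw [hP, integral_fun_snd (μ := ν) (ν := inputLaw lam G)
      (fun w => ((arrivalCount w.1 t : ℝ) - lam * t) ^ 2),
      integral_fun_fst (μ := iidLaw (expMeasure lam)) (ν := iidLaw G)
      (fun ξ => ((arrivalCount ξ t : ℝ) - lam * t) ^ 2), hA2.2]
    simp
  have b1 : Integrable (fun p : (ℕ × ℝ) × ((ℕ → ℝ) × (ℕ → ℝ)) => (p.1.1 : ℝ) - m) P :=
    iq.comp_fst _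
  have b1e : ∫ p, ((p.1.1 : ℝ) - m) ∂P = 0 := by
    rw [hP, integral_fun_fst (μ := ν) (ν := inputLaw lam G) (fun x => (x.1 : ℝ) - m), eq0]
    simp
  have b2 : Integrable (fun p : (ℕ × ℝ) × ((ℕ → ℝ) × (ℕ → ℝ)) => ((p.1.1 : ℝ) - m) ^ 2) P :=
    iq2.comp_fst _
  have b2e : ∫ p, ((p.1.1 : ℝ) - m) ^ 2 ∂P = ∫ x, ((x.1 : ℝ) - m) ^ 2 ∂ν := by
    rw [hP, integral_fun_fst (μ := ν) (ν := inputLaw lam G) (fun x => ((x.1 : ℝ) - m) ^ 2)]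
    simp
  have ab : Integrable (fun p : (ℕ × ℝ) × ((ℕ → ℝ) × (ℕ → ℝ)) =>
      ((p.1.1 : ℝ) - m) * ((arrivalCount p.2.1 t : ℝ) - lam * t)) P :=
    iq.mul_prod (hA.1.comp_fst (iidLaw G))
  have abe : ∫ p, ((p.1.1 : ℝ) - m) * ((arrivalCount p.2.1 t : ℝ) - lam * t) ∂P = 0 := by
    rw [hP, integral_prod_mul (μ := ν) (ν := inputLaw lam G) (fun x => (x.1 : ℝ) - m)
      (fun w => (arrivalCount w.1 t : ℝ) - lam * t), eq0, zero_mul]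
  have c1 : Integrable (fun p : (ℕ × ℝ) × ((ℕ → ℝ) × (ℕ → ℝ)) => ((stateAt t p).1 : ℝ) - m) P :=
    (h.integrable_stateAt_iff hmq ht).mpr iq
  have c1e : ∫ p, (((stateAt t p).1 : ℝ) - m) ∂P = 0 := by
    rw [hP, h.integral_stateAt hmq ht, eq0]
  obtain ⟨c2, c2e⟩ := integrable_number_centered_sq hlam h hgr ht m
  have d := integrable_covar hlam h hgr hmq iq2 ht m
  have s1 : Integrable (fun p : (ℕ × ℝ) × ((ℕ → ℝ) × (ℕ → ℝ)) =>
      ((arrivalCount p.2.1 t : ℝ) - lam * t) + ((p.1.1 : ℝ) - m)) P := a1.add b1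
  have s2 : Integrable (fun p : (ℕ × ℝ) × ((ℕ → ℝ) × (ℕ → ℝ)) =>
      (((arrivalCount p.2.1 t : ℝ) - lam * t) + ((p.1.1 : ℝ) - m)) -
        (((stateAt t p).1 : ℝ) - m)) P := s1.sub c1
  rw [variance_eq_integral hmeas.aemeasurable, integral_congr_ae hD,
    integral_add s2 (integrable_const _), integral_sub s1 c1, integral_add a1 b1, a1e, b1e, c1e]
  have hsq : (fun p : (ℕ × ℝ) × ((ℕ → ℝ) × (ℕ → ℝ)) =>
      ((departures p.1.1 p.1.2 p.2.1 p.2.2 t : ℝ) -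
        (0 + 0 - 0 + ∫ _, lam * t ∂P)) ^ 2) =ᵐ[P] fun p =>
      (((arrivalCount p.2.1 t : ℝ) - lam * t) ^ 2 +
        2 * (((p.1.1 : ℝ) - m) * ((arrivalCount p.2.1 t : ℝ) - lam * t)) + ((p.1.1 : ℝ) - m) ^ 2) -
      2 * ((((arrivalCount p.2.1 t : ℝ) - lam * t) + ((p.1.1 : ℝ) - m)) *
        (((stateAt t p).1 : ℝ) - m)) + (((stateAt t p).1 : ℝ) - m) ^ 2 := by
    filter_upwards [hD] with p hp
    rw [hp, integral_const, probReal_univ, one_smul]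
    ring
  have t1 : Integrable (fun p : (ℕ × ℝ) × ((ℕ → ℝ) × (ℕ → ℝ)) =>
      ((arrivalCount p.2.1 t : ℝ) - lam * t) ^ 2 +
        2 * (((p.1.1 : ℝ) - m) * ((arrivalCount p.2.1 t : ℝ) - lam * t))) P :=
    a2.add (ab.const_mul 2)
  have t2 : Integrable (fun p : (ℕ × ℝ) × ((ℕ → ℝ) × (ℕ → ℝ)) =>
      ((arrivalCount p.2.1 t : ℝ) - lam * t) ^ 2 +
        2 * (((p.1.1 : ℝ) - m) * ((arrivalCount p.2.1 t : ℝ) - lam * t)) +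
          ((p.1.1 : ℝ) - m) ^ 2) P := t1.add b2
  have t3 : Integrable (fun p : (ℕ × ℝ) × ((ℕ → ℝ) × (ℕ → ℝ)) =>
      (((arrivalCount p.2.1 t : ℝ) - lam * t) ^ 2 +
        2 * (((p.1.1 : ℝ) - m) * ((arrivalCount p.2.1 t : ℝ) - lam * t)) + ((p.1.1 : ℝ) - m) ^ 2) -
      2 * ((((arrivalCount p.2.1 t : ℝ) - lam * t) + ((p.1.1 : ℝ) - m)) *
        (((stateAt t p).1 : ℝ) - m))) P := t2.sub (d.const_mul 2)
  rw [integral_congr_ae hsq, integral_add t3 c2, integral_sub t2 (d.const_mul 2),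
    integral_add t1 b2, integral_add a2 (ab.const_mul 2), integral_const_mul, integral_const_mul,
    a2e, abe, b2e, c2e]
  ring

/-- The centred number of customers is approximated in mean square by bounded functions. -/
lemma exists_bounded_approx {ε : ℝ} (hε : 0 < ε) (m : ℝ) :
    ∃ β : ℕ × ℝ → ℝ, Measurable β ∧ (∃ B, ∀ x, |β x| ≤ B) ∧ Integrable (fun x => β x ^ 2) ν ∧
      ∫ x, (((x.1 : ℝ) - m) - β x) ^ 2 ∂ν < ε := by
  obtain ⟨iN, iN2, -⟩ := integrable_number h hgr
  have hmn : Measurable fun x : ℕ × ℝ => (x.1 : ℝ) := measurable_from_nat.comp measurable_fst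
  have hlim : Tendsto (fun K : ℕ => ∫ x, (((x.1 : ℝ) - m) - (min (x.1 : ℝ) K - m)) ^ 2 ∂ν) atTop
      (nhds (∫ _, (0 : ℝ) ∂ν)) := by
    refine tendsto_integral_of_dominated_convergence (fun x => (x.1 : ℝ) ^ 2)
      (fun K => (((hmn.sub_const m).sub ((hmn.min measurable_const).sub_const m)).pow_const
        2).aestronglyMeasurable) iN2 (fun K => ?_) ?_
    · refine Eventually.of_forall fun x => ?_
      rw [Real.norm_of_nonneg (sq_nonneg _)]
      have h1 : min (x.1 : ℝ) K ≤ x.1 := min_le_left _ _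
      have h2 : 0 ≤ min (x.1 : ℝ) K := le_min (Nat.cast_nonneg _) (Nat.cast_nonneg _)
      exact pow_le_pow_left₀ (by linarith) (by linarith) 2
    · refine Eventually.of_forall fun x => tendsto_const_nhds.congr' ?_
      filter_upwards [eventually_ge_atTop x.1] with K hK
      rw [min_eq_left (by exact_mod_cast hK)]
      ring
  rw [integral_zero] at hlim
  obtain ⟨K, hK⟩ := (hlim.eventually_lt_const hε).exists
  have hβm : Measurable fun x : ℕ × ℝ => min (x.1 : ℝ) K - m :=
    (hmn.min measurable_const).sub_const m
  have hβb : ∀ x : ℕ × ℝ, |min (x.1 : ℝ) K - m| ≤ K + |m| := fun x => by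
    have h2 : 0 ≤ min (x.1 : ℝ) K := le_min (Nat.cast_nonneg _) (Nat.cast_nonneg _)
    refine (abs_sub _ _).trans ?_
    rw [abs_of_nonneg h2]
    gcongr
    exact min_le_right _ _
  refine ⟨fun x => min (x.1 : ℝ) K - m, hβm, ⟨_, hβb⟩, ?_, hK⟩
  refine Integrable.mono' (integrable_const ((K + |m|) ^ 2)) (hβm.pow_const 2).aestronglyMeasurable
    (Eventually.of_forall fun x => ?_)
  rw [Real.norm_of_nonneg (sq_nonneg _), ← sq_abs]
  exact pow_le_pow_left₀ (abs_nonneg _) (hβb x) 2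

end Variance

/-- A function with a linear asymptote whose averages converge, up to arbitrarily small uniform
errors, to `l` is asymptotically constant with limit `l`. -/
lemma intercept_eq_of_average {c : ℝ → ℝ} {a b l : ℝ}
    (hc : Tendsto (fun t => c t - (a * t + b)) atTop (nhds 0))
    (happ : ∀ ε > 0, ∃ g : ℝ → ℝ, (∀ t, 0 ≤ t → |c t - g t| ≤ ε) ∧
      (∀ t, 0 ≤ t → IntervalIntegrable g volume 0 t) ∧
      Tendsto (fun t => (∫ v in 0..t, g v) / t) atTop (nhds l)) : a = 0 ∧ b = l := by
  have key : Tendsto (fun t => a / 2 * t + b - l) atTop (nhds 0) := by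
    rw [Metric.tendsto_atTop]
    intro δ hδ
    obtain ⟨g, hg1, hg2, hg3⟩ := happ (δ / 8) (by positivity)
    obtain ⟨T, hT⟩ := Metric.tendsto_atTop.mp hc (δ / 8) (by positivity)
    set T' := max T 1 with hT'
    have hT'0 : 0 < T' := lt_of_lt_of_le one_pos (le_max_right _ _)
    obtain ⟨T₂, hT₂⟩ := Metric.tendsto_atTop.mp hg3 (δ / 4) (by positivity)
    -- the contribution of `[0, T']` to the average vanishes in the limit
    set I := (∫ v in 0..T', g v) - ∫ v in 0..T', (a * v + b) with hI
    have hfin : Tendsto (fun t : ℝ => I / t) atTop (nhds 0) :=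
      tendsto_const_nhds.div_atTop tendsto_id
    obtain ⟨T₃, hT₃⟩ := Metric.tendsto_atTop.mp hfin (δ / 4) (by positivity)
    refine ⟨max (max T' T₂) T₃, fun t ht => ?_⟩
    have ht1 : T' ≤ t := (le_max_left _ _).trans ((le_max_left _ _).trans ht)
    have ht2 : T₂ ≤ t := (le_max_right _ _).trans ((le_max_left _ _).trans ht)
    have ht3 : T₃ ≤ t := (le_max_right _ _).trans ht
    have ht0 : 0 < t := hT'0.trans_le ht1
    have e2 := hT₂ t ht2
    have e3 := hT₃ t ht3
    rw [Real.dist_eq] at e2 e3 ⊢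
    rw [sub_zero] at e3 ⊢
    have iaff : ∀ x y : ℝ, IntervalIntegrable (fun v : ℝ => a * v + b) volume x y := fun x y =>
      (by fun_prop : Continuous fun v : ℝ => a * v + b).intervalIntegrable x y
    have ig : IntervalIntegrable g volume T' t :=
      (hg2 T' hT'0.le).symm.trans (hg2 t ht0.le)
    have hdiff : |∫ v in T'..t, (g v - (a * v + b))| ≤ δ / 4 * |t - T'| := by
      have := intervalIntegral.norm_integral_le_of_norm_le_const (a := T') (b := t) (C := δ / 4)
        (f := fun v => g v - (a * v + b)) fun v hv => by
          rw [Set.uIoc_of_le ht1] at hv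
          have h1 := hg1 v (hT'0.trans hv.1).le
          have h2 := hT v ((le_max_left _ _).trans hv.1.le)
          rw [Real.dist_eq, sub_zero] at h2
          rw [Real.norm_eq_abs]
          have : g v - (a * v + b) = (c v - (a * v + b)) - (c v - g v) := by ring
          rw [this]
          refine (abs_sub _ _).trans ?_
          linarith
      simpa using this
    rw [intervalIntegral.integral_sub ig (iaff _ _)] at hdiff
    have s1 := intervalIntegral.integral_add_adjacent_intervals (hg2 T' hT'0.le) ig
    have s2 := intervalIntegral.integral_add_adjacent_intervals (iaff 0 T') (iaff T' t)
    have s3 : ∫ v in (0 : ℝ)..t, (a * v + b) = a * (t ^ 2 / 2) + b * t := by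
      have i1 : IntervalIntegrable (fun v : ℝ => a * v) volume 0 t :=
        (by fun_prop : Continuous fun v : ℝ => a * v).intervalIntegrable 0 t
      rw [intervalIntegral.integral_add i1 intervalIntegrable_const,
        intervalIntegral.integral_const_mul]
      simp
      ring
    have e4 : a / 2 * t + b - l = ((∫ v in (0 : ℝ)..t, g v) / t - l) - I / t -
        ((∫ v in T'..t, g v) - ∫ v in T'..t, (a * v + b)) / t := by
      rw [s3] at s2
      have s4 : (∫ v in (0 : ℝ)..t, g v) - I - ((∫ v in T'..t, g v) - ∫ v in T'..t, (a * v + b)) =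
          a * (t ^ 2 / 2) + b * t := by rw [hI]; linarith
      have s5 : a / 2 * t + b = (a * (t ^ 2 / 2) + b * t) / t := by field_simp
      rw [s5, ← s4]
      ring
    have e5 : |((∫ v in T'..t, g v) - ∫ v in T'..t, (a * v + b)) / t| ≤ δ / 4 := by
      rw [abs_div, abs_of_pos ht0, div_le_iff₀ ht0]
      refine hdiff.trans ?_
      rw [abs_of_nonneg (by linarith)]
      gcongr
      linarith
    rw [e4]
    refine ((abs_sub _ _).trans (add_le_add (abs_sub _ _) le_rfl)).trans_lt ?_
    linarith
  have hshift := key.comp (tendsto_atTop_add_const_right atTop (1 : ℝ) tendsto_id)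
  have hd := hshift.sub key
  have ha : a = 0 := by
    have e : ∀ t : ℝ, ((fun t => a / 2 * t + b - l) ∘ fun x => id x + 1) t -
        (a / 2 * t + b - l) = a / 2 := by
      intro t; simp only [Function.comp_apply, id]; ring
    simp only [e] at hd
    have := tendsto_nhds_unique hd tendsto_const_nhds
    linarith
  refine ⟨ha, ?_⟩
  rw [ha] at key
  simp only [zero_div, zero_mul, zero_add] at key
  have := tendsto_nhds_unique key tendsto_const_nhds
  linarith

/-! ### The intercept of the variance curve -/

section Intercept

variable {lam : ℝ} (hlam : 0 < lam) {G : Measure ℝ} [IsProbabilityMeasure G]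
  (hG : ∀ᵐ x ∂G, 0 ≤ x) (hG3 : Integrable (fun x : ℝ => x ^ 3) G)
  (hg1 : 0 < moment G 1) (hstab : lam * moment G 1 < 1)
  {ν : Measure (ℕ × ℝ)} [IsProbabilityMeasure ν] (h : StationaryLaw lam G ν)
  (hgr : Integrable growth ν)
include hlam hG hG3 hg1 hstab h hgr

/-- The intercept of the linear asymptote of the variance curve is twice the stationary variance
of the queue length minus twice the long-run average covariance of the queue length with the
arrival count. -/
theorem intercept_eq {vbar b : ℝ}
    (hv : Tendsto (fun t => variance (fun p : (ℕ × ℝ) × ((ℕ → ℝ) × (ℕ → ℝ)) =>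
      (departures p.1.1 p.1.2 p.2.1 p.2.2 t : ℝ)) (ν.prod (inputLaw lam G)) - (vbar * t + b))
      atTop (nhds 0)) :
    b = 2 * (∫ x, ((x.1 : ℝ) - ∫ x, (x.1 : ℝ) ∂ν) ^ 2 ∂ν) -
      2 * (lam * meanIncrement lam G / moment G 1) := by
  set m := ∫ x, (x.1 : ℝ) ∂ν with hm
  set V := ∫ x, ((x.1 : ℝ) - m) ^ 2 ∂ν with hV
  have hV0 : 0 ≤ V := integral_nonneg fun x => sq_nonneg _
  have hmq : Measurable fun x : ℕ × ℝ => (x.1 : ℝ) - m :=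
    (measurable_from_nat.comp measurable_fst).sub_const m
  have iq2 : Integrable (fun x : ℕ × ℝ => ((x.1 : ℝ) - m) ^ 2) ν :=
    (h.integrable_stateAt_iff (hmq.pow_const 2) le_rfl).mp
      (integrable_number_centered_sq hlam h hgr le_rfl m).1
  have hc : Tendsto (fun t => covar lam G ν (fun x => (x.1 : ℝ) - m) t -
      ((lam - vbar) / 2 * t + (V - b / 2))) atTop (nhds 0) := by
    have hv' := hv.const_mul (-1 / 2)
    rw [mul_zero] at hv'
    refine hv'.congr' ?_
    filter_upwards [eventually_ge_atTop 0] with t ht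
    rw [variance_departures hlam hG h hgr ht]
    ring
  have key := intercept_eq_of_average (l := lam * meanIncrement lam G / moment G 1) hc
    fun ε hε => by
      -- the two error terms of `abs_covar_sub_le` are each made at most `ε / 2`
      set η := ε / (V + 1) with hη
      have hη0 : 0 < η := by positivity
      obtain ⟨β, hβ, ⟨B, hB⟩, hβ2, happ⟩ := exists_bounded_approx hlam hG h hgr
        (ε := ε * η) (by positivity) m
      obtain ⟨a1, a2⟩ := tendsto_average_covar hlam hG hG3 hg1 hstab h hgr hβ hB
      refine ⟨covar lam G ν β, fun t ht => ?_, a1, a2⟩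
      refine (abs_covar_sub_le hlam h hgr hmq hβ iq2 hβ2 hη0 ht).trans ?_
      have e1 : (∫ x, (((x.1 : ℝ) - m) - β x) ^ 2 ∂ν) / (2 * η) ≤ ε / 2 := by
        rw [div_le_iff₀ (by positivity)]
        linarith
      have e2 : η / 2 * V ≤ ε / 2 := by
        have : η * V ≤ ε := by
          rw [hη, div_mul_eq_mul_div, div_le_iff₀ (by positivity)]
          nlinarith
        linarith
      linarith
  linarith [key.2]

/-- The stationary variance of the number of customers. -/
lemma variance_number :
    ∫ x, ((x.1 : ℝ) - ∫ x, (x.1 : ℝ) ∂ν) ^ 2 ∂ν =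
      lam ^ 3 * moment G 3 / (3 * (1 - lam * moment G 1)) +
      (lam * meanWork lam G) ^ 2 + lam * moment G 1 * (1 - lam * moment G 1) +
      lam ^ 2 * moment G 2 * (3 - 2 * lam * moment G 1) / (2 * (1 - lam * moment G 1)) := by
  obtain ⟨iN, iN2, e1, e2⟩ := integrable_number h hgr
  set m := ∫ x, (x.1 : ℝ) ∂ν with hm
  have eV : ∫ x, ((x.1 : ℝ) - m) ^ 2 ∂ν = (∫ x, (x.1 : ℝ) ^ 2 ∂ν) - m ^ 2 := by
    have e : ∀ x : ℕ × ℝ, ((x.1 : ℝ) - m) ^ 2 = ((x.1 : ℝ) ^ 2 - 2 * m * x.1) + m ^ 2 := fun x => by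
      ring
    have i1 : Integrable (fun x : ℕ × ℝ => (x.1 : ℝ) ^ 2 - 2 * m * x.1) ν :=
      iN2.sub (iN.const_mul _)
    rw [integral_congr_ae (Eventually.of_forall e), integral_add i1 (integrable_const _),
      integral_sub iN2 (iN.const_mul _), integral_const_mul, ← hm, integral_const, probReal_univ,
      one_smul]
    ring
  have hB := integral_busy hlam hG hG3 h hgr
  have hR := integral_residual hlam hG hG3 h hgr
  have hY := integral_numWaiting hlam hG hG3 h hgr hstab
  have hR2 := integral_residual_sq hlam hG hG3 h hgr
  have hRY := integral_residual_mul hlam hG hG3 h hgr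
  have hW := integral_workSq hlam hG hG3 h hgr hstab
  have hW' := integral_workSq_eq hlam hG hG3 h hgr
  rw [eV, e2]
  rw [hB] at e1 ⊢
  rw [e1]
  rw [hW, hR2, hRY, hR2] at hW'
  rw [hR] at hY
  set Y := ∫ x, (numWaiting x : ℝ) ∂ν
  set Y2 := ∫ x, (numWaiting x : ℝ) ^ 2 ∂ν
  clear_value Y Y2
  unfold meanWork at *
  generalize moment G 1 = g₁ at *
  generalize moment G 2 = g₂ at *
  generalize moment G 3 = g₃ at *
  have h1 : (1 : ℝ) - lam * g₁ ≠ 0 := by linarith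
  have hYe : Y = lam ^ 2 * g₂ / (2 * (1 - lam * g₁)) := by
    have : g₁ * Y = g₁ * (lam ^ 2 * g₂ / (2 * (1 - lam * g₁))) := by
      rw [eq_sub_of_add_eq' hY]
      field_simp
      ring
    exact mul_left_cancel₀ hg1.ne' this
  have hY2 : Y2 = 2 * (lam ^ 2 * g₂ / (2 * (1 - lam * g₁))) ^ 2 +
      lam ^ 3 * g₃ / (3 * (1 - lam * g₁)) + lam ^ 2 * g₂ / (2 * (1 - lam * g₁)) := by
    have : g₁ ^ 2 * Y2 = g₁ ^ 2 * (2 * (lam ^ 2 * g₂ / (2 * (1 - lam * g₁))) ^ 2 +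
      lam ^ 3 * g₃ / (3 * (1 - lam * g₁)) + lam ^ 2 * g₂ / (2 * (1 - lam * g₁))) := by
      rw [hYe] at hW'
      rw [eq_sub_of_add_eq' (eq_sub_of_add_eq hW'.symm)]
      field_simp
      ring
    exact mul_left_cancel₀ (by positivity) this
  rw [hY2, hYe]
  field_simp
  ring

end Intercept

section Shape

variable {G : Measure ℝ} [IsProbabilityMeasure G] (hG : ∀ᵐ x ∂G, 0 ≤ x)
  (hG3 : Integrable (fun x : ℝ => x ^ 3) G) (hg1 : 0 < moment G 1)
include hG hG3 hg1

lemma cv_sq : cv G ^ 2 = moment G 2 / moment G 1 ^ 2 - 1 := by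
  unfold cv
  rw [Real.sq_sqrt, scv]
  unfold scv
  have hv := sq_moment_le hG (integrable_pow hG hG3 (k := 2) (by norm_num))
    (by simpa using integrable_pow hG hG3 (k := 1) (by norm_num))
  rw [sub_nonneg, le_div_iff₀ (by positivity), one_mul]
  exact hv

/-- A distribution with zero variance is a point mass. -/
lemma moment_three_of_degenerate (h0 : moment G 2 = moment G 1 ^ 2) :
    moment G 3 = moment G 1 ^ 3 := by
  have i2 := integrable_pow hG hG3 (k := 2) (by norm_num)
  have i1 : Integrable (fun x : ℝ => x) G := by
    simpa using integrable_pow hG hG3 (k := 1) (by norm_num)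
  set m := moment G 1 with hm
  have e1 : ∫ x, x ∂G = m := by simp [hm, moment]
  have e2 : ∫ x, x ^ 2 ∂G = m ^ 2 := h0
  have e : ∀ x : ℝ, (x - m) ^ 2 = (x ^ 2 - 2 * m * x) + m ^ 2 := fun x => by ring
  have i3 : Integrable (fun x : ℝ => x ^ 2 - 2 * m * x) G := i2.sub (i1.const_mul _)
  have i4 : Integrable (fun x : ℝ => (x - m) ^ 2) G :=
    (i3.add (integrable_const (m ^ 2))).congr (Eventually.of_forall fun x => (e x).symm)
  have hz : ∫ x, (x - m) ^ 2 ∂G = 0 := by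
    rw [integral_congr_ae (Eventually.of_forall e), integral_add i3 (integrable_const _),
      integral_sub i2 (i1.const_mul _), integral_const_mul, integral_const, probReal_univ,
      one_smul, e1, e2]
    ring
  have hae := (integral_eq_zero_iff_of_nonneg (fun x => sq_nonneg _) i4).mp hz
  have : ∫ x, x ^ 3 ∂G = ∫ _, m ^ 3 ∂G := by
    refine integral_congr_ae ?_
    filter_upwards [hae] with x hx
    have : x - m = 0 := by simpa using hx
    rw [sub_eq_zero.mp this]
  rw [moment, this]
  simp

/-- The product `γ c³`, also in the degenerate case, where both sides vanish. -/
lemma skewness_mul_cv_cube : skewness G * cv G ^ 3 =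
    (2 * moment G 1 ^ 3 - 3 * moment G 1 * moment G 2 + moment G 3) / moment G 1 ^ 3 := by
  have hc := cv_sq hG hG3 hg1
  have hc0 : 0 ≤ cv G := Real.sqrt_nonneg _
  have hv : moment G 2 - moment G 1 ^ 2 = (moment G 1 * cv G) ^ 2 := by
    rw [mul_pow, hc]
    field_simp
  rcases hc0.eq_or_lt with h0 | h0
  · have h2 : moment G 2 = moment G 1 ^ 2 := by
      rw [← h0] at hv
      linarith
    rw [← h0, h2, moment_three_of_degenerate hG hG3 hg1 h2]
    ring
  · have hp : (moment G 2 - moment G 1 ^ 2) ^ (3 / 2 : ℝ) = (moment G 1 * cv G) ^ 3 := by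
      rw [hv, ← Real.rpow_natCast, ← Real.rpow_mul (by positivity), ← Real.rpow_natCast]
      norm_num
    rw [skewness, hp, mul_pow]
    field_simp

end Shape

end MG1

end

theorem mainTheorem1 {Ω : Type*} [MeasurableSpace Ω] (μ : Measure Ω) [IsProbabilityMeasure μ]
    -- the arrival rate and the service-time distribution, a probability measure on `[0, ∞)`
    (lam : ℝ) (hlam : 0 < lam)
    (G : Measure ℝ) [IsProbabilityMeasure G] (hG : ∀ᵐ x ∂G, 0 ≤ x)
    (hg₁ : 0 < MG1.moment G 1) (hg₃ : Integrable (fun x : ℝ => x ^ 3) G)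
    -- the traffic intensity `ρ = λ g₁`, and stability
    (ρ : ℝ) (hρ : ρ = lam * MG1.moment G 1) (hstable : ρ < 1)
    -- a stationary M/G/1 queue
    (q₀ : Ω → ℕ) (r₀ : Ω → ℝ) (ξ S : ℕ → Ω → ℝ)
    (hQ : MG1.IsStationary μ lam G q₀ r₀ ξ S)
    -- the variance curve of the departures has a linear asymptote
    (vbar b : ℝ)
    (hasymp : (fun t : ℝ => MG1.varianceCurve μ q₀ r₀ ξ S t - (vbar * t + b))
      =o[atTop] (fun _ => (1 : ℝ)))
    -- the squared coefficient of variation is `c ^ 2`, the skewness coefficient is `γ`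
    (c γ : ℝ) (hc : c = MG1.cv G) (hγ : γ = MG1.skewness G) :
    b = ((3 * c ^ 4 - 4 * γ * c ^ 3 + 6 * c ^ 2 - 1) * ρ ^ 3
          + (4 * γ * c ^ 3 - 12 * c ^ 2 + 4) * ρ ^ 2
          + (6 * c ^ 2 - 6) * ρ) / 6 * (ρ / (1 - ρ) ^ 2) := by
  have hstab : lam * MG1.moment G 1 < 1 := hρ ▸ hstable
  have hmeas : Measurable fun ω => (q₀ ω, r₀ ω) := hQ.measurable_q₀.prodMk hQ.measurable_r₀
  have : IsProbabilityMeasure (μ.map fun ω => (q₀ ω, r₀ ω)) :=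
    Measure.isProbabilityMeasure_map hmeas.aemeasurable
  have h := hQ.stationaryLaw hlam
  have hgr := MG1.integrable_growth hlam hG hg₃ hg₁ hstab h
  have hv := (isLittleO_one_iff ℝ).mp hasymp
  simp only [hQ.varianceCurve_eq hlam] at hv
  rw [MG1.intercept_eq hlam hG hg₃ hg₁ hstab h hgr hv,
    MG1.variance_number hlam hG hg₃ hg₁ hstab h hgr]
  have e2 := MG1.cv_sq hG hg₃ hg₁
  have e3 := MG1.skewness_mul_cv_cube hG hg₃ hg₁
  rw [← hc] at e2 e3
  rw [← hγ] at e3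
  have e4 : c ^ 4 = (MG1.moment G 2 / MG1.moment G 1 ^ 2 - 1) ^ 2 := by rw [← e2]; ring
  have h1 : 1 - lam * MG1.moment G 1 ≠ 0 := by linarith
  rw [mul_assoc 4 γ, e3, e4, e2, hρ, MG1.meanIncrement, MG1.meanWork]
  field_simp
  ring
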